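/- **Setting.** Let $d\in\{1,2,3\}$, let $\Omega\subset\mathbb R^d$ be a bounded open set (for instance a bounded Lipschitz domain), $T>0$, $Q=\Omega\times(0,T)$, $\omega=2\pi/T$, $\lambda>0$, $\boldsymbol g_d\in[L^2(Q)]^d$, and let $\sigma,\nu$ be measurable with $0<\underline\sigma\le\sigma(\boldsymbol x)\le\overline\sigma$ and $0<\underline\nu\le\nu(\boldsymbol x)\le\overline\nu$ for $\boldsymbol x\in\Omega$. Write $\|\cdot\|$ for the norm of $L^2(Q)$, let $C_F>0$ be a constant with $\|w\|_{L^2(\Omega)}\le C_F\|\nabla w\|_{L^2(\Omega)}$ for all $w\in H^1_0(\Omega)$, and put $\mu_1=\tfrac1{\sqrt2}\min\{\underline\nu,\underline\sigma\}$. Let $H^{1,0}_0(Q)$ be the closure of $C_c^\infty(Q)$ under $(\|u\|^2+\|\nabla u\|^2)^{1/2}$, where $\nabla$ is the spatial gradient (functions vanishing on $\partial\Omega\times(0,T)$); $H^{1,1}_{0,per}(Q)$ the set of $u\in H^{1,0}_0(Q)$ with $\partial_t u\in L^2(Q)$ and $u(0)=u(T)$; $H(\mathrm{div},Q)$ the set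 of $\boldsymbol\tau\in[L^2(Q)]^d$ with weak spatial divergence $\nabla\cdot\boldsymbol\tau\in L^2(Q)$. With the Fourier coefficients $u_k^c=\frac2T\int_0^Tu\cos(k\omega t)\,dt$, $u_k^s=\frac2T\int_0^Tu\sin(k\omega t)\,dt$, let $H^{1,1/2}_{0,per}(Q)$ be the set of $u\in H^{1,0}_0(Q)$ with $\sum_{k\ge1}k\omega(\|u_k^c\|_{L^2(\Omega)}^2+\|u_k^s\|_{L^2(\Omega)}^2)<\infty$, and for $u,v$ in it put $$\langle\sigma\partial_t^{1/2}u,\partial_t^{1/2}v^\perp\rangle=\frac T2\sum_{k\ge1}k\omega\int_\Omega\sigma\,(u_k^s v_k^c-u_k^c v_k^s)\,d\boldsymbol x$$ (which equals $\langle\sigma\partial_tu,v\rangle$ if $u\in H^{1,1}_{0,per}(Q)$). **Problem.** Minimize $\tilde{\mathcal J}(y,u)=\frac12\|\nabla y-\boldsymbol g_d\|^2+\frac\lambda2\|u\|^2$ over $u\in L^2(Q)$ and the weak solutions $y\in H^{1,1/2}_{0,per}(Q)$ of $\sigma\partial_ty-\nabla\cdot(\nu\nabla y)=u$ in $Q$,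 $y=0$ on $\partial\Omega\times(0,T)$, $y(0)=y(T)$, that is, $$\int_Q\nu\nabla y\cdot\nabla q+\langle\sigma\partial_t^{1/2}y,\partial_t^{1/2}q^\perp\rangle=\int_Qu\,q\qquad\forall q\in H^{1,1/2}_{0,per}(Q).$$ The optimality system asks for $y,p\in H^{1,1/2}_{0,per}(Q)$ such that, for all $z,q\in H^{1,1/2}_{0,per}(Q)$, $$\int_Q(\nabla y\cdot\nabla z-\nu\nabla p\cdot\nabla z)+\langle\sigma\partial_t^{1/2}p,\partial_t^{1/2}z^\perp\rangle=\int_Q\boldsymbol g_d\cdot\nabla z,\qquad \int_Q(\nu\nabla y\cdot\nabla q+\lambda^{-1}p\,q)+\langle\sigma\partial_t^{1/2}y,\partial_t^{1/2}q^\perp\rangle=0.$$ **Minorant.** For $\eta,\zeta\in H^{1,1}_{0,per}(Q)$ and $\boldsymbol\tau,\boldsymbol\rho\in H(\mathrm{div},Q)$ put $$\mathcal R_1=\sigma\partial_t\eta-\nabla\cdot\boldsymbol\tau+\lambda^{-1}\zeta,\quad \mathcal R_2=\boldsymbol\tau-\nu\nabla\eta,\quad \mathcal R_3=\nabla\cdot\boldsymbol\rho+\sigma\partial_t\zeta,\quad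 \mathcal R_4=\boldsymbol\rho-\nu\nabla\zeta+\nabla\eta-\boldsymbol g_d,$$ $$\tilde{\mathcal J}^\ominus(\eta,\zeta,\boldsymbol\tau,\boldsymbol\rho)=\tfrac12\|\nabla\eta-\boldsymbol g_d\|^2+\tfrac1{2\lambda}\|\zeta\|^2-\int_Q\big(\nu\nabla\eta\cdot\nabla\zeta+\sigma\partial_t\eta\,\zeta+\lambda^{-1}\zeta^2\big)$$ $$-\frac{C_F^2}{\mu_1^2\lambda}\big(C_F\|\mathcal R_3\|+\|\mathcal R_4\|\big)^2-\frac1{\mu_1}\big(C_F\|\mathcal R_1\|+\|\mathcal R_2\|\big)\big(C_F\|\mathcal R_3\|+\|\mathcal R_4\|\big).$$ **Theorem.** The problem has an optimal pair, and $(y,u)$ is optimal if and only if $u=-\lambda^{-1}p$ for some $p$ such that $(y,p)$ solves the optimality system. For every optimal pair $(y(u),u)$, $$\tilde{\mathcal J}(y(u),u)\ge\tilde{\mathcal J}^\ominus(\eta,\zeta,\boldsymbol\tau,\boldsymbol\rho)\qquad\forall\,\eta,\zeta\in H^{1,1}_{0,per}(Q),\ \boldsymbol\tau,\boldsymbol\rho\in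 H(\mathrm{div},Q),$$ $$\sup_{\eta,\zeta\in H^{1,1}_{0,per}(Q),\ \boldsymbol\tau,\boldsymbol\rho\in H(\mathrm{div},Q)}\tilde{\mathcal J}^\ominus(\eta,\zeta,\boldsymbol\tau,\boldsymbol\rho)=\tilde{\mathcal J}(y(u),u).$$ Moreover, if $(y,p)$ solves the optimality system and $p\in H^{1,1}_{0,per}(Q)$, then $y\in H^{1,1}_{0,per}(Q)$, the fields $\nu\nabla y$ and $\nu\nabla p-(\nabla y-\boldsymbol g_d)$ belong to $H(\mathrm{div},Q)$, and the supremum is attained at $\eta=y$, $\zeta=p$, $\boldsymbol\tau=\nu\nabla y$, $\boldsymbol\rho=\nu\nabla p-(\nabla y-\boldsymbol g_d)$. -/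

import Mathlib

open MeasureTheory Filter Topology Set
open scoped ContDiff ENNReal

noncomputable section

namespace ParabolicOC

/-- Points of the spatial space `ℝ^d` with the Euclidean norm. -/
abbrev Space (d : ℕ) : Type := EuclideanSpace ℝ (Fin d)

variable {d : ℕ}

/-- The space-time cylinder `Q = Ω × (0,T)`. -/
def cyl (Ω : Set (Space d)) (T : ℝ) : Set (Space d × ℝ) := Ω ×ˢ Ioo 0 T

/-- Lebesgue measure on `Q`. -/
def muQ (Ω : Set (Space d)) (T : ℝ) : Measure (Space d × ℝ) := volume.restrict (cyl Ω T)

/-- The `L²` norm (meaningful for `f ∈ L²(μ)`). -/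
def l2norm {α F : Type*} [MeasurableSpace α] [NormedAddCommGroup F]
    (μ : Measure α) (f : α → F) : ℝ := (eLpNorm f 2 μ).toReal

/-- `φ ∈ C_c^∞(U)`, extended by zero to the whole space. -/
def IsTest {X : Type*} [NormedAddCommGroup X] [NormedSpace ℝ X] (U : Set X) (φ : X → ℝ) : Prop :=
  ContDiff ℝ ∞ φ ∧ HasCompactSupport φ ∧ tsupport φ ⊆ U

/-- The classical spatial gradient of a function of `(x,t)`. -/
def gradX (φ : Space d × ℝ → ℝ) (z : Space d × ℝ) : Space d :=
  gradient (fun x => φ (x, z.2)) z.1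

/-- The classical time derivative of a function of `(x,t)`. -/
def derivT (φ : Space d × ℝ → ℝ) (z : Space d × ℝ) : ℝ :=
  deriv (fun t => φ (z.1, t)) z.2

/-- `u ∈ H^{1,0}_0(Q)` with weak spatial gradient `G ∈ [L²(Q)]^d`: the pair `(u, G)` is an
`L²(Q)`-limit of pairs `(φₙ, ∇φₙ)` with `φₙ ∈ C_c^∞(Q)`. In particular `∇u = G` weakly and `u`
vanishes on the lateral surface. -/
def IsH10Zero (Ω : Set (Space d)) (T : ℝ) (u : Space d × ℝ → ℝ) (G : Space d × ℝ → Space d) :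
    Prop :=
  MemLp u 2 (muQ Ω T) ∧ MemLp G 2 (muQ Ω T) ∧
    ∃ φ : ℕ → Space d × ℝ → ℝ, (∀ n, IsTest (cyl Ω T) (φ n)) ∧
      Tendsto (fun n => eLpNorm (fun z => φ n z - u z) 2 (muQ Ω T)) atTop (𝓝 0) ∧
      Tendsto (fun n => eLpNorm (fun z => gradX (φ n) z - G z) 2 (muQ Ω T)) atTop (𝓝 0)

/-- `u ∈ L²(Q)` has the weak time derivative `ut ∈ L²(Q)` and the time traces `u(0) = w₀`,
`u(T) = w₁`, expressed by integration by parts in time against functions in `C_c^∞(Ω × ℝ)`. -/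
def HasTimeDerivTraces (Ω : Set (Space d)) (T : ℝ) (u ut : Space d × ℝ → ℝ)
    (w₀ w₁ : Space d → ℝ) : Prop :=
  ∀ φ : Space d × ℝ → ℝ, IsTest (Ω ×ˢ (univ : Set ℝ)) φ →
    ∫ z, u z * derivT φ z ∂(muQ Ω T) =
      -(∫ z, ut z * φ z ∂(muQ Ω T))
        + (∫ x in Ω, w₁ x * φ (x, T)) - ∫ x in Ω, w₀ x * φ (x, 0)

/-- `u ∈ H^{0,1}_{per}(Q)` with weak time derivative `ut`: the traces `u(0)` and `u(T)` agree. -/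
def IsH01Per (Ω : Set (Space d)) (T : ℝ) (u ut : Space d × ℝ → ℝ) : Prop :=
  MemLp u 2 (muQ Ω T) ∧ MemLp ut 2 (muQ Ω T) ∧
    ∃ w : Space d → ℝ, MemLp w 2 (volume.restrict Ω) ∧ HasTimeDerivTraces Ω T u ut w w

/-- The space `H^{1,1}_{0,per}(Q)`; an element carries its (a.e. unique) weak derivatives. -/
structure H11ZeroPer (Ω : Set (Space d)) (T : ℝ) where
  val : Space d × ℝ → ℝ
  grad : Space d × ℝ → Space d
  dt : Space d × ℝ → ℝ
  isH10Zero : IsH10Zero Ω T val grad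
  isH01Per : IsH01Per Ω T val dt

/-- The space `H(div,Q)`; an element carries its (a.e. unique) weak spatial divergence in `L²(Q)`. -/
structure HDiv (Ω : Set (Space d)) (T : ℝ) where
  val : Space d × ℝ → Space d
  div : Space d × ℝ → ℝ
  memLp_val : MemLp val 2 (muQ Ω T)
  memLp_div : MemLp div 2 (muQ Ω T)
  weak_div : ∀ φ : Space d × ℝ → ℝ, IsTest (cyl Ω T) φ →
    ∫ z, inner ℝ (val z) (gradX φ z) ∂(muQ Ω T) = -∫ z, div z * φ z ∂(muQ Ω T)

/-- The frequency `ω = 2π/T`. -/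
def freq (T : ℝ) : ℝ := 2 * Real.pi / T

/-- The Fourier coefficient `u_k^c(x) = (2/T) ∫₀ᵀ u(x,t) cos(kωt) dt` (used for `k ≥ 1`). -/
def cosCoeff (T : ℝ) (u : Space d × ℝ → ℝ) (k : ℕ) (x : Space d) : ℝ :=
  2 / T * ∫ t in Ioo 0 T, u (x, t) * Real.cos (k * freq T * t)

/-- The Fourier coefficient `u_k^s(x) = (2/T) ∫₀ᵀ u(x,t) sin(kωt) dt`. -/
def sinCoeff (T : ℝ) (u : Space d × ℝ → ℝ) (k : ℕ) (x : Space d) : ℝ :=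
  2 / T * ∫ t in Ioo 0 T, u (x, t) * Real.sin (k * freq T * t)

/-- The space `H^{1,1/2}_{0,per}(Q)` of all `u ∈ H^{1,0}_0(Q)` with
`‖∂_t^{1/2} u‖² = (T/2) ∑_{k ≥ 1} kω (‖u_k^c‖²_Ω + ‖u_k^s‖²_Ω) < ∞`. -/
structure H1HalfZeroPer (Ω : Set (Space d)) (T : ℝ) where
  val : Space d × ℝ → ℝ
  grad : Space d × ℝ → Space d
  isH10Zero : IsH10Zero Ω T val grad
  half_deriv : Summable fun k : ℕ => (k : ℝ) * freq T *
    (l2norm (volume.restrict Ω) (cosCoeff T val k) ^ 2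
      + l2norm (volume.restrict Ω) (sinCoeff T val k) ^ 2)

/-- The bilinear form
`⟨σ ∂_t^{1/2} u, ∂_t^{1/2} v^⊥⟩ = (T/2) ∑_{k ≥ 1} kω ∫_Ω σ u_k · v_k^⊥`, where
`u_k = (u_k^c, u_k^s)` and `v_k^⊥ = (-v_k^s, v_k^c)`. It equals `⟨σ ∂_t u, v⟩` when
`u ∈ H^{0,1}_{per}(Q)`. -/
def halfForm (Ω : Set (Space d)) (T : ℝ) (σ : Space d → ℝ) (u v : Space d × ℝ → ℝ) : ℝ :=
  T / 2 * ∑' k : ℕ, (k : ℝ) * freq T *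
    ∫ x in Ω, σ x * (cosCoeff T u k x * (-sinCoeff T v k x) + sinCoeff T u k x * cosCoeff T v k x)

/-- `y ∈ H^{1,1/2}_{0,per}(Q)` is the weak solution of the time-periodic problem
`σ ∂_t y - ∇·(ν∇y) = u` in `Q`, `y = 0` on `Σ`, `y(0) = y(T)`. -/
def IsState (Ω : Set (Space d)) (T : ℝ) (σ ν : Space d → ℝ) (y : H1HalfZeroPer Ω T)
    (u : Space d × ℝ → ℝ) : Prop :=
  ∀ q : H1HalfZeroPer Ω T,
    (∫ z, ν z.1 * inner ℝ (y.grad z) (q.grad z) ∂(muQ Ω T)) + halfForm Ω T σ y.val q.val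
      = ∫ z, u z * q.val z ∂(muQ Ω T)

/-- The cost functional `(1/2)‖∇y - g_d‖² + (λ/2)‖u‖²`. -/
def cost (Ω : Set (Space d)) (T lam : ℝ) (gd : Space d × ℝ → Space d) (y : H1HalfZeroPer Ω T)
    (u : Space d × ℝ → ℝ) : ℝ :=
  1 / 2 * l2norm (muQ Ω T) (fun z => y.grad z - gd z) ^ 2 + lam / 2 * l2norm (muQ Ω T) u ^ 2

/-- `(y,u)` minimizes the cost functional over all controls in `L²(Q)` and their states. -/
def IsOptimal (Ω : Set (Space d)) (T : ℝ) (σ ν : Space d → ℝ) (lam : ℝ)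
    (gd : Space d × ℝ → Space d) (y : H1HalfZeroPer Ω T) (u : Space d × ℝ → ℝ) : Prop :=
  MemLp u 2 (muQ Ω T) ∧ IsState Ω T σ ν y u ∧
    ∀ (y' : H1HalfZeroPer Ω T) (u' : Space d × ℝ → ℝ), MemLp u' 2 (muQ Ω T) →
      IsState Ω T σ ν y' u' → cost Ω T lam gd y u ≤ cost Ω T lam gd y' u'

/-- The weak optimality system for the state `y` and the adjoint state `p`. -/
def OptimalitySystem (Ω : Set (Space d)) (T : ℝ) (σ ν : Space d → ℝ) (lam : ℝ)
    (gd : Space d × ℝ → Space d) (y p : H1HalfZeroPer Ω T) : Prop :=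
  (∀ v : H1HalfZeroPer Ω T,
    (∫ z, (inner ℝ (y.grad z) (v.grad z) - ν z.1 * inner ℝ (p.grad z) (v.grad z)) ∂(muQ Ω T))
        + halfForm Ω T σ p.val v.val
      = ∫ z, inner ℝ (gd z) (v.grad z) ∂(muQ Ω T)) ∧
  (∀ q : H1HalfZeroPer Ω T,
    (∫ z, (ν z.1 * inner ℝ (y.grad z) (q.grad z) + lam⁻¹ * p.val z * q.val z) ∂(muQ Ω T))
        + halfForm Ω T σ y.val q.val = 0)

/-- `C` is a constant in Friedrichs' inequality `‖w‖_Ω ≤ C ‖∇w‖_Ω`; by density, its validity on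
`C_c^∞(Ω)` is the same as its validity on `H^1_0(Ω)`. -/
def IsFriedrichsConst (Ω : Set (Space d)) (C : ℝ) : Prop :=
  0 < C ∧ ∀ φ : Space d → ℝ, IsTest Ω φ →
    l2norm (volume.restrict Ω) φ ≤ C * l2norm (volume.restrict Ω) (gradient φ)

/-- `R₁(η,τ,v) = σ ∂_t η - ∇·τ - v`. -/
def res1 {Ω : Set (Space d)} {T : ℝ} (σ : Space d → ℝ) (η : H11ZeroPer Ω T) (τ : HDiv Ω T)
    (v : Space d × ℝ → ℝ) (z : Space d × ℝ) : ℝ :=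
  σ z.1 * η.dt z - τ.div z - v z

/-- `R₂(η,τ) = τ - ν∇η`. -/
def res2 {Ω : Set (Space d)} {T : ℝ} (ν : Space d → ℝ) (η : H11ZeroPer Ω T) (τ : HDiv Ω T)
    (z : Space d × ℝ) : Space d :=
  τ.val z - ν z.1 • η.grad z

/-- `R₃(ζ,ρ) = ∇·ρ + σ ∂_t ζ`. -/
def res3 {Ω : Set (Space d)} {T : ℝ} (σ : Space d → ℝ) (ζ : H11ZeroPer Ω T) (ρ : HDiv Ω T)
    (z : Space d × ℝ) : ℝ :=
  ρ.div z + σ z.1 * ζ.dt z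

/-- `R₄(ζ,ρ,η) = ρ - ν∇ζ + ∇η - g_d`. -/
def res4 {Ω : Set (Space d)} {T : ℝ} (ν : Space d → ℝ) (gd : Space d × ℝ → Space d)
    (ζ : H11ZeroPer Ω T) (ρ : HDiv Ω T) (η : H11ZeroPer Ω T) (z : Space d × ℝ) : Space d :=
  ρ.val z - ν z.1 • ζ.grad z + (η.grad z - gd z)

/-- The constant `μ₁ = min {ν_low, σ_low} / √2`. -/
def mu1 (νlow σlow : ℝ) : ℝ := 1 / √2 * min νlow σlow

/-- The minorant; `CF` is the Friedrichs constant and `μ₁` the constant `mu1`. -/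
def minorant {Ω : Set (Space d)} {T : ℝ} (σ ν : Space d → ℝ) (lam CF μ₁ : ℝ)
    (gd : Space d × ℝ → Space d) (η ζ : H11ZeroPer Ω T) (τ ρ : HDiv Ω T) : ℝ :=
  1 / 2 * l2norm (muQ Ω T) (fun z => η.grad z - gd z) ^ 2
    + 1 / (2 * lam) * l2norm (muQ Ω T) ζ.val ^ 2
    - (∫ z, (ν z.1 * inner ℝ (η.grad z) (ζ.grad z) + σ z.1 * η.dt z * ζ.val z
        + lam⁻¹ * ζ.val z ^ 2) ∂(muQ Ω T))
    - CF ^ 2 / (μ₁ ^ 2 * lam) *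
        (CF * l2norm (muQ Ω T) (res3 σ ζ ρ) + l2norm (muQ Ω T) (res4 ν gd ζ ρ η)) ^ 2
    - 1 / μ₁ *
        (CF * l2norm (muQ Ω T) (res1 σ η τ (fun z => -lam⁻¹ * ζ.val z))
          + l2norm (muQ Ω T) (res2 ν η τ)) *
        (CF * l2norm (muQ Ω T) (res3 σ ζ ρ) + l2norm (muQ Ω T) (res4 ν gd ζ ρ η))

end ParabolicOC

end

noncomputable section

set_option linter.unusedSectionVars false

namespace ParabolicOC

/-! ### The Hartley basis of `L²(0,T)` -/

/-! Everything is expanded in time in the Hartley functions e_j, j ∈ ℤ, a real orthonormal basis of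
L²(0,T) with e_j' = jω e_{-j}. Multiplication by σ(x) or ν(x) and the spatial gradient act on each
coefficient separately (`coeff_mulL`, `InWQ.coeff`, `inWQ_of_coeff`), the half-order form becomes
the skew series `half`, and the optimality system splits into independent systems for the pairs (j,
-j) (`OptSys.modeSystem`, `ModeSystem.optSys`).

Existence: each pair system is a saddle point problem that Lax–Milgram solves after testing with (y
- δp, p) (`exists_saddle`); energy bounds uniform in j allow the solutions to be summed
(`exists_optSys`). Testing the state equation crosswise, mode j against y_{-j}, bounds |jω|‖y_j‖ by
the modes of p (`ModeSystem.freq_norm_y_le`). Hence ∂_t y ∈ L²(Q) without further assumptions, while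
p is only shown to have half a time derivative.

Optimality: the cost at an admissible pair (y',u') exceeds the value at a solution by exactly
½‖∇(y'-y)‖² + (λ/2)‖u' + p/λ‖² (`OptSys.cost_eq`). So solutions are minimizers, and Friedrichs'
inequality makes the minimizer unique.

Lower bound: when the cost is expanded around (η,ζ), the linear remainder is R₃ and R₄ paired with
the error y - η. Coercivity of ν bounds that error by R₁, R₂ and ‖p - ζ‖, and ‖p - ζ‖ is absorbed by
the term ‖p - ζ‖²/(2λ) of the expansion (`minorant_le_of_identities`, `minorant_arith`).

Supremum: at an exact solution all residuals vanish, but this needs ∂_t p ∈ L²(Q). In general the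
solution is truncated to |j| ≤ n. The truncation is regular in time and solves the system with
truncated target g_n (`OptSys.modeSum`), so the only residual left is R₄ = g_n - g, which tends to 0
(`OptSys.minorantL_eq`, `tendsto_minorant_modeSum`). -/

/-- The normalized Hartley functions `(cos (jωt) + sin (jωt)) / √T`, `j ∈ ℤ`. -/
def hartley (T : ℝ) (j : ℤ) (t : ℝ) : ℝ :=
  (Real.cos (j * freq T * t) + Real.sin (j * freq T * t)) / √T

lemma freq_pos {T : ℝ} (hT : 0 < T) : 0 < freq T := by unfold freq; positivity

lemma contDiff_hartley (T : ℝ) (j : ℤ) : ContDiff ℝ ∞ (hartley T j) := by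
  unfold hartley
  fun_prop

lemma continuous_hartley (T : ℝ) (j : ℤ) : Continuous (hartley T j) :=
  (contDiff_hartley T j).continuous

lemma abs_hartley_le (T : ℝ) (j : ℤ) (t : ℝ) : |hartley T j t| ≤ 2 / √T := by
  unfold hartley
  rw [abs_div, abs_of_nonneg (Real.sqrt_nonneg T)]
  gcongr
  refine (abs_add_le _ _).trans ?_
  linarith [Real.abs_cos_le_one (j * freq T * t), Real.abs_sin_le_one (j * freq T * t)]

/-- The reason for this basis: cos + sin differentiates to cos - sin, which is the reflection j ↦
-j, so the time derivative stays real and couples only j with -j. -/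
lemma hasDerivAt_hartley (T : ℝ) (j : ℤ) (t : ℝ) :
    HasDerivAt (hartley T j) (j * freq T * hartley T (-j) t) t := by
  have h : HasDerivAt (fun t : ℝ => (j : ℝ) * freq T * t) (j * freq T) t := by
    simpa using (hasDerivAt_id t).const_mul ((j : ℝ) * freq T)
  refine ((h.cos.add h.sin).div_const (√T)).congr_deriv ?_
  simp only [hartley, Int.cast_neg, neg_mul, Real.cos_neg, Real.sin_neg]
  ring

lemma freq_mul_self {T : ℝ} (hT : 0 < T) : freq T * T = 2 * Real.pi := by
  unfold freq; field_simp

lemma hartley_zero (T : ℝ) (j : ℤ) : hartley T j 0 = 1 / √T := by simp [hartley]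

lemma hartley_right {T : ℝ} (hT : 0 < T) (j : ℤ) : hartley T j T = 1 / √T := by
  have h : (j : ℝ) * freq T * T = j * (2 * Real.pi) := by rw [mul_assoc, freq_mul_self hT]
  have hs : Real.sin ((j : ℝ) * (2 * Real.pi)) = 0 := by
    have := Real.sin_int_mul_pi (2 * j)
    push_cast at this
    rw [← this]; ring_nf
  rw [hartley, h, Real.cos_int_mul_two_pi, hs, add_zero]

lemma cos_eq_hartley {T : ℝ} (hT : 0 < T) (k : ℕ) (t : ℝ) :
    Real.cos (k * freq T * t) = √T / 2 * (hartley T k t + hartley T (-k) t) := by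
  have := Real.sqrt_pos.2 hT
  simp only [hartley, Int.cast_neg, neg_mul, Real.cos_neg, Real.sin_neg, Int.cast_natCast]
  field_simp; ring

lemma sin_eq_hartley {T : ℝ} (hT : 0 < T) (k : ℕ) (t : ℝ) :
    Real.sin (k * freq T * t) = √T / 2 * (hartley T k t - hartley T (-k) t) := by
  have := Real.sqrt_pos.2 hT
  simp only [hartley, Int.cast_neg, neg_mul, Real.cos_neg, Real.sin_neg, Int.cast_natCast]
  field_simp; ring

lemma integral_cos_int {T : ℝ} (hT : 0 < T) (m : ℤ) :
    ∫ t in (0 : ℝ)..T, Real.cos (m * freq T * t) = if m = 0 then T else 0 := by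
  split_ifs with h
  · simp [h]
  · have hm : (m : ℝ) * freq T ≠ 0 := mul_ne_zero (by exact_mod_cast h) (freq_pos hT).ne'
    rw [intervalIntegral.integral_comp_mul_left _ hm, integral_cos, mul_assoc, freq_mul_self hT]
    have hs : Real.sin ((m : ℝ) * (2 * Real.pi)) = 0 := by
      have := Real.sin_int_mul_pi (2 * m)
      push_cast at this
      rw [← this]; ring_nf
    simp [hs]

lemma integral_sin_int {T : ℝ} (hT : 0 < T) (m : ℤ) :
    ∫ t in (0 : ℝ)..T, Real.sin (m * freq T * t) = 0 := by
  by_cases h : m = 0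
  · simp [h]
  · have hm : (m : ℝ) * freq T ≠ 0 := mul_ne_zero (by exact_mod_cast h) (freq_pos hT).ne'
    rw [intervalIntegral.integral_comp_mul_left _ hm, integral_sin, mul_assoc _ _ T,
      freq_mul_self hT,
      Real.cos_int_mul_two_pi]
    simp

/-- The product collapses to (cos((j-l)ωt) + sin((j+l)ωt))/T, and the sine has mean zero over a
period. -/
lemma integral_hartley_mul {T : ℝ} (hT : 0 < T) (j l : ℤ) :
    ∫ t in Ioo 0 T, hartley T j t * hartley T l t = if j = l then 1 else 0 := by
  rw [← integral_Ioc_eq_integral_Ioo, ← intervalIntegral.integral_of_le hT.le]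
  have h : ∀ t, hartley T j t * hartley T l t
      = (Real.cos ((j - l : ℤ) * freq T * t) + Real.sin ((j + l : ℤ) * freq T * t)) / T := by
    intro t
    have e1 : ((j - l : ℤ) : ℝ) * freq T * t = j * freq T * t - l * freq T * t := by
      push_cast; ring
    have e2 : ((j + l : ℤ) : ℝ) * freq T * t = j * freq T * t + l * freq T * t := by
      push_cast; ring
    rw [e1, e2, Real.cos_sub, Real.sin_add]
    simp only [hartley]
    rw [div_mul_div_comm, Real.mul_self_sqrt hT.le]
    ring
  simp only [h]
  rw [intervalIntegral.integral_div, intervalIntegral.integral_add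
    (Continuous.intervalIntegrable (by fun_prop) _ _)
    (Continuous.intervalIntegrable (by fun_prop) _ _), integral_cos_int hT, integral_sin_int hT]
  by_cases hjl : j = l
  · simp [hjl, hT.ne']
  · simp [hjl, sub_eq_zero]

/-- The Hartley functions are complete in `L²(0,T)`. -/
lemma ae_eq_zero_of_integral_hartley {T : ℝ} (hT : 0 < T) {f : ℝ → ℝ}
    (hf : MemLp f 2 (volume.restrict (Ioo 0 T)))
    (h : ∀ j : ℤ, ∫ t in Ioo 0 T, f t * hartley T j t = 0) :
    f =ᵐ[volume.restrict (Ioo 0 T)] 0 := by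
  have hfi : Integrable f (volume.restrict (Ioo 0 T)) := hf.integrable (by norm_num)
  have hh : ∀ j : ℤ, Integrable (fun t => f t * hartley T j t) (volume.restrict (Ioo 0 T)) :=
    fun j => hfi.mul_bdd (c := 2 / √T)
      (continuous_hartley T j).aestronglyMeasurable (ae_of_all _ fun t => abs_hartley_le T j t)
  have hsT := Real.sqrt_pos.2 hT
  have hcos : ∀ n : ℤ, ∫ t in Ioo 0 T, f t * Real.cos (n * freq T * t) = 0 := by
    intro n
    have : ∀ t, f t * Real.cos (n * freq T * t)
        = √T / 2 * (f t * hartley T n t + f t * hartley T (-n) t) := by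
      intro t
      simp only [hartley, Int.cast_neg, neg_mul, Real.cos_neg, Real.sin_neg]
      field_simp; ring
    simp only [this]
    rw [integral_const_mul, integral_add (hh _) (hh _), h, h]; simp
  have hsin : ∀ n : ℤ, ∫ t in Ioo 0 T, f t * Real.sin (n * freq T * t) = 0 := by
    intro n
    have : ∀ t, f t * Real.sin (n * freq T * t)
        = √T / 2 * (f t * hartley T n t - f t * hartley T (-n) t) := by
      intro t
      simp only [hartley, Int.cast_neg, neg_mul, Real.cos_neg, Real.sin_neg]
      field_simp; ring
    simp only [this]
    rw [integral_const_mul, integral_sub (hh _) (hh _), h, h]; simp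
  have hmem : MemLp (fun t => (f t : ℂ)) 2 (volume.restrict (Ioc 0 T)) := by
    rw [← restrict_Ioo_eq_restrict_Ioc]; exact hf.ofReal
  have hcoef : ∀ n : ℤ, fourierCoeffOn hT (fun t => (f t : ℂ)) n = 0 := by
    intro n
    rw [fourierCoeffOn_eq_integral, intervalIntegral.integral_of_le hT.le,
      integral_Ioc_eq_integral_Ioo]
    have e : ∀ t : ℝ, (fourier (-n) (t : AddCircle (T - 0)) • (f t : ℂ))
        = ((f t * Real.cos (n * freq T * t) : ℝ) : ℂ)
          - Complex.I * ((f t * Real.sin (n * freq T * t) : ℝ) : ℂ) := by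
      intro t
      rw [fourier_coe_apply]
      have : 2 * (Real.pi : ℂ) * Complex.I * ((-n : ℤ) : ℂ) * (t : ℂ) / ((T - 0 : ℝ) : ℂ)
          = ((-(n * freq T * t) : ℝ) : ℂ) * Complex.I := by
        unfold freq; push_cast; field_simp; ring
      rw [this, Complex.exp_mul_I, ← Complex.ofReal_cos, ← Complex.ofReal_sin, Real.cos_neg,
        Real.sin_neg]
      push_cast
      simp only [smul_eq_mul]; ring
    simp only [e]
    have hb : ∀ g : ℝ → ℝ, Continuous g → (∀ t, |g t| ≤ 1) →
        Integrable (fun t => ((f t * g t : ℝ) : ℂ)) (volume.restrict (Ioo 0 T)) := fun g hg hg1 =>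
      (hfi.mul_bdd (c := 1) hg.aestronglyMeasurable (ae_of_all _ fun t => hg1 t)).ofReal
    rw [integral_sub (hb _ (by fun_prop) fun t => Real.abs_cos_le_one _)
      ((hb _ (by fun_prop) fun t => Real.abs_sin_le_one _).const_mul _),
      integral_const_mul, integral_complex_ofReal, integral_complex_ofReal, hcos, hsin]
    simp
  -- Parseval for the complex Fourier series: all coefficients vanish, hence so does the integral of
  -- f².
  have hs := hasSum_sq_fourierCoeffOn hT hmem
  simp only [hcoef, norm_zero, ne_eq, OfNat.ofNat_ne_zero, not_false_eq_true, zero_pow] at hs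
  have h0 := hs.unique hasSum_zero
  rw [intervalIntegral.integral_of_le hT.le, integral_Ioc_eq_integral_Ioo] at h0
  have h1 : ∫ t in Ioo 0 T, f t ^ 2 = 0 := by
    simp only [Complex.norm_real, Real.norm_eq_abs, sq_abs, sub_zero, smul_eq_mul] at h0
    rcases mul_eq_zero.1 h0 with h0 | h0
    · exact absurd h0 (inv_ne_zero hT.ne')
    · exact h0
  rw [integral_eq_zero_iff_of_nonneg (fun t => sq_nonneg _) hf.integrable_sq] at h1
  filter_upwards [h1] with t ht
  simpa using ht

end ParabolicOC

namespace ParabolicOC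

/-! ### Complete orthogonal families of isometric embeddings -/

section HilbertSum

variable {ι X H : Type*} [NormedAddCommGroup X] [InnerProductSpace ℝ X] [CompleteSpace X]
  [NormedAddCommGroup H] [InnerProductSpace ℝ H] [CompleteSpace H]

/-- The coefficient maps (adjoints) of a family of isometric embeddings. -/
def coeff (M : ι → X →ₗᵢ[ℝ] H) (i : ι) : H →L[ℝ] X := (M i).toContinuousLinearMap.adjoint

/-- The ranges of the embeddings are mutually orthogonal and span a dense subspace. -/
structure CompleteFamily (M : ι → X →ₗᵢ[ℝ] H) : Prop where
  ortho : ∀ i j, i ≠ j → ∀ g h, inner ℝ (M i g) (M j h) = 0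
  total : ∀ u, (∀ i, coeff M i u = 0) → u = 0

variable {M : ι → X →ₗᵢ[ℝ] H}

lemma inner_coeff (i : ι) (u : H) (g : X) : inner ℝ (coeff M i u) g = inner ℝ u (M i g) := by
  rw [coeff, ContinuousLinearMap.adjoint_inner_left]; rfl

lemma inner_coeff_right (i : ι) (u : H) (g : X) :
    inner ℝ g (coeff M i u) = inner ℝ (M i g) u := by
  rw [real_inner_comm, inner_coeff, real_inner_comm]

lemma coeff_emb_self (i : ι) (g : X) : coeff M i (M i g) = g := by
  refine ext_inner_right ℝ fun h => ?_
  rw [inner_coeff, LinearIsometry.inner_map_map]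

namespace CompleteFamily

lemma coeff_emb_of_ne (hM : CompleteFamily M) {i j : ι} (h : i ≠ j) (g : X) :
    coeff M i (M j g) = 0 := by
  refine ext_inner_right ℝ fun h' => ?_
  rw [inner_coeff, hM.ortho j i h.symm, inner_zero_left]

lemma orthogonalFamily (hM : CompleteFamily M) :
    OrthogonalFamily ℝ (fun _ : ι => X) M := fun i j hij g h => hM.ortho i j hij g h

lemma summable_emb (hM : CompleteFamily M) {f : ι → X} (hf : Summable fun i => ‖f i‖ ^ 2) :
    Summable fun i => M i (f i) :=
  (hM.orthogonalFamily.summable_iff_norm_sq_summable f).2 hf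

lemma coeff_tsum (hM : CompleteFamily M) {f : ι → X} (hf : Summable fun i => ‖f i‖ ^ 2) (i : ι) :
    coeff M i (∑' j, M j (f j)) = f i := by
  rw [ContinuousLinearMap.map_tsum _ (hM.summable_emb hf), tsum_eq_single i, coeff_emb_self]
  intro j hj
  exact hM.coeff_emb_of_ne hj.symm _

/-- Bessel's inequality, from expanding ‖u - ∑_{i∈s} M_i u_i‖² ≥ 0. -/
lemma summable_coeff (hM : CompleteFamily M) (u : H) : Summable fun i => ‖coeff M i u‖ ^ 2 := by
  refine summable_of_sum_le (fun i => by positivity) (c := ‖u‖ ^ 2) fun s => ?_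
  have h1 := hM.orthogonalFamily.norm_sum (fun i => coeff M i u) s
  have h2 : inner ℝ u (∑ i ∈ s, M i (coeff M i u)) = ∑ i ∈ s, ‖coeff M i u‖ ^ 2 := by
    rw [inner_sum]
    exact Finset.sum_congr rfl fun i _ => by rw [← inner_coeff, real_inner_self_eq_norm_sq]
  have h3 := norm_sub_sq_real u (∑ i ∈ s, M i (coeff M i u))
  rw [h1, h2] at h3
  nlinarith [sq_nonneg ‖u - ∑ i ∈ s, M i (coeff M i u)‖]

lemma ext_coeff (hM : CompleteFamily M) {u v : H} (h : ∀ i, coeff M i u = coeff M i v) : u = v :=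
  sub_eq_zero.1 (hM.total _ fun i => by rw [map_sub, h, sub_self])

/-- Bessel gives convergence; the limit has the same coefficients as u, and totality identifies
them. -/
lemma hasSum_emb (hM : CompleteFamily M) (u : H) : HasSum (fun i => M i (coeff M i u)) u := by
  have h := (hM.summable_emb (hM.summable_coeff u)).hasSum
  rwa [hM.ext_coeff fun i => hM.coeff_tsum (hM.summable_coeff u) i] at h

/-- Parseval's identity, which turns identities between modes into identities on Q. -/
lemma hasSum_inner (hM : CompleteFamily M) (u v : H) :
    HasSum (fun i => inner ℝ (coeff M i u) (coeff M i v)) (inner ℝ u v) := by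
  have h := (innerSL ℝ v).hasSum (hM.hasSum_emb u)
  simp only [innerSL_apply_apply] at h
  rw [real_inner_comm]
  have e : (fun i => inner ℝ (coeff M i u) (coeff M i v))
      = fun i => inner ℝ v (M i (coeff M i u)) :=
    funext fun i => by rw [inner_coeff_right, real_inner_comm]
  rwa [e]

end CompleteFamily
end HilbertSum

/-! ### Multiplication by bounded functions -/

section Multiplication

variable {α F : Type*} [MeasurableSpace α] [NormedAddCommGroup F] [InnerProductSpace ℝ F]
  {μ : Measure α} {m : α → ℝ}

/-- `m` is measurable and essentially bounded. -/
def IsBddMul (μ : Measure α) (m : α → ℝ) : Prop :=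
  AEMeasurable m μ ∧ ∃ C : ℝ, ∀ᵐ x ∂μ, |m x| ≤ C

lemma IsBddMul.memLp_smul (hm : IsBddMul μ m) {f : α → F} (hf : MemLp f 2 μ) :
    MemLp (fun x => m x • f x) 2 μ := by
  obtain ⟨hmm, C, hC⟩ := hm
  refine hf.of_le_mul (c := C) (hmm.aestronglyMeasurable.smul hf.1) ?_
  filter_upwards [hC] with x hx
  rw [norm_smul, Real.norm_eq_abs]
  gcongr

/-- Multiplication by the bounded function `m` on `L²(μ; F)`. -/
def mulL (F : Type*) [NormedAddCommGroup F] [InnerProductSpace ℝ F] (hm : IsBddMul μ m) :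
    Lp F 2 μ →L[ℝ] Lp F 2 μ :=
  LinearMap.mkContinuousOfExistsBound
    { toFun := fun f => (hm.memLp_smul (Lp.memLp f)).toLp _
      map_add' := fun f g => by
        ext1
        filter_upwards [MemLp.coeFn_toLp (hm.memLp_smul (Lp.memLp f)), Lp.coeFn_add f g,
          MemLp.coeFn_toLp (hm.memLp_smul (Lp.memLp g)),
          MemLp.coeFn_toLp (hm.memLp_smul (Lp.memLp (f + g))),
          Lp.coeFn_add ((hm.memLp_smul (Lp.memLp f)).toLp _)
            ((hm.memLp_smul (Lp.memLp g)).toLp _)] with x h1 h2 h3 h4 h5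
        rw [h4, h5, Pi.add_apply, h1, h3, h2, Pi.add_apply, smul_add]
      map_smul' := fun c f => by
        ext1
        filter_upwards [MemLp.coeFn_toLp (hm.memLp_smul (Lp.memLp f)), Lp.coeFn_smul c f,
          MemLp.coeFn_toLp (hm.memLp_smul (Lp.memLp (c • f))),
          Lp.coeFn_smul c ((hm.memLp_smul (Lp.memLp f)).toLp _)] with x h1 h2 h3 h4
        rw [h3, RingHom.id_apply, h4, Pi.smul_apply, h1, h2, Pi.smul_apply, smul_comm] }
    (by
      obtain ⟨C, hC⟩ := hm.2
      refine ⟨C, fun f => ?_⟩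
      refine Lp.norm_le_mul_norm_of_ae_le_mul ?_
      filter_upwards [hC, MemLp.coeFn_toLp (hm.memLp_smul (Lp.memLp f))] with x hx h1
      simp only [LinearMap.coe_mk, AddHom.coe_mk, h1]
      rw [norm_smul, Real.norm_eq_abs]
      gcongr)

lemma coeFn_mulL (hm : IsBddMul μ m) (f : Lp F 2 μ) :
    mulL F hm f =ᵐ[μ] fun x => m x • f x :=
  MemLp.coeFn_toLp (hm.memLp_smul (Lp.memLp f))

lemma mulL_toLp (hm : IsBddMul μ m) {f : α → F} (hf : MemLp f 2 μ) :
    mulL F hm (hf.toLp f) = (hm.memLp_smul hf).toLp _ := by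
  ext1
  filter_upwards [coeFn_mulL hm (hf.toLp f), hf.coeFn_toLp,
    (hm.memLp_smul hf).coeFn_toLp] with x h1 h2 h3
  rw [h1, h2, h3]

lemma inner_mulL_left (hm : IsBddMul μ m) (f g : Lp F 2 μ) :
    inner ℝ (mulL F hm f) g = inner ℝ f (mulL F hm g) := by
  rw [L2.inner_def, L2.inner_def]
  refine integral_congr_ae ?_
  filter_upwards [coeFn_mulL hm f, coeFn_mulL hm g] with x h1 h2
  rw [h1, h2, real_inner_smul_left, real_inner_smul_right]

lemma le_inner_mulL_self (hm : IsBddMul μ m) {c : ℝ} (hc : ∀ᵐ x ∂μ, c ≤ m x) (f : Lp F 2 μ) :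
    c * ‖f‖ ^ 2 ≤ inner ℝ (mulL F hm f) f := by
  rw [← real_inner_self_eq_norm_sq, L2.inner_def, L2.inner_def, ← integral_const_mul]
  refine integral_mono_ae ((L2.integrable_inner f f).const_mul c)
    (L2.integrable_inner (mulL F hm f) f) ?_
  filter_upwards [hc, coeFn_mulL hm f] with x h1 h2
  rw [h2, real_inner_smul_left]
  exact mul_le_mul_of_nonneg_right h1 real_inner_self_nonneg

end Multiplication

/-! ### The modes of a function on `Ω × (0,T)` -/

section Modes

variable {α F : Type*} [MeasurableSpace α] [NormedAddCommGroup F] [InnerProductSpace ℝ F]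
  {μ : Measure α} {T : ℝ}

/-- Lebesgue measure on `(0,T)`. -/
abbrev tauT (T : ℝ) : Measure ℝ := volume.restrict (Ioo 0 T)

variable [IsFiniteMeasure μ]

lemma memLp_hartley_smul (j : ℤ) {g : α → F} (hg : MemLp g 2 μ) :
    MemLp (fun z : α × ℝ => hartley T j z.2 • g z.1) 2 (μ.prod (tauT T)) := by
  have h := hg.comp_fst (tauT T)
  refine h.of_le_mul (c := 2 / √T) ?_ ?_
  · exact ((continuous_hartley T j).measurable.comp measurable_snd).aestronglyMeasurable.smul h.1
  · refine ae_of_all _ fun z => ?_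
    rw [norm_smul, Real.norm_eq_abs]
    exact mul_le_mul_of_nonneg_right (abs_hartley_le T j z.2) (norm_nonneg _)

lemma ae_comp_fst {p : α → Prop} (h : ∀ᵐ x ∂μ, p x) (ν : Measure ℝ) [SFinite ν] :
    ∀ᵐ z ∂(μ.prod ν), p z.1 :=
  Measure.quasiMeasurePreserving_fst.ae h

/-- The linear map `g ↦ e_j(t) g(x)`. -/
def modeLin (F : Type*) [NormedAddCommGroup F] [InnerProductSpace ℝ F] (μ : Measure α)
    [IsFiniteMeasure μ] (T : ℝ) (j : ℤ) : Lp F 2 μ →ₗ[ℝ] Lp F 2 (μ.prod (tauT T)) where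
  toFun g := (memLp_hartley_smul j (Lp.memLp g)).toLp _
  map_add' f g := by
    ext1
    filter_upwards [MemLp.coeFn_toLp (memLp_hartley_smul (T := T) j (Lp.memLp f)),
      ae_comp_fst (Lp.coeFn_add f g) (tauT T),
      MemLp.coeFn_toLp (memLp_hartley_smul (T := T) j (Lp.memLp g)),
      MemLp.coeFn_toLp (memLp_hartley_smul (T := T) j (Lp.memLp (f + g))),
      Lp.coeFn_add ((memLp_hartley_smul (T := T) j (Lp.memLp f)).toLp _)
        ((memLp_hartley_smul (T := T) j (Lp.memLp g)).toLp _)] with x h1 h2 h3 h4 h5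
    rw [h4, h5, Pi.add_apply, h1, h3, h2, Pi.add_apply, smul_add]
  map_smul' c f := by
    ext1
    filter_upwards [MemLp.coeFn_toLp (memLp_hartley_smul (T := T) j (Lp.memLp f)),
      ae_comp_fst (Lp.coeFn_smul c f) (tauT T),
      MemLp.coeFn_toLp (memLp_hartley_smul (T := T) j (Lp.memLp (c • f))),
      Lp.coeFn_smul c ((memLp_hartley_smul (T := T) j (Lp.memLp f)).toLp _)] with x h1 h2 h3 h4
    rw [h3, RingHom.id_apply, h4, Pi.smul_apply, h1, h2, Pi.smul_apply, smul_comm]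

lemma coeFn_modeLin (j : ℤ) (g : Lp F 2 μ) :
    modeLin F μ T j g =ᵐ[μ.prod (tauT T)] fun z => hartley T j z.2 • g z.1 :=
  MemLp.coeFn_toLp (memLp_hartley_smul j (Lp.memLp g))

/-- Fubini factors the integral into a spatial inner product and a Hartley product. The case i = j
makes each mode map isometric; the case i ≠ j makes the ranges orthogonal. -/
lemma inner_modeLin (hT : 0 < T) (i j : ℤ) (g h : Lp F 2 μ) :
    inner ℝ (modeLin F μ T i g) (modeLin F μ T j h) = if i = j then inner ℝ g h else 0 := by
  rw [L2.inner_def]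
  have : ∫ z, inner ℝ (modeLin F μ T i g z) (modeLin F μ T j h z) ∂(μ.prod (tauT T))
      = ∫ z : α × ℝ, inner ℝ (g z.1) (h z.1) * (hartley T i z.2 * hartley T j z.2)
        ∂(μ.prod (tauT T)) := by
    refine integral_congr_ae ?_
    filter_upwards [coeFn_modeLin i g, coeFn_modeLin j h] with z h1 h2
    rw [h1, h2, real_inner_smul_left, real_inner_smul_right]; ring
  rw [this, integral_prod_mul (fun x => inner ℝ (g x) (h x))
    (fun t => hartley T i t * hartley T j t), integral_hartley_mul hT, L2.inner_def]
  split_ifs <;> simp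

/-- The isometric embedding `g ↦ e_j(t) g(x)` of `L²(Ω)` into `L²(Q)`. -/
def mode (F : Type*) [NormedAddCommGroup F] [InnerProductSpace ℝ F] (μ : Measure α)
    [IsFiniteMeasure μ] (hT : 0 < T) (j : ℤ) : Lp F 2 μ →ₗᵢ[ℝ] Lp F 2 (μ.prod (tauT T)) where
  toLinearMap := modeLin F μ T j
  norm_map' g := by
    have h := inner_modeLin hT j j g g
    rw [if_pos rfl, real_inner_self_eq_norm_sq, real_inner_self_eq_norm_sq] at h
    exact (sq_eq_sq₀ (norm_nonneg _) (norm_nonneg _)).1 h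

lemma coeFn_mode (hT : 0 < T) (j : ℤ) (g : Lp F 2 μ) :
    mode F μ hT j g =ᵐ[μ.prod (tauT T)] fun z => hartley T j z.2 • g z.1 :=
  coeFn_modeLin j g

lemma integrable_hartley_smul (j : ℤ) {u : α × ℝ → F} (hu : Integrable u (μ.prod (tauT T))) :
    Integrable (fun z => hartley T j z.2 • u z) (μ.prod (tauT T)) := by
  refine hu.bdd_smul (2 / √T) ?_ ?_
  · exact ((continuous_hartley T j).measurable.comp measurable_snd).aestronglyMeasurable
  · exact ae_of_all _ fun z => abs_hartley_le T j z.2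

/-- The coefficient is defined abstractly as an adjoint; pairing it with constants times indicators
of measurable sets and using Fubini recovers the concrete time integral. -/
lemma integral_hartley_ae (hT : 0 < T) [CompleteSpace F] (j : ℤ) {u : α × ℝ → F}
    (hu : MemLp u 2 (μ.prod (tauT T))) :
    (fun x => ∫ t in Ioo 0 T, hartley T j t • u (x, t)) =ᵐ[μ]
      coeff (mode F μ hT) j (hu.toLp u) := by
  have hui : Integrable u (μ.prod (tauT T)) := hu.integrable (by norm_num)
  have hi := integrable_hartley_smul j hui
  refine Integrable.ae_eq_of_forall_setIntegral_eq _ _ hi.integral_prod_left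
    ((Lp.memLp _).integrable (by norm_num)) fun s hs hμs => ?_
  refine ext_inner_left ℝ fun c => ?_
  rw [← L2.inner_indicatorConstLp_eq_inner_setIntegral ℝ hs hμs.ne c, inner_coeff_right,
    L2.inner_def]
  have h1 : ∫ z, inner ℝ (mode F μ hT j (indicatorConstLp 2 hs hμs.ne c) z) (hu.toLp u z)
        ∂(μ.prod (tauT T))
      = ∫ z in s ×ˢ univ, inner ℝ c (hartley T j z.2 • u z) ∂(μ.prod (tauT T)) := by
    rw [← integral_indicator (hs.prod MeasurableSet.univ)]
    refine integral_congr_ae ?_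
    filter_upwards [coeFn_mode hT j (indicatorConstLp 2 hs hμs.ne c), hu.coeFn_toLp,
      ae_comp_fst (indicatorConstLp_coeFn (p := 2) (hs := hs) (hμs := hμs.ne) (c := c)) (tauT T)]
      with z h1 h2 h3
    rw [h1, h2, h3]
    by_cases hz : z.1 ∈ s
    · simp [hz, real_inner_smul_left, real_inner_smul_right]
    · simp [hz]
  rw [h1, setIntegral_prod _ ((hi.const_inner c).integrableOn), Measure.restrict_univ,
    ← integral_inner hi.integral_prod_left.integrableOn]
  refine setIntegral_congr_ae hs ?_
  filter_upwards [hi.prod_right_ae] with x hx _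
  rw [integral_inner hx]

/-- If all coefficients vanish, then almost every time slice has vanishing Hartley coefficients.
Scalar completeness applies to each of the finitely many components of the slice, and Fubini for
null sets concludes. -/
lemma completeFamily_mode [FiniteDimensional ℝ F] (hT : 0 < T) :
    CompleteFamily (mode F μ hT) := by
  have : CompleteSpace F := FiniteDimensional.complete ℝ F
  refine ⟨fun i j hij g h => ?_, fun u hu => ?_⟩
  · exact (inner_modeLin hT i j g h).trans (if_neg hij)
  · have hm := Lp.memLp u
    have h0 : ∀ᵐ x ∂μ, ∀ j : ℤ, ∫ t in Ioo 0 T, hartley T j t • u (x, t) = 0 := by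
      rw [ae_all_iff]
      intro j
      have h := integral_hartley_ae hT j hm
      rw [Lp.toLp_coeFn, hu j] at h
      filter_upwards [h, Lp.coeFn_zero F 2 μ] with x h1 h2
      rw [h1, h2]; rfl
    have hsq : ∀ᵐ x ∂μ, MemLp (fun t => u (x, t)) 2 (tauT T) := by
      have h1 := (memLp_two_iff_integrable_sq_norm hm.1).1 hm
      filter_upwards [h1.prod_right_ae, hm.1.prodMk_left] with x h2 h3
      exact (memLp_two_iff_integrable_sq_norm h3).2 h2
    have hz : ∀ᵐ x ∂μ, ∀ᵐ t ∂(tauT T), u (x, t) = 0 := by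
      filter_upwards [h0, hsq] with x h1 h2
      have hb : ∀ i, ∀ᵐ t ∂(tauT T), inner ℝ (stdOrthonormalBasis ℝ F i) (u (x, t)) = 0 := by
        intro i
        refine ae_eq_zero_of_integral_hartley hT (h2.const_inner _) fun j => ?_
        have hi : Integrable (fun t => hartley T j t • u (x, t)) (tauT T) :=
          (h2.integrable (by norm_num)).bdd_smul (2 / √T)
            (continuous_hartley T j).aestronglyMeasurable
            (ae_of_all _ fun t => abs_hartley_le T j t)
        have h3 := integral_inner (𝕜 := ℝ) hi (stdOrthonormalBasis ℝ F i)
        rw [h1 j, inner_zero_right] at h3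
        refine (integral_congr_ae (ae_of_all _ fun t => ?_)).trans h3
        simp only [real_inner_smul_right]; ring
      have hall : ∀ᵐ t ∂(tauT T), ∀ i, inner ℝ (stdOrthonormalBasis ℝ F i) (u (x, t)) = 0 :=
        ae_all_iff.2 hb
      filter_upwards [hall] with t ht
      refine (stdOrthonormalBasis ℝ F).repr.injective ?_
      ext i
      rw [OrthonormalBasis.repr_apply_apply, ht i]
      simp
    rw [Lp.eq_zero_iff_ae_eq_zero]
    refine (Measure.ae_prod_iff_ae_ae ?_).2 hz
    exact (Lp.stronglyMeasurable u).measurableSet_eq_fun stronglyMeasurable_const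

lemma isBddMul_fst {m : α → ℝ} (hm : IsBddMul μ m) :
    IsBddMul (μ.prod (tauT T)) (fun z => m z.1) :=
  ⟨hm.1.comp_quasiMeasurePreserving Measure.quasiMeasurePreserving_fst, hm.2.imp fun _ h =>
    ae_comp_fst h _⟩

lemma mulL_mode (hT : 0 < T) {m : α → ℝ} (hm : IsBddMul μ m) (j : ℤ) (g : Lp F 2 μ) :
    mulL F (isBddMul_fst hm) (mode F μ hT j g) = mode F μ hT j (mulL F hm g) := by
  ext1
  filter_upwards [coeFn_mulL (isBddMul_fst hm) (mode F μ hT j g), coeFn_mode hT j g,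
    coeFn_mode hT j (mulL F hm g), ae_comp_fst (coeFn_mulL hm g) (tauT T)] with z h1 h2 h3 h4
  rw [h1, h2, h3, h4, smul_comm]

/-- Symmetry moves the multiplier onto the mode, with which it commutes, and then back: coefficients
depending on x alone do not mix modes. -/
lemma coeff_mulL [CompleteSpace F] (hT : 0 < T) {m : α → ℝ} (hm : IsBddMul μ m) (j : ℤ)
    (u : Lp F 2 (μ.prod (tauT T))) :
    coeff (mode F μ hT) j (mulL F (isBddMul_fst hm) u) = mulL F hm (coeff (mode F μ hT) j u) := by
  refine ext_inner_right ℝ fun g => ?_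
  rw [inner_coeff, inner_mulL_left, mulL_mode, ← inner_coeff, inner_mulL_left]

end Modes

end ParabolicOC

namespace ParabolicOC

/-! ### Test functions -/

section Test

variable {d : ℕ} {Ω : Set (Space d)} {T : ℝ}

/-- Lebesgue measure on `Q`, as a product measure. -/
abbrev muP (Ω : Set (Space d)) (T : ℝ) : Measure (Space d × ℝ) :=
  (volume.restrict Ω).prod (tauT T)

lemma muQ_eq (Ω : Set (Space d)) (T : ℝ) : muQ Ω T = muP Ω T := by
  rw [muQ, cyl, Measure.volume_eq_prod, muP, Measure.prod_restrict]

lemma continuous_gradient {φ : Space d → ℝ} (h : ContDiff ℝ ∞ φ) : Continuous (gradient φ) :=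
  (InnerProductSpace.toDual ℝ (Space d)).symm.continuous.comp (h.continuous_fderiv (by simp))

lemma support_gradient_subset (φ : Space d → ℝ) : Function.support (gradient φ) ⊆ tsupport φ := by
  intro x hx
  refine support_fderiv_subset ℝ (f := φ) fun h => hx ?_
  simp [gradient, h]

lemma hasCompactSupport_gradient {φ : Space d → ℝ} (h : HasCompactSupport φ) :
    HasCompactSupport (gradient φ) :=
  h.mono' (support_gradient_subset φ)

/-- Written through the full derivative on space-time, the partial gradient inherits continuity and
compact support from it. -/
lemma gradX_eq {φ : Space d × ℝ → ℝ} (h : ContDiff ℝ ∞ φ) (z : Space d × ℝ) :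
    gradX φ z = (InnerProductSpace.toDual ℝ (Space d)).symm
      ((fderiv ℝ φ z).comp (ContinuousLinearMap.inl ℝ (Space d) ℝ)) := by
  unfold gradX gradient
  congr 1
  have h1 : HasFDerivAt φ (fderiv ℝ φ z) (z.1, z.2) :=
    (h.differentiable (by simp) z).hasFDerivAt
  exact (h1.comp z.1 (hasFDerivAt_prodMk_left z.1 z.2)).fderiv

lemma inner_gradX {φ : Space d × ℝ → ℝ} (h : ContDiff ℝ ∞ φ) (z : Space d × ℝ) (v : Space d) :
    inner ℝ (gradX φ z) v = fderiv ℝ φ z (v, 0) := by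
  rw [gradX_eq h, InnerProductSpace.toDual_symm_apply]; rfl

lemma continuous_gradX {φ : Space d × ℝ → ℝ} (h : ContDiff ℝ ∞ φ) : Continuous (gradX φ) := by
  have : gradX φ = fun z => (InnerProductSpace.toDual ℝ (Space d)).symm
      ((fderiv ℝ φ z).comp (ContinuousLinearMap.inl ℝ (Space d) ℝ)) := funext (gradX_eq h)
  rw [this]
  have h1 : Continuous (fderiv ℝ φ) := h.continuous_fderiv (by simp)
  exact (InnerProductSpace.toDual ℝ (Space d)).symm.continuous.comp
    (h1.clm_comp continuous_const)

lemma support_gradX_subset {φ : Space d × ℝ → ℝ} (h : ContDiff ℝ ∞ φ) :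
    Function.support (gradX φ) ⊆ tsupport φ := by
  intro x hx
  refine support_fderiv_subset ℝ (f := φ) fun h0 => hx ?_
  simp [gradX_eq h, h0]

lemma hasCompactSupport_gradX {φ : Space d × ℝ → ℝ} (h : ContDiff ℝ ∞ φ)
    (hc : HasCompactSupport φ) : HasCompactSupport (gradX φ) :=
  hc.mono' (support_gradX_subset h)

lemma derivT_eq {φ : Space d × ℝ → ℝ} (h : ContDiff ℝ ∞ φ) (z : Space d × ℝ) :
    HasDerivAt (fun t => φ (z.1, t)) (derivT φ z) z.2 ∧ derivT φ z = fderiv ℝ φ z (0, 1) := by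
  have h1 : HasFDerivAt φ (fderiv ℝ φ z) (z.1, z.2) :=
    (h.differentiable (by simp) z).hasFDerivAt
  have h2 := (h1.comp z.2 (hasFDerivAt_prodMk_right z.1 z.2)).hasDerivAt
  have h3 : derivT φ z = fderiv ℝ φ z (0, 1) := by
    unfold derivT
    rw [show (fun t => φ (z.1, t)) = φ ∘ fun y => (z.1, y) from rfl, h2.deriv]
    rfl
  exact ⟨h3 ▸ h2, h3⟩

lemma continuous_derivT {φ : Space d × ℝ → ℝ} (h : ContDiff ℝ ∞ φ) : Continuous (derivT φ) := by
  rw [show derivT φ = fun z => fderiv ℝ φ z (0, 1) from funext fun z => (derivT_eq h z).2]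
  exact (h.continuous_fderiv (by simp)).clm_apply continuous_const

lemma hasCompactSupport_derivT {φ : Space d × ℝ → ℝ} (h : ContDiff ℝ ∞ φ)
    (hc : HasCompactSupport φ) : HasCompactSupport (derivT φ) := by
  refine hc.mono' fun x hx => support_fderiv_subset ℝ (f := φ) fun h0 => hx ?_
  rw [(derivT_eq h x).2, h0]; rfl

lemma memLp_of_compact {X F : Type*} [TopologicalSpace X] [MeasurableSpace X]
    [OpensMeasurableSpace X] [NormedAddCommGroup F] {f : X → F} (μ ν : Measure X)
    [IsFiniteMeasureOnCompacts ν] (h : μ ≤ ν) [SecondCountableTopologyEither X F]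
    (hf : Continuous f) (hc : HasCompactSupport f) : MemLp f 2 μ :=
  (hf.memLp_of_hasCompactSupport (μ := ν) hc).mono_measure h

lemma muP_le (Ω : Set (Space d)) (T : ℝ) : muP Ω T ≤ volume := by
  rw [← muQ_eq]; exact Measure.restrict_le_self

lemma IsTest.memLp {φ : Space d → ℝ} (h : IsTest Ω φ) : MemLp φ 2 (volume.restrict Ω) :=
  memLp_of_compact _ volume Measure.restrict_le_self h.1.continuous h.2.1

lemma IsTest.memLp_gradient {φ : Space d → ℝ} (h : IsTest Ω φ) :
    MemLp (gradient φ) 2 (volume.restrict Ω) :=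
  memLp_of_compact _ volume Measure.restrict_le_self (continuous_gradient h.1)
    (hasCompactSupport_gradient h.2.1)

lemma IsTest.memLp_Q {U : Set (Space d × ℝ)} {φ : Space d × ℝ → ℝ} (h : IsTest U φ) :
    MemLp φ 2 (muP Ω T) :=
  memLp_of_compact _ volume (muP_le Ω T) h.1.continuous h.2.1

lemma IsTest.memLp_gradX {U : Set (Space d × ℝ)} {φ : Space d × ℝ → ℝ} (h : IsTest U φ) :
    MemLp (gradX φ) 2 (muP Ω T) :=
  memLp_of_compact _ volume (muP_le Ω T) (continuous_gradX h.1) (hasCompactSupport_gradX h.1 h.2.1)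

lemma IsTest.memLp_derivT {U : Set (Space d × ℝ)} {φ : Space d × ℝ → ℝ} (h : IsTest U φ) :
    MemLp (derivT φ) 2 (muP Ω T) :=
  memLp_of_compact _ volume (muP_le Ω T) (continuous_derivT h.1)
    (hasCompactSupport_derivT h.1 h.2.1)

/-- Time slices of test functions are test functions. -/
lemma IsTest.slice {I : Set ℝ} {φ : Space d × ℝ → ℝ} (h : IsTest (Ω ×ˢ I) φ) (t : ℝ) :
    IsTest Ω (fun x => φ (x, t)) := by
  have hsub : tsupport (fun x => φ (x, t)) ⊆ Prod.fst '' tsupport φ := by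
    refine closure_minimal ?_ (h.2.1.isCompact.image continuous_fst).isClosed
    intro x hx
    exact ⟨(x, t), subset_tsupport _ hx, rfl⟩
  refine ⟨h.1.comp (contDiff_id.prodMk contDiff_const), ?_, ?_⟩
  · exact (h.2.1.isCompact.image continuous_fst).of_isClosed_subset (isClosed_tsupport _) hsub
  · rintro x hx
    obtain ⟨z, hz, rfl⟩ := hsub hx
    exact (h.2.2 hz).1

/-- Products of test functions in space and in time are test functions. -/
lemma IsTest.mul_time {I : Set ℝ} {ψ : Space d → ℝ} {θ : ℝ → ℝ} (hψ : IsTest Ω ψ)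
    (hθ : IsTest I θ) : IsTest (Ω ×ˢ I) (fun z => ψ z.1 * θ z.2) := by
  have hsub : tsupport (fun z : Space d × ℝ => ψ z.1 * θ z.2) ⊆ tsupport ψ ×ˢ tsupport θ := by
    refine closure_minimal ?_ ((isClosed_tsupport _).prod (isClosed_tsupport _))
    intro z hz
    exact ⟨subset_tsupport _ (left_ne_zero_of_mul hz), subset_tsupport _ (right_ne_zero_of_mul hz)⟩
  refine ⟨(hψ.1.comp contDiff_fst).mul (hθ.1.comp contDiff_snd), ?_, ?_⟩
  · exact (hψ.2.1.isCompact.prod hθ.2.1.isCompact).of_isClosed_subset (isClosed_tsupport _) hsub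
  · exact hsub.trans (prod_mono hψ.2.2 hθ.2.2)

lemma gradX_mul_time {ψ : Space d → ℝ} (hψ : ContDiff ℝ ∞ ψ) (θ : ℝ → ℝ) (z : Space d × ℝ) :
    gradX (fun z => ψ z.1 * θ z.2) z = θ z.2 • gradient ψ z.1 := by
  simp only [gradX, gradient]
  rw [fderiv_mul_const (hψ.differentiable (by simp) _), map_smul]

lemma derivT_mul_time (ψ : Space d → ℝ) (θ : ℝ → ℝ) (z : Space d × ℝ) :
    derivT (fun z => ψ z.1 * θ z.2) z = ψ z.1 * deriv θ z.2 := by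
  simp only [derivT]
  exact deriv_const_mul_field _

lemma IsTest.add {X : Type*} [NormedAddCommGroup X] [NormedSpace ℝ X] {U : Set X} {φ ψ : X → ℝ}
    (hφ : IsTest U φ) (hψ : IsTest U ψ) : IsTest U (fun x => φ x + ψ x) :=
  ⟨hφ.1.add hψ.1, hφ.2.1.add hψ.2.1,
    (tsupport_add φ ψ).trans (union_subset hφ.2.2 hψ.2.2)⟩

lemma IsTest.const_mul {X : Type*} [NormedAddCommGroup X] [NormedSpace ℝ X] {U : Set X}
    {φ : X → ℝ} (hφ : IsTest U φ) (c : ℝ) : IsTest U (fun x => c * φ x) :=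
  ⟨contDiff_const.mul hφ.1, hφ.2.1.mul_left, (tsupport_mul_subset_right).trans hφ.2.2⟩

lemma gradX_add {φ ψ : Space d × ℝ → ℝ} (hφ : ContDiff ℝ ∞ φ) (hψ : ContDiff ℝ ∞ ψ)
    (z : Space d × ℝ) : gradX (fun z => φ z + ψ z) z = gradX φ z + gradX ψ z := by
  refine ext_inner_right ℝ fun v => ?_
  rw [inner_add_left, inner_gradX hφ, inner_gradX hψ, inner_gradX (hφ.add hψ),
    fderiv_fun_add (hφ.differentiable (by simp) _) (hψ.differentiable (by simp) _)]
  rfl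

lemma gradX_const_mul {φ : Space d × ℝ → ℝ} (hφ : ContDiff ℝ ∞ φ) (c : ℝ)
    (z : Space d × ℝ) : gradX (fun z => c * φ z) z = c • gradX φ z := by
  refine ext_inner_right ℝ fun v => ?_
  rw [real_inner_smul_left, inner_gradX hφ, inner_gradX (contDiff_const.mul hφ),
    fderiv_const_mul (hφ.differentiable (by simp) _)]
  rfl

/-- A square integrable function orthogonal to all test functions vanishes. -/
lemma ae_eq_zero_of_forall_test {E F : Type*} [NormedAddCommGroup E] [NormedSpace ℝ E]
    [FiniteDimensional ℝ E] [MeasurableSpace E] [BorelSpace E] [NormedAddCommGroup F]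
    [NormedSpace ℝ F] [CompleteSpace F]
    {μ : Measure E} {U : Set E} (hU : IsOpen U) {f : E → F} (hf : Integrable f (μ.restrict U))
    (h : ∀ φ, IsTest U φ → ∫ x in U, φ x • f x ∂μ = 0) : f =ᵐ[μ.restrict U] 0 := by
  have hl : LocallyIntegrableOn f U μ := (show IntegrableOn f U μ from hf).locallyIntegrableOn
  have := hU.ae_eq_zero_of_integral_contDiff_smul_eq_zero hl fun g h1 h2 h3 => by
    rw [← h g ⟨h1, h2, h3⟩, setIntegral_eq_integral_of_forall_compl_eq_zero]
    intro x hx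
    rw [image_eq_zero_of_notMem_tsupport fun h' => hx (h3 h'), zero_smul]
  exact (ae_restrict_iff' hU.measurableSet).2 this

end Test

end ParabolicOC

namespace ParabolicOC

/-! ### The energy spaces `H^1_0(Ω)` and `H^{1,0}_0(Q)` as closed subspaces -/

section L2tools

variable {α F : Type*} [MeasurableSpace α] [NormedAddCommGroup F] [InnerProductSpace ℝ F]
  {μ : Measure α}

lemma inner_toLp {f g : α → F} (hf : MemLp f 2 μ) (hg : MemLp g 2 μ) :
    inner ℝ (hf.toLp f) (hg.toLp g) = ∫ x, inner ℝ (f x) (g x) ∂μ := by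
  rw [L2.inner_def]
  refine integral_congr_ae ?_
  filter_upwards [hf.coeFn_toLp, hg.coeFn_toLp] with x h1 h2
  rw [h1, h2]

lemma l2norm_eq {f : α → F} (hf : MemLp f 2 μ) : l2norm μ f = ‖hf.toLp f‖ :=
  (Lp.norm_toLp f hf).symm

lemma norm_toLp_sq {f : α → F} (hf : MemLp f 2 μ) : ‖hf.toLp f‖ ^ 2 = ∫ x, ‖f x‖ ^ 2 ∂μ := by
  rw [← real_inner_self_eq_norm_sq, inner_toLp]
  simp only [real_inner_self_eq_norm_sq]

end L2tools

section Spaces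

variable {d : ℕ} {Ω : Set (Space d)} {T : ℝ}

abbrev LX (Ω : Set (Space d)) := Lp ℝ 2 (volume.restrict Ω)
abbrev LG (Ω : Set (Space d)) := Lp (Space d) 2 (volume.restrict Ω)
abbrev HX (Ω : Set (Space d)) (T : ℝ) := Lp ℝ 2 (muP Ω T)
abbrev HG (Ω : Set (Space d)) (T : ℝ) := Lp (Space d) 2 (muP Ω T)

/-- The pairs `(φ, ∇φ)` with `φ ∈ C_c^∞(Ω)`. -/
def testPairs (Ω : Set (Space d)) : Set (WithLp 2 (LX Ω × LG Ω)) :=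
  {p | ∃ (φ : Space d → ℝ) (h : IsTest Ω φ),
    p = WithLp.toLp 2 (h.memLp.toLp φ, h.memLp_gradient.toLp (gradient φ))}

/-- The pairs `(φ, ∇φ)` with `φ ∈ C_c^∞(Q)`. -/
def testPairsQ (Ω : Set (Space d)) (T : ℝ) : Set (WithLp 2 (HX Ω T × HG Ω T)) :=
  {p | ∃ (φ : Space d × ℝ → ℝ) (h : IsTest (cyl Ω T) φ),
    p = WithLp.toLp 2 (h.memLp_Q.toLp φ, h.memLp_gradX.toLp (gradX φ))}

/-- The graph of the weak gradient on `H^1_0(Ω)`. -/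
def W0 (Ω : Set (Space d)) : Submodule ℝ (WithLp 2 (LX Ω × LG Ω)) :=
  (Submodule.span ℝ (testPairs Ω))ᗮᗮ

/-- The graph of the weak spatial gradient on `H^{1,0}_0(Q)`. -/
def WQ (Ω : Set (Space d)) (T : ℝ) : Submodule ℝ (WithLp 2 (HX Ω T × HG Ω T)) :=
  (Submodule.span ℝ (testPairsQ Ω T))ᗮᗮ

/-- `w ∈ H^1_0(Ω)` with weak gradient `G`. -/
def InW0 (w : LX Ω) (G : LG Ω) : Prop := WithLp.toLp 2 (w, G) ∈ W0 Ω

/-- `u ∈ H^{1,0}_0(Q)` with weak spatial gradient `G`. -/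
def InWQ (u : HX Ω T) (G : HG Ω T) : Prop := WithLp.toLp 2 (u, G) ∈ WQ Ω T

lemma mem_orthogonal_span_iff {E : Type*} [NormedAddCommGroup E] [InnerProductSpace ℝ E]
    (S : Set E) (v : E) : v ∈ (Submodule.span ℝ S)ᗮ ↔ ∀ p ∈ S, inner ℝ p v = 0 := by
  rw [Submodule.mem_orthogonal]
  refine ⟨fun h p hp => h p (Submodule.subset_span hp), fun h p hp => ?_⟩
  induction hp using Submodule.span_induction with
  | mem x hx => exact h x hx
  | zero => exact inner_zero_left _
  | add x y _ _ hx hy => rw [inner_add_left, hx, hy, add_zero]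
  | smul a x _ hx => rw [real_inner_smul_left, hx, mul_zero]

lemma mem_testPairs_orthogonal (a : LX Ω) (A : LG Ω) :
    WithLp.toLp 2 (a, A) ∈ (Submodule.span ℝ (testPairs Ω))ᗮ ↔
      ∀ (φ : Space d → ℝ) (h : IsTest Ω φ),
        inner ℝ (h.memLp.toLp φ) a + inner ℝ (h.memLp_gradient.toLp (gradient φ)) A = 0 := by
  rw [mem_orthogonal_span_iff]
  constructor
  · intro h φ hφ
    simpa [WithLp.prod_inner_apply] using h _ ⟨φ, hφ, rfl⟩
  · rintro h p ⟨φ, hφ, rfl⟩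
    simpa [WithLp.prod_inner_apply] using h φ hφ

lemma mem_testPairsQ_orthogonal (a : HX Ω T) (A : HG Ω T) :
    WithLp.toLp 2 (a, A) ∈ (Submodule.span ℝ (testPairsQ Ω T))ᗮ ↔
      ∀ (φ : Space d × ℝ → ℝ) (h : IsTest (cyl Ω T) φ),
        inner ℝ (h.memLp_Q.toLp φ) a + inner ℝ (h.memLp_gradX.toLp (gradX φ)) A = 0 := by
  rw [mem_orthogonal_span_iff]
  constructor
  · intro h φ hφ
    simpa [WithLp.prod_inner_apply] using h _ ⟨φ, hφ, rfl⟩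
  · rintro h p ⟨φ, hφ, rfl⟩
    simpa [WithLp.prod_inner_apply] using h φ hφ

/-- The closure is described by duality: a pair belongs to it when everything that annihilates the
test pairs annihilates it. Passing between Ω and Q then needs no approximating sequences, only
transport of annihilators. -/
lemma inW0_iff (w : LX Ω) (G : LG Ω) :
    InW0 w G ↔ ∀ (a : LX Ω) (A : LG Ω), (∀ (φ : Space d → ℝ) (h : IsTest Ω φ),
        inner ℝ (h.memLp.toLp φ) a + inner ℝ (h.memLp_gradient.toLp (gradient φ)) A = 0) →
      inner ℝ a w + inner ℝ A G = 0 := by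
  rw [InW0, W0, Submodule.mem_orthogonal]
  constructor
  · intro h a A hA
    simpa [WithLp.prod_inner_apply] using h _ ((mem_testPairs_orthogonal a A).2 hA)
  · intro h p hp
    have := h p.fst p.snd ((mem_testPairs_orthogonal p.fst p.snd).1 hp)
    simpa [WithLp.prod_inner_apply] using this

lemma inWQ_iff (w : HX Ω T) (G : HG Ω T) :
    InWQ w G ↔ ∀ (a : HX Ω T) (A : HG Ω T), (∀ (φ : Space d × ℝ → ℝ) (h : IsTest (cyl Ω T) φ),
        inner ℝ (h.memLp_Q.toLp φ) a + inner ℝ (h.memLp_gradX.toLp (gradX φ)) A = 0) →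
      inner ℝ a w + inner ℝ A G = 0 := by
  rw [InWQ, WQ, Submodule.mem_orthogonal]
  constructor
  · intro h a A hA
    simpa [WithLp.prod_inner_apply] using h _ ((mem_testPairsQ_orthogonal a A).2 hA)
  · intro h p hp
    have := h p.fst p.snd ((mem_testPairsQ_orthogonal p.fst p.snd).1 hp)
    simpa [WithLp.prod_inner_apply] using this

lemma InWQ.test {φ : Space d × ℝ → ℝ} (h : IsTest (cyl Ω T) φ) :
    InWQ (Ω := Ω) (T := T) (h.memLp_Q.toLp φ) (h.memLp_gradX.toLp (gradX φ)) :=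
  (inWQ_iff _ _).2 fun a A hA => by
    rw [real_inner_comm, real_inner_comm (h.memLp_gradX.toLp (gradX φ))]
    exact hA φ h

lemma InW0.zero : InW0 (0 : LX Ω) 0 := (W0 Ω).zero_mem

lemma InWQ.sub {u v : HX Ω T} {G K : HG Ω T} (h : InWQ u G) (h' : InWQ v K) :
    InWQ (u - v) (G - K) :=
  (inWQ_iff _ _).2 fun a A hA => by
    rw [inner_sub_right, inner_sub_right]
    linarith [(inWQ_iff _ _).1 h a A hA, (inWQ_iff _ _).1 h' a A hA]

/-- The pairs `(φ, ∇φ)` form a linear subspace. -/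
lemma mem_span_testPairsQ {p : WithLp 2 (HX Ω T × HG Ω T)} :
    p ∈ Submodule.span ℝ (testPairsQ Ω T) ↔ p ∈ testPairsQ Ω T := by
  refine ⟨fun hp => ?_, fun hp => Submodule.subset_span hp⟩
  induction hp using Submodule.span_induction with
  | mem x hx => exact hx
  | zero =>
    have h0 : IsTest (cyl Ω T) (fun _ => (0 : ℝ)) :=
      ⟨contDiff_const, HasCompactSupport.zero, by simp [tsupport]⟩
    refine ⟨_, h0, ?_⟩
    have e2 : h0.memLp_gradX.toLp (gradX fun _ => (0 : ℝ)) = (0 : HG Ω T) := by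
      rw [Lp.eq_zero_iff_ae_eq_zero]
      filter_upwards [h0.memLp_gradX.coeFn_toLp] with z hz
      rw [hz]; simp [gradX]
    have e1 : h0.memLp_Q.toLp (fun _ => (0 : ℝ)) = (0 : HX Ω T) := by
      rw [Lp.eq_zero_iff_ae_eq_zero]
      exact h0.memLp_Q.coeFn_toLp
    rw [e1, e2]; rfl
  | add x y _ _ hx hy =>
    obtain ⟨φ, hφ, rfl⟩ := hx
    obtain ⟨ψ, hψ, rfl⟩ := hy
    refine ⟨_, hφ.add hψ, ?_⟩
    have e2 : (hφ.add hψ).memLp_gradX.toLp (gradX fun z => φ z + ψ z)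
        = (hφ.memLp_gradX.toLp (gradX φ) + hψ.memLp_gradX.toLp (gradX ψ) : HG Ω T) := by
      rw [← MemLp.toLp_add]
      congr 1
      exact funext fun z => gradX_add hφ.1 hψ.1 z
    rw [e2]; rfl
  | smul a x _ hx =>
    obtain ⟨φ, hφ, rfl⟩ := hx
    refine ⟨_, hφ.const_mul a, ?_⟩
    have e2 : (hφ.const_mul a).memLp_gradX.toLp (gradX fun z => a * φ z)
        = (a • hφ.memLp_gradX.toLp (gradX φ) : HG Ω T) := by
      rw [← MemLp.toLp_const_smul]
      congr 1
      exact funext fun z => gradX_const_mul hφ.1 a z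
    rw [e2]; rfl

/-- A double orthogonal complement is the closed span, and the test pairs already form a subspace.
-/
lemma inWQ_iff_mem_closure (u : HX Ω T) (G : HG Ω T) :
    InWQ u G ↔ WithLp.toLp 2 (u, G) ∈ closure (testPairsQ Ω T) := by
  rw [InWQ, WQ, Submodule.orthogonal_orthogonal_eq_closure, ← SetLike.mem_coe,
    Submodule.topologicalClosure_coe]
  rw [show ((Submodule.span ℝ (testPairsQ Ω T) : Submodule ℝ _) :
    Set (WithLp 2 (HX Ω T × HG Ω T))) = testPairsQ Ω T from Set.ext fun p => mem_span_testPairsQ]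

lemma tendsto_eLpNorm_sub_iff {α F : Type*} [MeasurableSpace α] [NormedAddCommGroup F]
    {μ : Measure α} {f : ℕ → α → F} {g : α → F} (hf : ∀ n, MemLp (f n) 2 μ) (hg : MemLp g 2 μ) :
    Tendsto (fun n => eLpNorm (fun z => f n z - g z) 2 μ) atTop (𝓝 0) ↔
      Tendsto (fun n => (hf n).toLp (f n)) atTop (𝓝 (hg.toLp g)) :=
  (Lp.tendsto_Lp_iff_tendsto_eLpNorm'' f hf g hg).symm

lemma isH10Zero_iff {u : Space d × ℝ → ℝ} {G : Space d × ℝ → Space d}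
    (hu : MemLp u 2 (muP Ω T)) (hG : MemLp G 2 (muP Ω T)) :
    IsH10Zero Ω T u G ↔ InWQ (hu.toLp u) (hG.toLp G) := by
  rw [IsH10Zero, muQ_eq, inWQ_iff_mem_closure, mem_closure_iff_seq_limit]
  constructor
  · rintro ⟨-, -, φ, hφ, h1, h2⟩
    rw [tendsto_eLpNorm_sub_iff (fun n => (hφ n).memLp_Q) hu] at h1
    rw [tendsto_eLpNorm_sub_iff (fun n => (hφ n).memLp_gradX) hG] at h2
    exact ⟨_, fun n => ⟨φ n, hφ n, rfl⟩,
      ((WithLp.prod_continuous_toLp 2 _ _).tendsto _).comp (h1.prodMk_nhds h2)⟩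
  · rintro ⟨p, hp, hlim⟩
    choose φ hφ hpφ using hp
    refine ⟨hu, hG, φ, hφ, ?_, ?_⟩
    · rw [tendsto_eLpNorm_sub_iff (fun n => (hφ n).memLp_Q) hu]
      have := ((continuous_fst.comp (WithLp.prod_continuous_ofLp 2 _ _)).tendsto _).comp hlim
      refine this.congr fun n => ?_
      simp only [Function.comp_apply, hpφ n]
    · rw [tendsto_eLpNorm_sub_iff (fun n => (hφ n).memLp_gradX) hG]
      have := ((continuous_snd.comp (WithLp.prod_continuous_ofLp 2 _ _)).tendsto _).comp hlim
      refine this.congr fun n => ?_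
      simp only [Function.comp_apply, hpφ n]

/-- Friedrichs' inequality on each time slice, squared and integrated in time. -/
lemma IsTest.norm_sq_le [IsFiniteMeasure (volume.restrict Ω)] {CF : ℝ}
    (hCF : IsFriedrichsConst Ω CF) {φ : Space d × ℝ → ℝ} (hφ : IsTest (cyl Ω T) φ) :
    ∫ z, ‖φ z‖ ^ 2 ∂(muP Ω T) ≤ CF ^ 2 * ∫ z, ‖gradX φ z‖ ^ 2 ∂(muP Ω T) := by
  have i1 : Integrable (fun z => ‖φ z‖ ^ 2) (muP Ω T) :=
    (memLp_two_iff_integrable_sq_norm hφ.memLp_Q.1).1 hφ.memLp_Q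
  have i2 : Integrable (fun z => ‖gradX φ z‖ ^ 2) (muP Ω T) :=
    (memLp_two_iff_integrable_sq_norm hφ.memLp_gradX.1).1 hφ.memLp_gradX
  rw [integral_prod_symm _ i1, integral_prod_symm _ i2, ← integral_const_mul]
  refine integral_mono i1.integral_prod_right (i2.integral_prod_right.const_mul _) fun t => ?_
  have hs : IsTest Ω (fun x => φ (x, t)) := IsTest.slice hφ t
  have hF := hCF.2 _ hs
  rw [l2norm_eq hs.memLp, l2norm_eq hs.memLp_gradient] at hF
  have := pow_le_pow_left₀ (norm_nonneg _) hF 2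
  rw [mul_pow, norm_toLp_sq, norm_toLp_sq] at this
  exact this

/-- Friedrichs' inequality on `H^{1,0}_0(Q)`. -/
lemma InWQ.norm_le [IsFiniteMeasure (volume.restrict Ω)] {CF : ℝ} (hCF : IsFriedrichsConst Ω CF)
    {u : HX Ω T} {G : HG Ω T} (h : InWQ u G) : ‖u‖ ≤ CF * ‖G‖ := by
  rw [inWQ_iff_mem_closure] at h
  have c1 : Continuous fun p : WithLp 2 (HX Ω T × HG Ω T) => ‖p.fst‖ :=
    (continuous_fst.comp (WithLp.prod_continuous_ofLp 2 _ _)).norm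
  have c2 : Continuous fun p : WithLp 2 (HX Ω T × HG Ω T) => CF * ‖p.snd‖ :=
    continuous_const.mul (continuous_snd.comp (WithLp.prod_continuous_ofLp 2 _ _)).norm
  -- The inequality is a closed condition on pairs, so test pairs suffice.
  have hsub : testPairsQ Ω T ⊆ {p : WithLp 2 (HX Ω T × HG Ω T) | ‖p.fst‖ ≤ CF * ‖p.snd‖} := by
    rintro p ⟨φ, hφ, rfl⟩
    have h0 := IsTest.norm_sq_le hCF hφ
    rw [← norm_toLp_sq hφ.memLp_Q, ← norm_toLp_sq hφ.memLp_gradX, ← mul_pow] at h0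
    exact (pow_le_pow_iff_left₀ (norm_nonneg _) (mul_nonneg hCF.1.le (norm_nonneg _))
      two_ne_zero).1 h0
  have hcl : closure (testPairsQ Ω T) ⊆ _ := closure_minimal hsub (isClosed_le c1 c2)
  have := hcl h
  simpa only [mem_ofPred_eq, WithLp.toLp_fst, WithLp.toLp_snd] using this

end Spaces

end ParabolicOC

namespace ParabolicOC

/-! ### Hartley coefficients of functions in `H^{1,0}_0(Q)` -/

section ModesOfSpaces

variable {d : ℕ} {Ω : Set (Space d)} {T : ℝ} [IsFiniteMeasure (volume.restrict Ω)]

/-- The coefficient of `u ∈ L²(Q)` with respect to the `j`-th Hartley function. -/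
abbrev cX (hT : 0 < T) (j : ℤ) : HX Ω T →L[ℝ] LX Ω := coeff (mode ℝ (volume.restrict Ω) hT) j
/-- The coefficient of `G ∈ L²(Q)^d` with respect to the `j`-th Hartley function. -/
abbrev cG (hT : 0 < T) (j : ℤ) : HG Ω T →L[ℝ] LG Ω :=
  coeff (mode (Space d) (volume.restrict Ω) hT) j
abbrev mX (hT : 0 < T) (j : ℤ) : LX Ω →ₗᵢ[ℝ] HX Ω T := mode ℝ (volume.restrict Ω) hT j
abbrev mG (hT : 0 < T) (j : ℤ) : LG Ω →ₗᵢ[ℝ] HG Ω T := mode (Space d) (volume.restrict Ω) hT j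

variable (Ω) in
lemma completeX (hT : 0 < T) : CompleteFamily (mode ℝ (volume.restrict Ω) hT) :=
  completeFamily_mode hT

variable (Ω) in
lemma completeG (hT : 0 < T) : CompleteFamily (mode (Space d) (volume.restrict Ω) hT) :=
  completeFamily_mode hT

lemma inner_toLp_mode {F : Type*} [NormedAddCommGroup F] [InnerProductSpace ℝ F] (hT : 0 < T)
    (j : ℤ) {f : Space d × ℝ → F} (hf : MemLp f 2 (muP Ω T)) (a : Lp F 2 (volume.restrict Ω)) :
    inner ℝ (hf.toLp f) (mode F (volume.restrict Ω) hT j a)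
      = ∫ z, hartley T j z.2 * inner ℝ (f z) (a z.1) ∂(muP Ω T) := by
  rw [L2.inner_def]
  refine integral_congr_ae ?_
  filter_upwards [hf.coeFn_toLp, coeFn_mode hT j a] with z h1 h2
  rw [h1, h2, real_inner_smul_right]

lemma integrable_inner_mode {F : Type*} [NormedAddCommGroup F] [InnerProductSpace ℝ F] (hT : 0 < T)
    (j : ℤ) {f : Space d × ℝ → F} (hf : MemLp f 2 (muP Ω T)) (a : Lp F 2 (volume.restrict Ω)) :
    Integrable (fun z => hartley T j z.2 * inner ℝ (f z) (a z.1)) (muP Ω T) := by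
  refine (L2.integrable_inner (𝕜 := ℝ) (hf.toLp f) (mode F (volume.restrict Ω) hT j a)).congr ?_
  filter_upwards [hf.coeFn_toLp, coeFn_mode hT j a] with z h1 h2
  rw [h1, h2, real_inner_smul_right]

lemma inner_toLp_left {α F : Type*} [MeasurableSpace α] [NormedAddCommGroup F]
    [InnerProductSpace ℝ F] {μ : Measure α} {f : α → F} (hf : MemLp f 2 μ) (a : Lp F 2 μ) :
    inner ℝ (hf.toLp f) a = ∫ x, inner ℝ (f x) (a x) ∂μ := by
  rw [L2.inner_def]
  refine integral_congr_ae ?_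
  filter_upwards [hf.coeFn_toLp] with x h1
  rw [h1]

lemma integrable_inner_toLp_left {α F : Type*} [MeasurableSpace α] [NormedAddCommGroup F]
    [InnerProductSpace ℝ F] {μ : Measure α} {f : α → F} (hf : MemLp f 2 μ) (a : Lp F 2 μ) :
    Integrable (fun x => (inner ℝ (f x) (a x) : ℝ)) μ := by
  refine (L2.integrable_inner (𝕜 := ℝ) (hf.toLp f) a).congr ?_
  filter_upwards [hf.coeFn_toLp] with x h1
  rw [h1]

/-- The modes of a pair orthogonal to all `(φ, ∇φ)` on `Ω` are orthogonal to all `(φ, ∇φ)` on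
`Q`. -/
lemma orthogonal_mode (hT : 0 < T) (j : ℤ) {a : LX Ω} {A : LG Ω}
    (h : ∀ (φ : Space d → ℝ) (h : IsTest Ω φ),
      inner ℝ (h.memLp.toLp φ) a + inner ℝ (h.memLp_gradient.toLp (gradient φ)) A = 0)
    (φ : Space d × ℝ → ℝ) (hφ : IsTest (cyl Ω T) φ) :
    inner ℝ (hφ.memLp_Q.toLp φ) (mX hT j a)
      + inner ℝ (hφ.memLp_gradX.toLp (gradX φ)) (mG hT j A) = 0 := by
  have i1 := integrable_inner_mode hT j (Ω := Ω) hφ.memLp_Q a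
  have i2 := integrable_inner_mode hT j (Ω := Ω) hφ.memLp_gradX A
  have i12 : Integrable (fun z => hartley T j z.2 * inner ℝ (φ z) (a z.1)
      + hartley T j z.2 * inner ℝ (gradX φ z) (A z.1)) (muP Ω T) := i1.add i2
  rw [inner_toLp_mode, inner_toLp_mode, ← integral_add i1 i2, integral_prod_symm _ i12]
  refine integral_eq_zero_of_ae (ae_of_all _ fun t => ?_)
  -- For fixed t the slice of φ is a test function on Ω, so the hypothesis kills the inner spatial
  -- integral.
  have hs : IsTest Ω (fun x => φ (x, t)) := IsTest.slice hφ t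
  have h0 := h _ hs
  rw [inner_toLp_left, inner_toLp_left, ← integral_add (integrable_inner_toLp_left hs.memLp a)
    (integrable_inner_toLp_left hs.memLp_gradient A)] at h0
  have : ∀ x, hartley T j t * inner ℝ (φ (x, t)) (a x)
      + hartley T j t * inner ℝ (gradX φ (x, t)) (A x)
      = hartley T j t * (inner ℝ (φ (x, t)) (a x)
        + inner ℝ (gradient (fun x => φ (x, t)) x) (A x)) := fun x => by
    rw [mul_add]; rfl
  simp only [this, integral_const_mul]
  rw [h0]
  simp

/-- The coefficients of a function in `H^{1,0}_0(Q)` belong to `H^1_0(Ω)`. -/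
lemma InWQ.coeff (hT : 0 < T) (j : ℤ) {u : HX Ω T} {G : HG Ω T} (h : InWQ u G) :
    InW0 (cX hT j u) (cG hT j G) := by
  rw [inW0_iff]
  intro a A hA
  -- Adjointness trades coefficients of (u, G) for modes of the annihilating pair.
  rw [inner_coeff_right, inner_coeff_right]
  exact (inWQ_iff u G).1 h _ _ (orthogonal_mode hT j hA)

/-- Tests ψ(x)θ(t) with θ ∈ C_c^∞(0,T) show that t ↦ ∫_Ω (ψ b + ∇ψ·B) vanishes almost everywhere.
The weight e_j can only be inserted afterwards, since ψ e_j need not have compact support in Q. -/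
lemma orthogonal_coeff (hT : 0 < T) (j : ℤ) {b : HX Ω T} {B : HG Ω T}
    (h : ∀ (φ : Space d × ℝ → ℝ) (h : IsTest (cyl Ω T) φ),
      inner ℝ (h.memLp_Q.toLp φ) b + inner ℝ (h.memLp_gradX.toLp (gradX φ)) B = 0)
    (ψ : Space d → ℝ) (hψ : IsTest Ω ψ) :
    inner ℝ (hψ.memLp.toLp ψ) (cX hT j b)
      + inner ℝ (hψ.memLp_gradient.toLp (gradient ψ)) (cG hT j B) = 0 := by
  have m1 : MemLp (fun z : Space d × ℝ => ψ z.1) 2 (muP Ω T) := hψ.memLp.comp_fst _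
  have m2 : MemLp (fun z : Space d × ℝ => gradient ψ z.1) 2 (muP Ω T) :=
    hψ.memLp_gradient.comp_fst _
  have i1 := integrable_inner_toLp_left m1 b
  have i2 := integrable_inner_toLp_left m2 B
  set k : Space d × ℝ → ℝ := fun z => inner ℝ (ψ z.1) (b z) + inner ℝ (gradient ψ z.1) (B z)
    with hk
  have ik : Integrable k (muP Ω T) := i1.add i2
  have key : (fun t => ∫ x in Ω, k (x, t)) =ᵐ[tauT T] 0 := by
    refine ae_eq_zero_of_forall_test isOpen_Ioo ik.integral_prod_right fun θ hθ => ?_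
    have hp : IsTest (cyl Ω T) (fun z => ψ z.1 * θ z.2) := hψ.mul_time hθ
    have h0 := h _ hp
    rw [inner_toLp_left, inner_toLp_left, ← integral_add
      (integrable_inner_toLp_left hp.memLp_Q b) (integrable_inner_toLp_left hp.memLp_gradX B)] at h0
    have e : ∀ z : Space d × ℝ, inner ℝ (ψ z.1 * θ z.2) (b z)
        + inner ℝ (gradX (fun z => ψ z.1 * θ z.2) z) (B z) = θ z.2 * k z := fun z => by
      rw [gradX_mul_time hψ.1, real_inner_smul_left, hk]
      simp only [RCLike.inner_apply, conj_trivial]; ring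
    simp only [e] at h0
    have iθ : Integrable (fun z : Space d × ℝ => θ z.2 * k z) (muP Ω T) := by
      refine ((integrable_inner_toLp_left hp.memLp_Q b).add
        (integrable_inner_toLp_left hp.memLp_gradX B)).congr (ae_of_all _ fun z => ?_)
      exact e z
    rw [integral_prod_symm _ iθ] at h0
    simpa only [integral_const_mul, smul_eq_mul] using h0
  have iH : Integrable (fun z : Space d × ℝ => hartley T j z.2 * k z) (muP Ω T) :=
    integrable_hartley_smul j ik
  have e1 : ∀ {F : Type} [NormedAddCommGroup F] [InnerProductSpace ℝ F]
      {g : Space d → F} (hg : MemLp g 2 (volume.restrict Ω)) (v : Lp F 2 (muP Ω T)),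
      inner ℝ (mode F (volume.restrict Ω) hT j (hg.toLp g)) v
        = ∫ z, hartley T j z.2 * inner ℝ (g z.1) (v z) ∂(muP Ω T) := by
    intro F _ _ g hg v
    rw [L2.inner_def]
    refine integral_congr_ae ?_
    filter_upwards [coeFn_mode hT j (hg.toLp g), ae_comp_fst hg.coeFn_toLp (tauT T)] with z h1 h2
    rw [h1, h2, real_inner_smul_left]
  have j1 : Integrable (fun z : Space d × ℝ => hartley T j z.2 * inner ℝ (ψ z.1) (b z))
      (muP Ω T) := integrable_hartley_smul j i1
  have j2 : Integrable (fun z : Space d × ℝ => hartley T j z.2 * inner ℝ (gradient ψ z.1) (B z))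
      (muP Ω T) := integrable_hartley_smul j i2
  rw [inner_coeff_right, inner_coeff_right, e1, e1, ← integral_add j1 j2]
  have e2 : ∀ z : Space d × ℝ, hartley T j z.2 * inner ℝ (ψ z.1) (b z)
      + hartley T j z.2 * inner ℝ (gradient ψ z.1) (B z) = hartley T j z.2 * k z :=
    fun z => by rw [hk]; ring
  simp only [e2]
  rw [integral_prod_symm _ iH]
  simp only [integral_const_mul]
  refine integral_eq_zero_of_ae ?_
  filter_upwards [key] with t ht
  rw [ht]; simp

/-- The modes of a function in `H^1_0(Ω)` belong to `H^{1,0}_0(Q)`. -/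
lemma InW0.mode (hT : 0 < T) (j : ℤ) {w : LX Ω} {G : LG Ω} (h : InW0 w G) :
    InWQ (mX hT j w) (mG hT j G) := by
  rw [inWQ_iff]
  intro a A hA
  rw [← inner_coeff, ← inner_coeff]
  exact (inW0_iff w G).1 h _ _ (orthogonal_coeff hT j hA)

/-- Membership in `H^{1,0}_0(Q)` is characterized by the coefficients. -/
lemma inWQ_of_coeff (hT : 0 < T) {u : HX Ω T} {G : HG Ω T}
    (h : ∀ j, InW0 (cX hT j u) (cG hT j G)) : InWQ u G := by
  rw [inWQ_iff]
  intro a A hA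
  -- Parseval in both components reduces the annihilation identity to one for each mode.
  have h1 := (completeX Ω hT).hasSum_inner a u
  have h2 := (completeG Ω hT).hasSum_inner A G
  refine (h1.add h2).unique ?_
  have : ∀ j, inner ℝ (cX hT j a) (cX hT j u) + inner ℝ (cG hT j A) (cG hT j G) = 0 := fun j =>
    (inW0_iff _ _).1 (h j) _ _ (orthogonal_coeff hT j hA)
  simp only [this]
  exact hasSum_zero

/-- Friedrichs' inequality on `H^1_0(Ω)`. -/
lemma InW0.norm_le (hT : 0 < T) {CF : ℝ} (hCF : IsFriedrichsConst Ω CF) {w : LX Ω} {G : LG Ω}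
    (h : InW0 w G) : ‖w‖ ≤ CF * ‖G‖ := by
  -- A mode embedding is isometric in both components, so the inequality on Q descends to Ω; index 0
  -- is an arbitrary choice.
  simpa using (h.mode hT 0).norm_le hCF

/-- The weak spatial gradient is unique. -/
lemma InWQ.eq_zero (hΩ : IsOpen Ω) {G : HG Ω T} (h : InWQ (0 : HX Ω T) G) : G = 0 := by
  have hop : IsOpen (cyl Ω T) := hΩ.prod isOpen_Ioo
  have hz : ∀ (ψ : Space d × ℝ → ℝ), IsTest (cyl Ω T) ψ → ∀ e : Space d,
      ∫ z, ψ z * inner ℝ e (G z) ∂(muP Ω T) = 0 := by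
    intro ψ hψ e
    have m1 : MemLp (fun z => fderiv ℝ ψ z (e, 0)) 2 (muP Ω T) := by
      have := (hψ.memLp_gradX (Ω := Ω) (T := T)).inner_const (𝕜 := ℝ) e
      simpa only [inner_gradX hψ.1] using this
    have m2 : MemLp (fun z => ψ z • e) 2 (muP Ω T) := by
      refine (hψ.memLp_Q (Ω := Ω) (T := T)).of_le_mul (c := ‖e‖)
        ((hψ.1.continuous.smul continuous_const).aestronglyMeasurable) (ae_of_all _ fun z => ?_)
      rw [norm_smul, mul_comm]
    -- The pair (∂_e ψ, ψ e) annihilates every (φ, ∇φ) by integration by parts, so it annihilates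
    -- (0, G); this leaves ∫ ψ e·G = 0.
    have h0 := (inWQ_iff 0 G).1 h (m1.toLp _) (m2.toLp _) ?_
    · rw [inner_zero_right, zero_add, inner_toLp_left] at h0
      simpa only [real_inner_smul_left] using h0
    · intro φ hφ
      rw [inner_toLp, inner_toLp]
      have hc : ∀ {f g : Space d × ℝ → ℝ}, Continuous f → Continuous g → HasCompactSupport f →
          Integrable (fun z => f z * g z) volume := fun hf hg hcf =>
        (hf.mul hg).integrable_of_hasCompactSupport hcf.mul_right
      have hd : ∀ {φ : Space d × ℝ → ℝ}, ContDiff ℝ ∞ φ →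
          Continuous fun z => fderiv ℝ φ z (e, 0) := fun hφ =>
        (hφ.continuous_fderiv (by simp)).clm_apply continuous_const
      have hcs : ∀ {φ : Space d × ℝ → ℝ}, HasCompactSupport φ →
          HasCompactSupport fun z => fderiv ℝ φ z (e, 0) := fun hφ =>
        HasCompactSupport.fderiv_apply (𝕜 := ℝ) hφ _
      have : (volume : Measure (Space d × ℝ)).IsAddHaarMeasure := by
        rw [Measure.volume_eq_prod]; infer_instance
      have ibp := integral_mul_fderiv_eq_neg_fderiv_mul_of_integrable (μ := volume) (f := φ)
        (g := ψ) (v := ((e, 0) : Space d × ℝ))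
        (hc (hd hφ.1) hψ.1.continuous (hcs hφ.2.1)) (hc hφ.1.continuous (hd hψ.1) hφ.2.1)
        (hc hφ.1.continuous hψ.1.continuous hφ.2.1)
        (fun x _ => hφ.1.differentiable (by simp) x) (fun x _ => hψ.1.differentiable (by simp) x)
      have hr : ∀ {f : Space d × ℝ → ℝ}, (∀ z, z ∉ tsupport φ → f z = 0) →
          ∫ z, f z ∂(muP Ω T) = ∫ z, f z := fun hf => by
        rw [← muQ_eq, muQ]
        exact setIntegral_eq_integral_of_forall_compl_eq_zero fun z hz =>
          hf z fun h' => hz (hφ.2.2 h')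
      have s1 : ∀ z, inner ℝ (φ z) (fderiv ℝ ψ z (e, 0)) = φ z * fderiv ℝ ψ z (e, 0) := fun z => by
        simp [mul_comm]
      have s2 : ∀ z, inner ℝ (gradX φ z) (ψ z • e) = fderiv ℝ φ z (e, 0) * ψ z := fun z => by
        rw [real_inner_smul_right, inner_gradX hφ.1, mul_comm]
      simp only [s1, s2]
      rw [hr, hr, ibp, neg_add_cancel]
      · intro z hz
        rw [show fderiv ℝ φ z = 0 from by
          by_contra h'
          exact hz (support_fderiv_subset ℝ h')]
        simp
      · intro z hz
        rw [image_eq_zero_of_notMem_tsupport hz, zero_mul]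
  have hi : Integrable G (muP Ω T) := (Lp.memLp G).integrable (by norm_num)
  have hi' : Integrable G (muQ Ω T) := by rwa [muQ_eq]
  suffices hae : (G : Space d × ℝ → Space d) =ᵐ[muQ Ω T] 0 by
    rw [muQ_eq] at hae
    exact (Lp.eq_zero_iff_ae_eq_zero).2 hae
  refine ae_eq_zero_of_forall_test hop hi' fun ψ hψ => ?_
  refine ext_inner_left ℝ fun e => ?_
  change inner ℝ e (∫ z, ψ z • G z ∂(muQ Ω T)) = _
  rw [muQ_eq, inner_zero_right, ← integral_inner, ← hz ψ hψ e]
  · simp only [real_inner_smul_right]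
  · obtain ⟨C, hC⟩ := hψ.1.continuous.bounded_above_of_compact_support hψ.2.1
    exact hi.bdd_smul C hψ.1.continuous.aestronglyMeasurable (ae_of_all _ hC)

end ModesOfSpaces

end ParabolicOC

namespace ParabolicOC

/-! ### Saddle point systems in Hilbert spaces -/

section Saddle

variable {K : Type*} [NormedAddCommGroup K] [InnerProductSpace ℝ K] [CompleteSpace K]

/-- Solvability of a coupled system with coercive symmetric forms `g`, `n` and a skew form `s`. -/
lemma exists_saddle (g n l s : K →L[ℝ] K →L[ℝ] ℝ) {c lam : ℝ} (hc : 0 < c) (hlam : 0 < lam)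
    (hn : ∀ x y, n x y = n y x)
    (hs : ∀ x y, s x y = -s y x) (hl0 : ∀ x, 0 ≤ l x x)
    (hgc : ∀ x, c * ‖x‖ ^ 2 ≤ g x x) (hnc : ∀ x, c * ‖x‖ ^ 2 ≤ n x x) (f : K →L[ℝ] ℝ) :
    ∃ y p : K, (∀ z, g y z - n p z + s p z = f z) ∧
      ∀ q, n y q + lam⁻¹ * l p q + s y q = 0 := by
  -- Chosen so that δ‖g‖² ≤ c², which is what absorbing the cross term δ g(y,p) requires.
  set δ : ℝ := c ^ 2 / (‖g‖ ^ 2 + 1) with hδ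
  have hδ0 : 0 < δ := by positivity
  have hδg : δ * ‖g‖ ^ 2 ≤ c ^ 2 := by
    rw [hδ, div_mul_eq_mul_div, div_le_iff₀ (by positivity)]
    nlinarith [sq_nonneg c]
  let π₁ : WithLp 2 (K × K) →L[ℝ] K := WithLp.fstL 2 ℝ K K
  let π₂ : WithLp 2 (K × K) →L[ℝ] K := WithLp.sndL 2 ℝ K K
  -- The first equation is tested with w₁ - δw₂, the second with w₂. On the diagonal, n(p,y) and
  -- n(y,p) cancel by symmetry and s(p,y) + s(y,p) = 0, leaving g(y,y) - δ g(y,p) + δ n(p,p) +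
  -- l(p,p)/λ.
  let ζ : WithLp 2 (K × K) →L[ℝ] K := π₁ - δ • π₂
  let B : WithLp 2 (K × K) →L[ℝ] WithLp 2 (K × K) →L[ℝ] ℝ :=
    g.bilinearComp π₁ ζ - n.bilinearComp π₂ ζ + s.bilinearComp π₂ ζ
      + n.bilinearComp π₁ π₂ + lam⁻¹ • l.bilinearComp π₂ π₂ + s.bilinearComp π₁ π₂
  have hB : ∀ x w, B x w = g x.fst (w.fst - δ • w.snd) - n x.snd (w.fst - δ • w.snd)
      + s x.snd (w.fst - δ • w.snd) + n x.fst w.snd + lam⁻¹ * l x.snd w.snd + s x.fst w.snd :=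
    fun x w => rfl
  have hcoer : IsCoercive B := by
    refine ⟨min (c / 2) (δ * c / 2), by positivity, fun x => ?_⟩
    have hx : ‖x‖ * ‖x‖ = ‖x.fst‖ ^ 2 + ‖x.snd‖ ^ 2 := by
      rw [← sq, WithLp.prod_norm_sq_eq_of_L2]
    rw [mul_assoc, hx, hB]
    have hss : s x.snd x.snd = 0 := by linarith [hs x.snd x.snd]
    have h1 := hgc x.fst
    have h2 := hnc x.snd
    have h3 := hl0 x.snd
    have h4 : g x.fst x.snd ≤ ‖g‖ * ‖x.fst‖ * ‖x.snd‖ :=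
      (le_abs_self _).trans (g.le_opNorm₂ _ _)
    have h5 : 0 ≤ lam⁻¹ * l x.snd x.snd := mul_nonneg (inv_nonneg.2 hlam.le) h3
    simp only [map_sub, map_smul, smul_eq_mul]
    rw [hn x.snd x.fst, hs x.snd x.fst, hss]
    have h6 : δ * (‖g‖ * ‖x.fst‖ * ‖x.snd‖) ≤ c / 2 * ‖x.fst‖ ^ 2 + δ * c / 2 * ‖x.snd‖ ^ 2 := by
      have h7 : 0 ≤ (c * ‖x.fst‖ - δ * ‖g‖ * ‖x.snd‖) ^ 2 := sq_nonneg _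
      have h8 : δ * (δ * ‖g‖ ^ 2) * ‖x.snd‖ ^ 2 ≤ δ * c ^ 2 * ‖x.snd‖ ^ 2 := by gcongr
      have h9 : 0 ≤ c * (c / 2 * ‖x.fst‖ ^ 2 + δ * c / 2 * ‖x.snd‖ ^ 2
          - δ * (‖g‖ * ‖x.fst‖ * ‖x.snd‖)) := by nlinarith
      linarith [nonneg_of_mul_nonneg_right h9 hc]
    have h10 : δ * g x.fst x.snd ≤ δ * (‖g‖ * ‖x.fst‖ * ‖x.snd‖) := by gcongr
    have h11 : δ * (c * ‖x.snd‖ ^ 2) ≤ δ * n x.snd x.snd := by gcongr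
    have h12 : min (c / 2) (δ * c / 2) * (‖x.fst‖ ^ 2 + ‖x.snd‖ ^ 2)
        ≤ c / 2 * ‖x.fst‖ ^ 2 + δ * c / 2 * ‖x.snd‖ ^ 2 := by
      rw [mul_add]
      gcongr
      · exact min_le_left _ _
      · exact min_le_right _ _
    linarith
  let F : WithLp 2 (K × K) →L[ℝ] ℝ := f.comp ζ
  -- Lax–Milgram.
  let x := hcoer.continuousLinearEquivOfBilin.symm
    ((InnerProductSpace.toDual ℝ (WithLp 2 (K × K))).symm F)
  have hx : ∀ w, B x w = f (w.fst - δ • w.snd) := by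
    intro w
    rw [← hcoer.continuousLinearEquivOfBilin_apply]
    simp only [x, ContinuousLinearEquiv.apply_symm_apply, InnerProductSpace.toDual_symm_apply]
    rfl
  refine ⟨x.fst, x.snd, fun z => ?_, fun q => ?_⟩
  · have := hx (WithLp.toLp 2 (z, 0))
    rw [hB] at this
    -- The change of test variables is invertible: (z, 0) isolates the first equation and (δq, q)
    -- the second.
    simpa using this
  · have := hx (WithLp.toLp 2 (δ • q, q))
    rw [hB] at this
    simpa using this

/-- Solvability of the system for a pair of conjugate modes. -/
lemma exists_saddle_pair (g n l s : K →L[ℝ] K →L[ℝ] ℝ) {c lam : ℝ} (hc : 0 < c) (hlam : 0 < lam)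
    (hn : ∀ x y, n x y = n y x) (hs : ∀ x y, s x y = s y x) (hl0 : ∀ x, 0 ≤ l x x)
    (hgc : ∀ x, c * ‖x‖ ^ 2 ≤ g x x) (hnc : ∀ x, c * ‖x‖ ^ 2 ≤ n x x) (κ : ℝ)
    (f f' : K →L[ℝ] ℝ) :
    ∃ y y' p p' : K, (∀ z, g y z - n p z - κ * s p' z = f z) ∧
      (∀ z, g y' z - n p' z + κ * s p z = f' z) ∧
      (∀ z, n y z + lam⁻¹ * l p z - κ * s y' z = 0) ∧
      (∀ z, n y' z + lam⁻¹ * l p' z + κ * s y z = 0) := by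
  let π₁ : WithLp 2 (K × K) →L[ℝ] K := WithLp.fstL 2 ℝ K K
  let π₂ : WithLp 2 (K × K) →L[ℝ] K := WithLp.sndL 2 ℝ K K
  let dbl : (K →L[ℝ] K →L[ℝ] ℝ) → (WithLp 2 (K × K) →L[ℝ] WithLp 2 (K × K) →L[ℝ] ℝ) := fun b =>
    b.bilinearComp π₁ π₁ + b.bilinearComp π₂ π₂
  have hd : ∀ b x w, dbl b x w = b x.fst w.fst + b x.snd w.snd := fun b x w => rfl
  -- On the doubled space the symmetric form s, entering with opposite signs in the two components,
  -- becomes skew.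
  let sk : WithLp 2 (K × K) →L[ℝ] WithLp 2 (K × K) →L[ℝ] ℝ :=
    κ • (s.bilinearComp π₁ π₂ - s.bilinearComp π₂ π₁)
  have hsk : ∀ x w, sk x w = κ * (s x.fst w.snd - s x.snd w.fst) := fun x w => rfl
  have hco : ∀ b : K →L[ℝ] K →L[ℝ] ℝ, (∀ x, c * ‖x‖ ^ 2 ≤ b x x) →
      ∀ x, c * ‖x‖ ^ 2 ≤ dbl b x x := fun b hb x => by
    rw [hd, WithLp.prod_norm_sq_eq_of_L2]
    linarith [hb x.fst, hb x.snd]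
  obtain ⟨y, p, h1, h2⟩ := exists_saddle (dbl g) (dbl n) (dbl l) sk hc hlam
    (fun x w => by rw [hd, hd, hn, hn x.snd])
    (fun x w => by rw [hsk, hsk, hs x.fst, hs x.snd]; ring)
    (fun x => by rw [hd]; exact add_nonneg (hl0 _) (hl0 _)) (hco g hgc) (hco n hnc)
    (f.comp π₁ + f'.comp π₂)
  have hF : ∀ z, (f.comp π₁ + f'.comp π₂) z = f z.fst + f' z.snd := fun z => rfl
  refine ⟨y.fst, y.snd, p.fst, p.snd, fun z => ?_, fun z => ?_, fun z => ?_, fun z => ?_⟩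
  · have := h1 (WithLp.toLp 2 (z, 0))
    rw [hd, hd, hsk, hF] at this
    simp at this
    linarith
  · have := h1 (WithLp.toLp 2 (0, z))
    rw [hd, hd, hsk, hF] at this
    simp at this
    linarith
  · have := h2 (WithLp.toLp 2 (z, 0))
    rw [hd, hd, hsk] at this
    simp at this
    linarith
  · have := h2 (WithLp.toLp 2 (0, z))
    rw [hd, hd, hsk] at this
    simp at this
    linarith

end Saddle

end ParabolicOC

namespace ParabolicOC

/-! ### The optimality system in terms of the modes -/

/-- A symmetric operator bounded below by `c > 0`. -/
structure IsSymmCoercive {E : Type*} [NormedAddCommGroup E] [InnerProductSpace ℝ E]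
    (A : E →L[ℝ] E) (c : ℝ) : Prop where
  pos : 0 < c
  symm : ∀ u v, inner ℝ (A u) v = inner ℝ u (A v)
  le : ∀ u, c * ‖u‖ ^ 2 ≤ inner ℝ (A u) u

lemma IsSymmCoercive.comm {E : Type*} [NormedAddCommGroup E] [InnerProductSpace ℝ E]
    {A : E →L[ℝ] E} {c : ℝ} (h : IsSymmCoercive A c) (u v : E) :
    inner ℝ (A u) v = inner ℝ (A v) u := by
  rw [h.symm, real_inner_comm]

section Pair

variable {X G : Type*} [NormedAddCommGroup X] [InnerProductSpace ℝ X] [NormedAddCommGroup G]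
  [InnerProductSpace ℝ G]

/-- `exists_saddle_pair` on the graph W of the gradient. Friedrichs bounds the squared graph norm by
CF² + 1 times the squared norm of the gradient part, which makes the two gradient forms coercive,
with constants 1 and `νlow` divided by CF² + 1. -/
lemma exists_modePair (W : Submodule ℝ (WithLp 2 (X × G))) [CompleteSpace W] {S : X →L[ℝ] X}
    {N : G →L[ℝ] G} {σlow νlow lam CF : ℝ} (hS : IsSymmCoercive S σlow)
    (hN : IsSymmCoercive N νlow) (hlam : 0 < lam)
    (hCF : ∀ x ∈ W, ‖x.fst‖ ≤ CF * ‖x.snd‖) (κ : ℝ) (f f' : G) :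
    ∃ y y' p p' : W,
      (∀ z ∈ W, inner ℝ y.1.snd z.snd - inner ℝ (N p.1.snd) z.snd
        - κ * inner ℝ (S p'.1.fst) z.fst = inner ℝ f z.snd) ∧
      (∀ z ∈ W, inner ℝ y'.1.snd z.snd - inner ℝ (N p'.1.snd) z.snd
        + κ * inner ℝ (S p.1.fst) z.fst = inner ℝ f' z.snd) ∧
      (∀ z ∈ W, inner ℝ (N y.1.snd) z.snd + lam⁻¹ * inner ℝ p.1.fst z.fst
        - κ * inner ℝ (S y'.1.fst) z.fst = 0) ∧
      (∀ z ∈ W, inner ℝ (N y'.1.snd) z.snd + lam⁻¹ * inner ℝ p'.1.fst z.fst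
        + κ * inner ℝ (S y.1.fst) z.fst = 0) := by
  let π₁ : W →L[ℝ] X := (WithLp.fstL 2 ℝ X G).comp W.subtypeL
  let π₂ : W →L[ℝ] G := (WithLp.sndL 2 ℝ X G).comp W.subtypeL
  let iX : X →L[ℝ] X →L[ℝ] ℝ := innerSL ℝ
  let iG : G →L[ℝ] G →L[ℝ] ℝ := innerSL ℝ
  have hsq : ∀ x : W, ‖x‖ ^ 2 ≤ (CF ^ 2 + 1) * ‖x.1.snd‖ ^ 2 := by
    intro x
    have h2 := pow_le_pow_left₀ (norm_nonneg _) (hCF x.1 x.2) 2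
    have h3 : ‖x‖ ^ 2 = ‖x.1.fst‖ ^ 2 + ‖x.1.snd‖ ^ 2 := by
      rw [Submodule.coe_norm, WithLp.prod_norm_sq_eq_of_L2]
    rw [h3]
    nlinarith
  have hpos : 0 < CF ^ 2 + 1 := by positivity
  have hdiv : ∀ x : W, ‖x‖ ^ 2 / (CF ^ 2 + 1) ≤ ‖x.1.snd‖ ^ 2 := fun x => by
    rw [div_le_iff₀ hpos, mul_comm]; exact hsq x
  obtain ⟨y, y', p, p', h1, h2, h3, h4⟩ := exists_saddle_pair (iG.bilinearComp π₂ π₂)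
    (iG.bilinearComp (N.comp π₂) π₂) (iX.bilinearComp π₁ π₁) (iX.bilinearComp (S.comp π₁) π₁)
    (c := min 1 νlow / (CF ^ 2 + 1)) (by have := hN.pos; positivity) hlam
    (fun x w => hN.comm x.1.snd w.1.snd) (fun x w => hS.comm x.1.fst w.1.fst)
    (fun x => real_inner_self_nonneg (x := x.1.fst))
    (fun x => by
      change _ ≤ inner ℝ x.1.snd x.1.snd
      rw [real_inner_self_eq_norm_sq, div_mul_eq_mul_div, mul_div_assoc]
      calc min 1 νlow * (‖x‖ ^ 2 / (CF ^ 2 + 1)) ≤ 1 * (‖x‖ ^ 2 / (CF ^ 2 + 1)) := by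
            gcongr; exact min_le_left _ _
        _ ≤ _ := by rw [one_mul]; exact hdiv x)
    (fun x => by
      refine le_trans ?_ (hN.le x.1.snd)
      rw [div_mul_eq_mul_div, mul_div_assoc]
      have := hN.pos
      exact mul_le_mul (min_le_right _ _) (hdiv x) (by positivity) this.le)
    κ ((iG f).comp π₂) ((iG f').comp π₂)
  exact ⟨y, y', p, p', fun z hz => h1 ⟨z, hz⟩, fun z hz => h2 ⟨z, hz⟩, fun z hz => h3 ⟨z, hz⟩,
    fun z hz => h4 ⟨z, hz⟩⟩

end Pair

section ModeSystem

variable {d : ℕ} {Ω : Set (Space d)} {T : ℝ} [IsFiniteMeasure (volume.restrict Ω)]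

/-- The optimality system for the families of modes of `y`, `∇y`, `p`, `∇p`, with the modes `g` of
the target. -/
structure ModeSystem (T : ℝ) (S : LX Ω →L[ℝ] LX Ω) (N : LG Ω →L[ℝ] LG Ω) (lam : ℝ)
    (y : ℤ → LX Ω) (Y : ℤ → LG Ω) (p : ℤ → LX Ω) (P : ℤ → LG Ω) (g : ℤ → LG Ω) : Prop where
  memY : ∀ j, InW0 (y j) (Y j)
  memP : ∀ j, InW0 (p j) (P j)
  eq₁ : ∀ j z Z, InW0 z Z → inner ℝ (Y j) Z - inner ℝ (N (P j)) Z
    - j * freq T * inner ℝ (S (p (-j))) z = inner ℝ (g j) Z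
  eq₂ : ∀ j z Z, InW0 z Z → inner ℝ (N (Y j)) Z + lam⁻¹ * inner ℝ (p j) z
    - j * freq T * inner ℝ (S (y (-j))) z = 0

variable {S : LX Ω →L[ℝ] LX Ω} {N : LG Ω →L[ℝ] LG Ω} {σlow νlow lam CF : ℝ}

instance : CompleteSpace (W0 Ω) := by unfold W0; infer_instance

/-- The mode system is solvable. -/
lemma exists_modeSystem (hT : 0 < T) (hS : IsSymmCoercive S σlow) (hN : IsSymmCoercive N νlow)
    (hlam : 0 < lam) (hCF : IsFriedrichsConst Ω CF) (g : ℤ → LG Ω) :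
    ∃ y Y p P, ModeSystem T S N lam y Y p P g := by
  choose a b p q h1 h2 h3 h4 using fun n : ℕ =>
    exists_modePair (W0 Ω) hS hN hlam
      (fun x hx => InW0.norm_le hT hCF (w := x.fst) (G := x.snd) hx) (n * freq T) (g n) (g (-n))
  -- The solution for the pair (n, -n) supplies both modes. At n = 0 the two halves decouple and the
  -- first one is kept.
  let y : ℤ → W0 Ω := fun j => if 0 ≤ j then a j.toNat else b (-j).toNat
  let r : ℤ → W0 Ω := fun j => if 0 ≤ j then p j.toNat else q (-j).toNat
  have ypos : ∀ n : ℕ, y n = a n := fun n => by simp [y]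
  have rpos : ∀ n : ℕ, r n = p n := fun n => by simp [r]
  have yneg : ∀ n : ℕ, 0 < n → y (-n) = b n := fun n hn => by
    simp only [y]; rw [if_neg (by omega)]; simp
  have rneg : ∀ n : ℕ, 0 < n → r (-n) = q n := fun n hn => by
    simp only [r]; rw [if_neg (by omega)]; simp
  refine ⟨fun j => (y j).1.fst, fun j => (y j).1.snd, fun j => (r j).1.fst, fun j => (r j).1.snd,
    fun j => (y j).2, fun j => (r j).2, fun j z Z hz => ?_, fun j z Z hz => ?_⟩
  · obtain ⟨n, rfl | rfl⟩ := j.eq_nat_or_neg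
    · have h := h1 n _ hz
      simp only [ypos, rpos, Int.cast_natCast]
      rcases Nat.eq_zero_or_pos n with rfl | hn
      · simpa using h
      · rw [rneg n hn]; exact h
    · rcases Nat.eq_zero_or_pos n with rfl | hn
      · have h := h1 0 _ hz
        have e1 := ypos 0
        have e2 := rpos 0
        simp only [Nat.cast_zero] at e1 e2
        simpa [e1, e2] using h
      · have h := h2 n _ hz
        simp only [neg_neg, rpos, yneg n hn, rneg n hn, Int.cast_neg, Int.cast_natCast, neg_mul,
          sub_neg_eq_add]
        exact h
  · obtain ⟨n, rfl | rfl⟩ := j.eq_nat_or_neg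
    · have h := h3 n _ hz
      simp only [ypos, rpos, Int.cast_natCast]
      rcases Nat.eq_zero_or_pos n with rfl | hn
      · simpa using h
      · rw [yneg n hn]; exact h
    · rcases Nat.eq_zero_or_pos n with rfl | hn
      · have h := h3 0 _ hz
        have e1 := ypos 0
        have e2 := rpos 0
        simp only [Nat.cast_zero] at e1 e2
        simpa [e1, e2] using h
      · have h := h4 n _ hz
        simp only [neg_neg, ypos, yneg n hn, rneg n hn, Int.cast_neg, Int.cast_natCast, neg_mul,
          sub_neg_eq_add]
        exact h

namespace ModeSystem

variable {y : ℤ → LX Ω} {Y : ℤ → LG Ω} {p : ℤ → LX Ω} {P : ℤ → LG Ω} {g : ℤ → LG Ω}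

/-- Energy bound for the gradients of the modes of the state. -/
lemma norm_sq_Y_le (h : ModeSystem T S N lam y Y p P g) (hS : IsSymmCoercive S σlow)
    (hN : IsSymmCoercive N νlow) (hlam : 0 < lam) (j : ℤ) :
    ‖Y j‖ ^ 2 + ‖Y (-j)‖ ^ 2 ≤ ‖g j‖ ^ 2 + ‖g (-j)‖ ^ 2 := by
  -- The first equation is tested with the state and the second with the adjoint state, at j and at
  -- -j. In the sum all N and S terms cancel, leaving ∑ (‖Y‖² + ‖p‖²/λ) = ∑ ⟨g, Y⟩ over the two
  -- indices.
  have a1 := h.eq₁ j _ _ (h.memY j)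
  have a2 := h.eq₁ (-j) _ _ (h.memY (-j))
  have b1 := h.eq₂ j _ _ (h.memP j)
  have b2 := h.eq₂ (-j) _ _ (h.memP (-j))
  rw [neg_neg] at a2 b2
  rw [hN.comm (P j), hS.comm (p (-j)), real_inner_self_eq_norm_sq] at a1
  rw [hN.comm (P (-j)), hS.comm (p j), real_inner_self_eq_norm_sq] at a2
  rw [real_inner_self_eq_norm_sq] at b1 b2
  push_cast at a2 b2
  have c1 : 0 ≤ lam⁻¹ * ‖p j‖ ^ 2 := by positivity
  have c2 : 0 ≤ lam⁻¹ * ‖p (-j)‖ ^ 2 := by positivity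
  have d1 := real_inner_le_norm (g j) (Y j)
  have d2 := real_inner_le_norm (g (-j)) (Y (-j))
  have e1 := sq_nonneg (‖g j‖ - ‖Y j‖)
  have e2 := sq_nonneg (‖g (-j)‖ - ‖Y (-j)‖)
  nlinarith

/-- Energy bound for the gradients of the modes of the adjoint state. -/
lemma norm_sq_P_le (h : ModeSystem T S N lam y Y p P g) (hS : IsSymmCoercive S σlow)
    (hN : IsSymmCoercive N νlow) (hlam : 0 < lam) (j : ℤ) :
    ‖P j‖ ^ 2 + ‖P (-j)‖ ^ 2 ≤ 4 / νlow ^ 2 * (‖g j‖ ^ 2 + ‖g (-j)‖ ^ 2) := by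
  -- Testing with p itself, the frequency terms at j and -j cancel, so ∑ ⟨N P, P⟩ = ∑ ⟨Y - g, P⟩.
  have a1 := h.eq₁ j _ _ (h.memP j)
  have a2 := h.eq₁ (-j) _ _ (h.memP (-j))
  have y0 := h.norm_sq_Y_le hS hN hlam j
  rw [neg_neg] at a2
  rw [hS.comm (p (-j))] at a1
  push_cast at a2
  have n1 := hN.le (P j)
  have n2 := hN.le (P (-j))
  have hν := hN.pos
  have d1 := real_inner_le_norm (Y j) (P j)
  have d2 := real_inner_le_norm (Y (-j)) (P (-j))
  have d3 := (abs_le.1 (abs_real_inner_le_norm (g j) (P j))).1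
  have d4 := (abs_le.1 (abs_real_inner_le_norm (g (-j)) (P (-j)))).1
  have key : νlow * (‖P j‖ ^ 2 + ‖P (-j)‖ ^ 2)
      ≤ (‖Y j‖ + ‖g j‖) * ‖P j‖ + (‖Y (-j)‖ + ‖g (-j)‖) * ‖P (-j)‖ := by nlinarith
  rw [div_mul_eq_mul_div, le_div_iff₀ (by positivity)]
  have e : ∀ s t : ℝ, s * t * νlow * 2 ≤ s ^ 2 + νlow ^ 2 * t ^ 2 := fun s t => by
    nlinarith [sq_nonneg (s - νlow * t)]
  have e1 := e (‖Y j‖ + ‖g j‖) ‖P j‖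
  have e2 := e (‖Y (-j)‖ + ‖g (-j)‖) ‖P (-j)‖
  have f1 := sq_nonneg (‖Y j‖ - ‖g j‖)
  have f2 := sq_nonneg (‖Y (-j)‖ - ‖g (-j)‖)
  have k2 := mul_le_mul_of_nonneg_left key hν.le
  nlinarith

/-- The weighted modes of the state are controlled by the modes of the adjoint state. -/
lemma freq_norm_y_le (h : ModeSystem T S N lam y Y p P g)
    (hS : IsSymmCoercive S σlow) (hN : IsSymmCoercive N νlow) (hlam : 0 < lam) (j : ℤ) :
    (j * freq T) ^ 2 * ‖y j‖ ^ 2 ≤ (lam⁻¹ / σlow) ^ 2 * (‖p j‖ ^ 2 + ‖p (-j)‖ ^ 2) := by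
  -- Crosswise test: mode j against y_{-j} and mode -j against y_j. The N terms cancel in the
  -- difference while the S terms add up to a coercive expression; as p enters only through its L²
  -- norm, a full power of the frequency is gained.
  have a1 := h.eq₂ j _ _ (h.memY (-j))
  have a2 := h.eq₂ (-j) _ _ (h.memY j)
  rw [neg_neg] at a2
  rw [hN.comm] at a1
  push_cast at a2
  have s1 := hS.le (y j)
  have s2 := hS.le (y (-j))
  have hσ := hS.pos
  set κ : ℝ := j * freq T with hκ
  set B : ℝ := ‖y j‖ ^ 2 + ‖y (-j)‖ ^ 2 with hB
  set A : ℝ := ‖p j‖ ^ 2 + ‖p (-j)‖ ^ 2 with hA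
  set E : ℝ := inner ℝ (S (y (-j))) (y (-j)) + inner ℝ (S (y j)) (y j) with hE
  have hEB : σlow * B ≤ E := by rw [hB, hE]; linarith
  have hEeq : κ * E = lam⁻¹ * (inner ℝ (p j) (y (-j)) - inner ℝ (p (-j)) (y j)) := by
    rw [hE]; linarith
  have hB0 : 0 ≤ B := by positivity
  have hA0 : 0 ≤ A := by positivity
  have hcs : (inner ℝ (p j) (y (-j)) - inner ℝ (p (-j)) (y j)) ^ 2 ≤ A * B := by
    have d1 := abs_real_inner_le_norm (p j) (y (-j))
    have d2 := abs_real_inner_le_norm (p (-j)) (y j)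
    have d3 : |inner ℝ (p j) (y (-j)) - inner ℝ (p (-j)) (y j)|
        ≤ ‖p j‖ * ‖y (-j)‖ + ‖p (-j)‖ * ‖y j‖ := (abs_sub _ _).trans (add_le_add d1 d2)
    rw [← sq_abs]
    refine (pow_le_pow_left₀ (abs_nonneg _) d3 2).trans ?_
    rw [hA, hB]
    nlinarith [sq_nonneg (‖p j‖ * ‖y j‖ - ‖p (-j)‖ * ‖y (-j)‖)]
  have h3 : κ ^ 2 * (σlow * B) ^ 2 ≤ lam⁻¹ ^ 2 * (A * B) := by
    calc κ ^ 2 * (σlow * B) ^ 2 ≤ κ ^ 2 * E ^ 2 := by gcongr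
      _ = lam⁻¹ ^ 2 * (inner ℝ (p j) (y (-j)) - inner ℝ (p (-j)) (y j)) ^ 2 := by
          rw [← mul_pow, hEeq, mul_pow]
      _ ≤ _ := by gcongr
  have h4 : κ ^ 2 * B ≤ (lam⁻¹ / σlow) ^ 2 * A := by
    rcases hB0.eq_or_lt with h0 | h0
    · rw [← h0]; simp only [mul_zero]; positivity
    · rw [div_pow, div_mul_eq_mul_div, le_div_iff₀ (by positivity)]
      refine le_of_mul_le_mul_right ?_ h0
      calc κ ^ 2 * B * σlow ^ 2 * B = κ ^ 2 * (σlow * B) ^ 2 := by ring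
        _ ≤ _ := h3
        _ = _ := by ring
  refine le_trans ?_ h4
  gcongr
  rw [hB]; linarith [sq_nonneg ‖y (-j)‖]

/-- The weighted modes of the adjoint state are controlled. -/
lemma freq_norm_p_le (h : ModeSystem T S N lam y Y p P g) (hT : 0 < T)
    (hS : IsSymmCoercive S σlow) (j : ℤ) :
    |(j : ℝ)| * freq T * (σlow * ‖p j‖ ^ 2)
      ≤ ‖Y (-j)‖ ^ 2 + ‖g (-j)‖ ^ 2 + (1 + ‖N‖) * (‖P j‖ ^ 2 + ‖P (-j)‖ ^ 2) := by
  -- Here the right-hand side pairs with the gradient P, so only one factor of the frequency against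
  -- ‖p_j‖² is gained: enough for half a time derivative.
  have a1 := h.eq₁ (-j) _ _ (h.memP j)
  rw [neg_neg] at a1
  push_cast at a1
  have hω := freq_pos hT
  have s1 := hS.le (p j)
  have d1 := abs_real_inner_le_norm (Y (-j)) (P j)
  have d2 := abs_real_inner_le_norm (g (-j)) (P j)
  have d3 : |inner ℝ (N (P (-j))) (P j)| ≤ ‖N‖ * ‖P (-j)‖ * ‖P j‖ :=
    (abs_real_inner_le_norm _ _).trans (by gcongr; exact N.le_opNorm _)
  have e : |(j : ℝ)| * freq T * inner ℝ (S (p j)) (p j)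
      ≤ ‖Y (-j)‖ * ‖P j‖ + ‖g (-j)‖ * ‖P j‖ + ‖N‖ * ‖P (-j)‖ * ‖P j‖ := by
    have hI : 0 ≤ inner ℝ (S (p j)) (p j) := le_trans (by have := hS.pos; positivity) s1
    have : |(j : ℝ)| * freq T * inner ℝ (S (p j)) (p j)
        = |j * freq T * inner ℝ (S (p j)) (p j)| := by
      rw [abs_mul, abs_mul, abs_of_pos hω, abs_of_nonneg hI]
    rw [this, show j * freq T * inner ℝ (S (p j)) (p j) = inner ℝ (g (-j)) (P j)
      - inner ℝ (Y (-j)) (P j) + inner ℝ (N (P (-j))) (P j) by linarith]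
    refine (abs_add_le _ _).trans ?_
    have := abs_sub (inner ℝ (g (-j)) (P j)) (inner ℝ (Y (-j)) (P j))
    linarith
  have e2 : |(j : ℝ)| * freq T * (σlow * ‖p j‖ ^ 2)
      ≤ |(j : ℝ)| * freq T * inner ℝ (S (p j)) (p j) := by gcongr
  have f1 := sq_nonneg (‖Y (-j)‖ - ‖P j‖)
  have f2 := sq_nonneg (‖g (-j)‖ - ‖P j‖)
  have f3 : ‖N‖ * ‖P (-j)‖ * ‖P j‖ ≤ ‖N‖ * (‖P j‖ ^ 2 + ‖P (-j)‖ ^ 2) := by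
    rw [mul_assoc]
    gcongr
    nlinarith [sq_nonneg (‖P (-j)‖ - ‖P j‖), sq_nonneg ‖P (-j)‖, sq_nonneg ‖P j‖]
  nlinarith [sq_nonneg ‖P (-j)‖]

end ModeSystem

end ModeSystem

end ParabolicOC

namespace ParabolicOC

/-! ### The half derivative form and the optimality system on `L²(Q)` -/

section HalfForm

variable {d : ℕ} {Ω : Set (Space d)} {T : ℝ} [IsFiniteMeasure (volume.restrict Ω)]

/-- The form `⟨σ ∂_t^{1/2} u, ∂_t^{1/2} v^⊥⟩` in terms of the Hartley coefficients. -/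
def half (hT : 0 < T) (S : LX Ω →L[ℝ] LX Ω) (u v : HX Ω T) : ℝ :=
  ∑' j : ℤ, j * freq T * inner ℝ (S (cX hT j u)) (cX hT (-j) v)

/-- `u` has a half time derivative in `L²(Q)`. -/
def IsHalf (hT : 0 < T) (u : HX Ω T) : Prop := Summable fun j : ℤ => |(j : ℝ)| * ‖cX hT j u‖ ^ 2

/-- `u ∈ H^{1,1/2}_{0,per}(Q)` with weak spatial gradient `G`. -/
structure InV (hT : 0 < T) (u : HX Ω T) (G : HG Ω T) : Prop where
  inWQ : InWQ u G
  isHalf : IsHalf hT u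

variable {hT : 0 < T} {S : LX Ω →L[ℝ] LX Ω} {σlow νlow lam CF : ℝ}

lemma _root_.HasSum.of_forall_eq {ι : Type*} {f f' : ι → ℝ} {a : ℝ} (h : HasSum f a)
    (e : ∀ i, f' i = f i) : HasSum f' a := by
  rwa [funext e]

lemma summable_neg_int {f : ℤ → ℝ} (h : Summable f) : Summable fun j => f (-j) :=
  (Equiv.neg ℤ).summable_iff.2 h

lemma IsHalf.neg_index {u : HX Ω T} (h : IsHalf hT u) :
    Summable fun j : ℤ => |(j : ℝ)| * ‖cX hT (-j) u‖ ^ 2 := by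
  have := summable_neg_int h
  simpa using this

lemma summable_half {u v : HX Ω T} (hu : IsHalf hT u) (hv : IsHalf hT v) :
    Summable fun j : ℤ => j * freq T * inner ℝ (S (cX hT j u)) (cX hT (-j) v) := by
  have hω := freq_pos hT
  refine Summable.of_norm_bounded ((hu.add hv.neg_index).mul_left (freq T * ‖S‖)) fun j => ?_
  rw [Real.norm_eq_abs, abs_mul, abs_mul, abs_of_pos hω]
  have h1 : |inner ℝ (S (cX hT j u)) (cX hT (-j) v)| ≤ ‖S‖ * ‖cX hT j u‖ * ‖cX hT (-j) v‖ :=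
    (abs_real_inner_le_norm _ _).trans (by gcongr; exact S.le_opNorm _)
  have h2 : ‖cX hT j u‖ * ‖cX hT (-j) v‖ ≤ ‖cX hT j u‖ ^ 2 + ‖cX hT (-j) v‖ ^ 2 := by
    nlinarith [sq_nonneg (‖cX hT j u‖ - ‖cX hT (-j) v‖), sq_nonneg ‖cX hT j u‖,
      sq_nonneg ‖cX hT (-j) v‖]
  calc |(j : ℝ)| * freq T * |inner ℝ (S (cX hT j u)) (cX hT (-j) v)|
      ≤ |(j : ℝ)| * freq T * (‖S‖ * (‖cX hT j u‖ ^ 2 + ‖cX hT (-j) v‖ ^ 2)) := by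
        gcongr
        refine h1.trans ?_
        rw [mul_assoc]
        gcongr
    _ = _ := by ring

lemma IsHalf.sub {u v : HX Ω T} (hu : IsHalf hT u) (hv : IsHalf hT v) : IsHalf hT (u - v) := by
  refine Summable.of_nonneg_of_le (fun j => by positivity) (fun j => ?_)
    ((hu.add hv).mul_left 2)
  rw [map_sub]
  have h1 := norm_sub_le (cX hT j u) (cX hT j v)
  have h2 : ‖cX hT j u - cX hT j v‖ ^ 2 ≤ 2 * (‖cX hT j u‖ ^ 2 + ‖cX hT j v‖ ^ 2) :=
    (pow_le_pow_left₀ (norm_nonneg _) h1 2).trans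
      (by nlinarith [sq_nonneg (‖cX hT j u‖ - ‖cX hT j v‖)])
  calc _ ≤ |(j : ℝ)| * (2 * (‖cX hT j u‖ ^ 2 + ‖cX hT j v‖ ^ 2)) := by gcongr
    _ = _ := by ring

lemma InV.sub {u v : HX Ω T} {G K : HG Ω T} (h : InV hT u G) (h' : InV hT v K) :
    InV hT (u - v) (G - K) := ⟨h.inWQ.sub h'.inWQ, h.isHalf.sub h'.isHalf⟩

/-- Reindexing by j ↦ -j flips the sign of the weight and exchanges the two slots; symmetry of S
does the rest. -/
lemma half_skew (hS : IsSymmCoercive S σlow) (u v : HX Ω T) : half hT S u v = -half hT S v u := by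
  unfold half
  rw [← tsum_neg, ← (Equiv.neg ℤ).tsum_eq]
  refine tsum_congr fun j => ?_
  simp only [Equiv.neg_apply, neg_neg, Int.cast_neg]
  rw [hS.symm, real_inner_comm]; ring

lemma half_self (hS : IsSymmCoercive S σlow) (u : HX Ω T) : half hT S u u = 0 := by
  linarith [half_skew (hT := hT) hS u u]

lemma half_sub_left {u v w : HX Ω T} (hu : IsHalf hT u) (hv : IsHalf hT v) (hw : IsHalf hT w) :
    half hT S (u - v) w = half hT S u w - half hT S v w := by
  unfold half
  rw [← (summable_half hu hw).tsum_sub (summable_half hv hw)]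
  refine tsum_congr fun j => ?_
  rw [map_sub, map_sub, inner_sub_left]; ring

lemma half_sub_right {u v w : HX Ω T} (hu : IsHalf hT u) (hv : IsHalf hT v) (hw : IsHalf hT w) :
    half hT S w (u - v) = half hT S w u - half hT S w v := by
  unfold half
  rw [← (summable_half hw hu).tsum_sub (summable_half hw hv)]
  refine tsum_congr fun j => ?_
  rw [map_sub, inner_sub_right]; ring

lemma coeff_mode_apply {F : Type*} [NormedAddCommGroup F] [InnerProductSpace ℝ F]
    [FiniteDimensional ℝ F] (hT : 0 < T) (i j : ℤ) (g : Lp F 2 (volume.restrict Ω)) :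
    haveI : CompleteSpace F := FiniteDimensional.complete ℝ F
    coeff (mode F (volume.restrict Ω) hT) i (mode F (volume.restrict Ω) hT j g)
      = if i = j then g else 0 := by
  have : CompleteSpace F := FiniteDimensional.complete ℝ F
  split_ifs with h
  · rw [h, coeff_emb_self]
  · exact (completeFamily_mode hT).coeff_emb_of_ne h g

lemma isHalf_mode (j : ℤ) (w : LX Ω) : IsHalf hT (mX hT j w) := by
  refine summable_of_ne_finset_zero (s := {j}) fun i hi => ?_
  rw [coeff_mode_apply, if_neg (by simpa using hi)]; simp

lemma inV_mode (j : ℤ) {w : LX Ω} {G : LG Ω} (h : InW0 w G) : InV hT (mX hT j w) (mG hT j G) :=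
  ⟨h.mode hT j, isHalf_mode j w⟩

/-- Only the term with index -j survives, so a single mode as test function isolates one equation of
the mode system. -/
lemma half_mode (u : HX Ω T) (j : ℤ) (w : LX Ω) :
    half hT S u (mX hT j w) = -(j * freq T * inner ℝ (S (cX hT (-j) u)) w) := by
  unfold half
  rw [tsum_eq_single (-j)]
  · rw [neg_neg, coeff_mode_apply, if_pos rfl]; push_cast; ring
  · intro i hi
    rw [coeff_mode_apply, if_neg (by omega)]; simp

/-- The series reindexed so that v carries the index j, aligning it with the Parseval series of the
other terms. -/
lemma hasSum_half {u v : HX Ω T} (hu : IsHalf hT u) (hv : IsHalf hT v) :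
    HasSum (fun j : ℤ => -(j * freq T * inner ℝ (S (cX hT (-j) u)) (cX hT j v)))
      (half hT S u v) := by
  have h := (Equiv.neg ℤ).hasSum_iff.2 (summable_half (S := S) hu hv).hasSum
  have e : (fun j : ℤ => -(j * freq T * inner ℝ (S (cX hT (-j) u)) (cX hT j v)))
      = (fun j : ℤ => j * freq T * inner ℝ (S (cX hT j u)) (cX hT (-j) v)) ∘ Equiv.neg ℤ := by
    funext j
    simp only [Function.comp_apply, Equiv.neg_apply, neg_neg, Int.cast_neg]
    ring
  rwa [e]

/-- The weak optimality system on `L²(Q)`. -/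
def OptSys (hT : 0 < T) (S : LX Ω →L[ℝ] LX Ω) (NQ : HG Ω T →L[ℝ] HG Ω T) (lam : ℝ)
    (g : HG Ω T) (y : HX Ω T) (Y : HG Ω T) (p : HX Ω T) (P : HG Ω T) : Prop :=
  (∀ v V, InV hT v V → inner ℝ Y V - inner ℝ (NQ P) V + half hT S p v = inner ℝ g V) ∧
  (∀ v V, InV hT v V → inner ℝ (NQ Y) V + lam⁻¹ * inner ℝ p v + half hT S y v = 0)

variable {N : LG Ω →L[ℝ] LG Ω} {NQ : HG Ω T →L[ℝ] HG Ω T}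

/-- The products e_j(t) z(x) with z ∈ H¹₀(Ω) are admissible test functions. -/
lemma OptSys.modeSystem (hNQ : ∀ j G, cG hT j (NQ G) = N (cG hT j G)) {g : HG Ω T} {y : HX Ω T}
    {Y : HG Ω T} {p : HX Ω T} {P : HG Ω T} (hy : InWQ y Y) (hp : InWQ p P)
    (h : OptSys hT S NQ lam g y Y p P) :
    ModeSystem T S N lam (fun j => cX hT j y) (fun j => cG hT j Y) (fun j => cX hT j p)
      (fun j => cG hT j P) (fun j => cG hT j g) where
  memY j := hy.coeff hT j
  memP j := hp.coeff hT j
  eq₁ j z Z hz := by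
    have := h.1 _ _ (inV_mode j hz)
    rw [half_mode, ← inner_coeff, ← inner_coeff, ← inner_coeff, hNQ] at this
    linarith
  eq₂ j z Z hz := by
    have := h.2 _ _ (inV_mode j hz)
    rw [half_mode, ← inner_coeff, ← inner_coeff, hNQ] at this
    linarith

/-- The mode equations, tested with the coefficients of v, are summed by Parseval; the half
derivatives are needed for convergence of the skew series. -/
lemma ModeSystem.optSys (hNQ : ∀ j G, cG hT j (NQ G) = N (cG hT j G)) {g : HG Ω T} {y : HX Ω T}
    {Y : HG Ω T} {p : HX Ω T} {P : HG Ω T} (hy : IsHalf hT y) (hp : IsHalf hT p)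
    (h : ModeSystem T S N lam (fun j => cX hT j y) (fun j => cG hT j Y) (fun j => cX hT j p)
      (fun j => cG hT j P) (fun j => cG hT j g)) :
    OptSys hT S NQ lam g y Y p P := by
  constructor
  · intro v V hv
    have h1 := (completeG Ω hT).hasSum_inner Y V
    have h2 := (completeG Ω hT).hasSum_inner (NQ P) V
    have h3 := hasSum_half (S := S) hp hv.isHalf
    have h4 := (completeG Ω hT).hasSum_inner g V
    refine ((h1.sub h2).add h3).unique (h4.of_forall_eq fun j => ?_)
    rw [hNQ, ← h.eq₁ j _ _ (hv.inWQ.coeff hT j)]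
    ring
  · intro v V hv
    have h1 := (completeG Ω hT).hasSum_inner (NQ Y) V
    have h2 := ((completeX Ω hT).hasSum_inner p v).mul_left lam⁻¹
    have h3 := hasSum_half (S := S) hy hv.isHalf
    refine ((h1.add h2).add h3).unique (hasSum_zero.of_forall_eq fun j => ?_)
    rw [hNQ, ← h.eq₂ j _ _ (hv.inWQ.coeff hT j)]
    ring

/-- The optimality system has a solution. -/
lemma exists_optSys (hNQ : ∀ j G, cG hT j (NQ G) = N (cG hT j G)) (hS : IsSymmCoercive S σlow)
    (hN : IsSymmCoercive N νlow) (hlam : 0 < lam) (hCF : IsFriedrichsConst Ω CF) (g : HG Ω T) :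
    ∃ y Y p P, InV hT y Y ∧ InV hT p P ∧ OptSys hT S NQ lam g y Y p P := by
  obtain ⟨y, Y, p, P, h⟩ := exists_modeSystem hT hS hN hlam hCF fun j => cG hT j g
  have hg : Summable fun j => ‖cG hT j g‖ ^ 2 := (completeG Ω hT).summable_coeff g
  have hgg := hg.add (summable_neg_int hg)
  -- The energy bounds have constants independent of j, so Bessel for g dominates the series.
  have hY : Summable fun j => ‖Y j‖ ^ 2 := by
    refine Summable.of_nonneg_of_le (fun j => by positivity) (fun j => ?_) hgg
    linarith [h.norm_sq_Y_le hS hN hlam j, sq_nonneg ‖Y (-j)‖]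
  have hP : Summable fun j => ‖P j‖ ^ 2 := by
    refine Summable.of_nonneg_of_le (fun j => by positivity) (fun j => ?_)
      (hgg.mul_left (4 / νlow ^ 2))
    linarith [h.norm_sq_P_le hS hN hlam j, sq_nonneg ‖P (-j)‖]
  have hF : ∀ {w : ℤ → LX Ω} {G : ℤ → LG Ω}, (∀ j, InW0 (w j) (G j)) →
      (Summable fun j => ‖G j‖ ^ 2) → Summable fun j => ‖w j‖ ^ 2 := fun hw hG => by
    refine Summable.of_nonneg_of_le (fun j => by positivity) (fun j => ?_) (hG.mul_left (CF ^ 2))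
    rw [← mul_pow]
    exact pow_le_pow_left₀ (norm_nonneg _) ((hw j).norm_le hT hCF) 2
  have hy := hF h.memY hY
  have hp := hF h.memP hP
  have cy := (completeX Ω hT).coeff_tsum hy
  have cY := (completeG Ω hT).coeff_tsum hY
  have cp := (completeX Ω hT).coeff_tsum hp
  have cP := (completeG Ω hT).coeff_tsum hP
  have hω := freq_pos hT
  have hσ := hS.pos
  have half_y : IsHalf hT (∑' j, mX hT j (y j)) := by
    unfold IsHalf
    simp only [cy]
    have hb := (((hp.add (summable_neg_int hp)).mul_left ((lam⁻¹ / σlow) ^ 2))).mul_left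
      ((freq T ^ 2)⁻¹)
    refine Summable.of_nonneg_of_le (fun j => by positivity) (fun j => ?_) hb
    rw [← div_eq_inv_mul, le_div_iff₀ (by positivity)]
    refine le_trans ?_ (h.freq_norm_y_le hS hN hlam j)
    -- On integers |j| ≤ j², so the quadratic weight controls the half derivative.
    have h1 : |(j : ℝ)| ≤ (j : ℝ) ^ 2 := by
      have : |j| ≤ j ^ 2 := by
        rw [← sq_abs]; nlinarith [abs_nonneg j, Int.le_self_sq |j|]
      exact_mod_cast this
    calc _ ≤ (j : ℝ) ^ 2 * ‖y j‖ ^ 2 * freq T ^ 2 := by gcongr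
      _ = _ := by ring
  have half_p : IsHalf hT (∑' j, mX hT j (p j)) := by
    unfold IsHalf
    simp only [cp]
    have hb := (((summable_neg_int hY).add (summable_neg_int hg)).add
      ((hP.add (summable_neg_int hP)).mul_left (1 + ‖N‖))).mul_left ((freq T * σlow)⁻¹)
    refine Summable.of_nonneg_of_le (fun j => by positivity) (fun j => ?_) hb
    rw [← div_eq_inv_mul, le_div_iff₀ (by positivity)]
    refine le_trans (le_of_eq ?_) (h.freq_norm_p_le hT hS j)
    ring
  refine ⟨_, ∑' j, mG hT j (Y j), _, ∑' j, mG hT j (P j), ⟨inWQ_of_coeff hT fun j => ?_, half_y⟩,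
    ⟨inWQ_of_coeff hT fun j => ?_, half_p⟩, ModeSystem.optSys hNQ half_y half_p ?_⟩
  · rw [cy, cY]; exact h.memY j
  · rw [cp, cP]; exact h.memP j
  · simp only [cy, cY, cp, cP]; exact h

end HalfForm

end ParabolicOC

namespace ParabolicOC

/-! ### Time derivatives in terms of modes -/

section TimeDerivative

variable {d : ℕ} {Ω : Set (Space d)} {T : ℝ} [IsFiniteMeasure (volume.restrict Ω)]

/-- `ut` is the time derivative of the time-periodic function `u`. -/
def IsDt (hT : 0 < T) (u ut : HX Ω T) : Prop :=
  ∀ j : ℤ, cX hT j ut = -(j * freq T) • cX hT (-j) u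

variable {hT : 0 < T} {S : LX Ω →L[ℝ] LX Ω} {N : LG Ω →L[ℝ] LG Ω} {SQ : HX Ω T →L[ℝ] HX Ω T}
  {NQ : HG Ω T →L[ℝ] HG Ω T} {σlow νlow lam CF : ℝ}

lemma IsDt.norm_eq {u ut : HX Ω T} (h : IsDt hT u ut) (j : ℤ) :
    ‖cX hT (-j) ut‖ = |(j : ℝ)| * freq T * ‖cX hT j u‖ := by
  rw [h, neg_neg, norm_smul, Real.norm_eq_abs]
  push_cast
  rw [neg_mul, neg_neg, abs_mul, abs_of_pos (freq_pos hT)]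

/-- Interpolation: |j|ω‖u_j‖² is the product of ‖u_j‖ and the norm of the coefficient of ∂_t u at
-j, both square summable. -/
lemma IsDt.isHalf {u ut : HX Ω T} (h : IsDt hT u ut) : IsHalf hT u := by
  have hω := freq_pos hT
  have h1 := (completeX Ω hT).summable_coeff u
  have h2 := summable_neg_int ((completeX Ω hT).summable_coeff ut)
  refine Summable.of_nonneg_of_le (fun j => by positivity) (fun j => ?_)
    ((h1.add h2).mul_left (freq T)⁻¹)
  rw [← div_eq_inv_mul, le_div_iff₀ hω]
  have := h.norm_eq j
  calc |(j : ℝ)| * ‖cX hT j u‖ ^ 2 * freq T = ‖cX hT j u‖ * ‖cX hT (-j) ut‖ := by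
        rw [this]; ring
    _ ≤ _ := by nlinarith [sq_nonneg (‖cX hT j u‖ - ‖cX hT (-j) ut‖), sq_nonneg ‖cX hT j u‖,
        sq_nonneg ‖cX hT (-j) ut‖]

/-- After j ↦ -j the series is Parseval for ⟨σ∂_t u, v⟩; no half derivative of v is needed. -/
lemma IsDt.half_eq (hSQ : ∀ j u, cX hT j (SQ u) = S (cX hT j u)) {u ut : HX Ω T}
    (h : IsDt hT u ut) (v : HX Ω T) : half hT S u v = inner ℝ (SQ ut) v := by
  have h1 := (Equiv.neg ℤ).hasSum_iff.2 ((completeX Ω hT).hasSum_inner (SQ ut) v)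
  rw [half, ← h1.tsum_eq]
  refine tsum_congr fun j => ?_
  simp only [Function.comp_apply, Equiv.neg_apply]
  rw [hSQ, h, neg_neg, map_smul, real_inner_smul_left]
  push_cast; ring

lemma exists_isDt {u : HX Ω T} (h : Summable fun j : ℤ => (j * freq T) ^ 2 * ‖cX hT j u‖ ^ 2) :
    ∃ ut, IsDt hT u ut := by
  have hs : Summable fun j : ℤ => ‖-(j * freq T) • cX hT (-j) u‖ ^ 2 := by
    have := summable_neg_int h
    refine this.congr fun j => ?_
    rw [norm_smul, mul_pow ‖-((j : ℝ) * freq T)‖, Real.norm_eq_abs, sq_abs]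
    push_cast; ring
  exact ⟨_, (completeX Ω hT).coeff_tsum hs⟩

/-- The state of the optimality system has a time derivative in `L²(Q)`. -/
lemma OptSys.exists_isDt (hNQ : ∀ j G, cG hT j (NQ G) = N (cG hT j G))
    (hS : IsSymmCoercive S σlow) (hN : IsSymmCoercive N νlow) (hlam : 0 < lam) {g : HG Ω T}
    {y : HX Ω T} {Y : HG Ω T} {p : HX Ω T} {P : HG Ω T} (hy : InWQ y Y) (hp : InWQ p P)
    (h : OptSys hT S NQ lam g y Y p P) : ∃ yt, IsDt hT y yt := by
  have hm := h.modeSystem hNQ hy hp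
  have h1 := (completeX Ω hT).summable_coeff p
  refine ParabolicOC.exists_isDt (Summable.of_nonneg_of_le (fun j => by positivity) (fun j =>
    hm.freq_norm_y_le hS hN hlam j)
    ((h1.add (summable_neg_int h1)).mul_left ((lam⁻¹ / σlow) ^ 2)))

end TimeDerivative

/-! ### The minorant as a lower bound -/

section LowerBound

/-- Here x = ‖Y - H‖ and e = ‖p - ζ‖, while A collects R₁, R₂ and B collects R₃, R₄. Inserting the
bound on x into B x leaves a product of e and B, absorbed by e²/(2l) at the price C²B²/(2ν²l). The
constants of the minorant are weaker because μ ≤ ν. -/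
lemma minorant_arith {a b x e A B ν μ C l : ℝ} (hν : 0 < ν) (hμ : 0 < μ) (hμν : μ ≤ ν)
    (hμν2 : 2 * μ ^ 2 ≤ ν ^ 2) (hl : 0 < l) (hA : 0 ≤ A) (hB : 0 ≤ B)
    (hx : ν * x ≤ A + l⁻¹ * C * e) (hab : b + 1 / (2 * l) * e ^ 2 - B * x ≤ a) :
    b - C ^ 2 / (μ ^ 2 * l) * B ^ 2 - 1 / μ * A * B ≤ a := by
  have h1 : x ≤ 1 / ν * (A + l⁻¹ * C * e) := by
    rw [one_div, ← div_eq_inv_mul, le_div_iff₀ hν, mul_comm]; exact hx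
  have h2 : B * x ≤ B * (1 / ν * (A + l⁻¹ * C * e)) := by gcongr
  have h3 : 1 / ν * A * B ≤ 1 / μ * A * B := by gcongr
  have h4 : C ^ 2 / (2 * ν ^ 2 * l) * B ^ 2 ≤ C ^ 2 / (μ ^ 2 * l) * B ^ 2 := by
    gcongr
    nlinarith [sq_nonneg ν, sq_nonneg μ]
  -- Young's inequality as a completed square, balanced at e = C B / ν.
  have h5 : 1 / ν * (l⁻¹ * C * e) * B ≤ 1 / (2 * l) * e ^ 2 + C ^ 2 / (2 * ν ^ 2 * l) * B ^ 2 := by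
    have : 1 / (2 * l) * e ^ 2 + C ^ 2 / (2 * ν ^ 2 * l) * B ^ 2 - 1 / ν * (l⁻¹ * C * e) * B
        = 1 / (2 * l) * (e - C * B / ν) ^ 2 := by
      field_simp; ring
    have h6 : 0 ≤ 1 / (2 * l) * (e - C * B / ν) ^ 2 := by positivity
    linarith
  nlinarith

variable {V W : Type*} [NormedAddCommGroup V] [InnerProductSpace ℝ V] [NormedAddCommGroup W]
  [InnerProductSpace ℝ W]

/-- The functional `½‖∇y - g‖² + (1/2λ)‖p‖²`. -/
def costL (lam : ℝ) (g Y : W) (p : V) : ℝ :=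
  1 / 2 * ‖Y - g‖ ^ 2 + 1 / (2 * lam) * ‖p‖ ^ 2

/-- The error estimate behind the minorant. -/
lemma minorant_le_of_identities {N : W →L[ℝ] W} {ν μ lam C : ℝ} (hN : IsSymmCoercive N ν)
    (hlam : 0 < lam) (hC : 0 ≤ C) (hμ : 0 < μ) (hμν : μ ≤ ν) (hμν2 : 2 * μ ^ 2 ≤ ν ^ 2)
    {g Y H Z τ ρ : W} {y p η ζ a b τd ρd : V}
    (hF : ‖y - η‖ ≤ C * ‖Y - H‖)
    (e1 : inner ℝ (N Y) (Y - H) + lam⁻¹ * inner ℝ p (y - η) + inner ℝ a (y - η) = 0)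
    (e2 : inner ℝ (N Y) Z + lam⁻¹ * inner ℝ p ζ + (inner ℝ a ζ - inner ℝ b (y - η)) = 0)
    (t1 : inner ℝ τ (Y - H) = -inner ℝ τd (y - η))
    (t2 : inner ℝ ρ (Y - H) = -inner ℝ ρd (y - η)) :
    costL lam g H ζ - (inner ℝ (N H) Z + inner ℝ a ζ + lam⁻¹ * ‖ζ‖ ^ 2)
      - C ^ 2 / (μ ^ 2 * lam) * (C * ‖ρd + b‖ + ‖ρ - N Z + (H - g)‖) ^ 2
      - 1 / μ * (C * ‖a - τd + lam⁻¹ • ζ‖ + ‖τ - N H‖)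
        * (C * ‖ρd + b‖ + ‖ρ - N Z + (H - g)‖)
    ≤ costL lam g Y p := by
  have n1 := hN.le (Y - H)
  -- Energy of the state error: subtracting the divergence identity for τ from the state equation
  -- expresses it by R₁, R₂ and p - ζ.
  have i1 : inner ℝ (N (Y - H)) (Y - H)
      = inner ℝ (τ - N H) (Y - H) - inner ℝ (a - τd + lam⁻¹ • ζ) (y - η)
        - lam⁻¹ * inner ℝ (p - ζ) (y - η) := by
    rw [map_sub, inner_sub_left (N Y), inner_sub_left τ, inner_add_left, inner_sub_left a,
      real_inner_smul_left, inner_sub_left p]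
    linarith
  have b1 := real_inner_le_norm (τ - N H) (Y - H)
  have b2 := (abs_le.1 (abs_real_inner_le_norm (a - τd + lam⁻¹ • ζ) (y - η))).1
  have b3 := (abs_le.1 (abs_real_inner_le_norm (p - ζ) (y - η))).1
  have hx : ν * ‖Y - H‖ ≤ (C * ‖a - τd + lam⁻¹ • ζ‖ + ‖τ - N H‖)
      + lam⁻¹ * C * ‖p - ζ‖ := by
    rcases (norm_nonneg (Y - H)).eq_or_lt with h0 | h0
    · rw [← h0, mul_zero]; positivity
    · refine le_of_mul_le_mul_right ?_ h0
      have c2 : ‖a - τd + lam⁻¹ • ζ‖ * ‖y - η‖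
          ≤ ‖a - τd + lam⁻¹ • ζ‖ * (C * ‖Y - H‖) := by gcongr
      have c3 : lam⁻¹ * (‖p - ζ‖ * ‖y - η‖) ≤ lam⁻¹ * (‖p - ζ‖ * (C * ‖Y - H‖)) := by gcongr
      have c4 : lam⁻¹ * -(‖p - ζ‖ * ‖y - η‖) ≤ lam⁻¹ * inner ℝ (p - ζ) (y - η) := by gcongr
      linarith
  -- Both squares of the cost are expanded around H and ζ; ½‖Y - H‖² is discarded at the end, ‖p -
  -- ζ‖²/(2λ) is kept for absorption.
  have x1 : ‖Y - g‖ ^ 2 = ‖H - g‖ ^ 2 + 2 * inner ℝ (H - g) (Y - H) + ‖Y - H‖ ^ 2 := by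
    rw [← norm_add_sq_real]; congr 2; abel
  have x2 : ‖p‖ ^ 2 = ‖ζ‖ ^ 2 + 2 * inner ℝ ζ (p - ζ) + ‖p - ζ‖ ^ 2 := by
    rw [← norm_add_sq_real]; congr 2; abel
  have x3 : inner ℝ ζ (p - ζ) = inner ℝ p ζ - ‖ζ‖ ^ 2 := by
    rw [inner_sub_right, real_inner_self_eq_norm_sq, real_inner_comm]
  -- With the state equation tested by ζ, the linear part of the expansion is R₄ paired with the
  -- gradient error plus R₃ paired with the error.
  have i2 : inner ℝ (ρ - N Z + (H - g)) (Y - H) + inner ℝ (ρd + b) (y - η)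
      = inner ℝ (H - g) (Y - H) - (inner ℝ (N Y) Z - inner ℝ (N H) Z)
        + inner ℝ b (y - η) := by
    rw [inner_add_left, inner_sub_left ρ, inner_add_left ρd, t2, hN.symm Z, map_sub,
      inner_sub_right Z, real_inner_comm (N Y) Z, real_inner_comm (N H) Z]
    ring
  have b4 := (abs_le.1 (abs_real_inner_le_norm (ρ - N Z + (H - g)) (Y - H))).1
  have b5 := (abs_le.1 (abs_real_inner_le_norm (ρd + b) (y - η))).1
  have b6 : ‖ρd + b‖ * ‖y - η‖ ≤ ‖ρd + b‖ * (C * ‖Y - H‖) := by gcongr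
  refine minorant_arith (x := ‖Y - H‖) (e := ‖p - ζ‖) hN.pos hμ hμν hμν2 hlam
    (by positivity) (by positivity) hx ?_
  unfold costL
  rw [x1, x2, x3]
  have l1 : 1 / (2 * lam) = lam⁻¹ / 2 := by field_simp
  rw [l1]
  have := sq_nonneg ‖Y - H‖
  linarith

variable {d : ℕ} {Ω : Set (Space d)} {T : ℝ} [IsFiniteMeasure (volume.restrict Ω)]
  {hT : 0 < T} {S : LX Ω →L[ℝ] LX Ω} {SQ : HX Ω T →L[ℝ] HX Ω T}
  {NQ : HG Ω T →L[ℝ] HG Ω T} {σlow νlow lam CF : ℝ}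

/-- `τd` is the weak spatial divergence of `τ`. -/
def IsDiv (τ : HG Ω T) (τd : HX Ω T) : Prop :=
  ∀ (v : HX Ω T) (V : HG Ω T), InWQ v V → inner ℝ τ V = -inner ℝ τd v

/-- The minorant is a lower bound. -/
lemma OptSys.minorant_le (hSQ : ∀ j u, cX hT j (SQ u) = S (cX hT j u))
    (hS : IsSymmCoercive S σlow) (hNQ : IsSymmCoercive NQ νlow) (hlam : 0 < lam)
    (hCF : IsFriedrichsConst Ω CF) {μ : ℝ} (hμ : 0 < μ) (hμν : μ ≤ νlow)
    (hμν2 : 2 * μ ^ 2 ≤ νlow ^ 2) {g : HG Ω T}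
    {y : HX Ω T} {Y : HG Ω T} {p : HX Ω T} {P : HG Ω T} (hy : InV hT y Y)
    (h : OptSys hT S NQ lam g y Y p P) {η ηt ζ ζt τd ρd : HX Ω T} {H Z τ ρ : HG Ω T}
    (hη : InWQ η H) (hηt : IsDt hT η ηt) (hζ : InWQ ζ Z) (hζt : IsDt hT ζ ζt)
    (hτ : IsDiv τ τd) (hρ : IsDiv ρ ρd) :
    costL lam g H ζ - (inner ℝ (NQ H) Z + inner ℝ (SQ ηt) ζ + lam⁻¹ * ‖ζ‖ ^ 2)
      - CF ^ 2 / (μ ^ 2 * lam) * (CF * ‖ρd + SQ ζt‖ + ‖ρ - NQ Z + (H - g)‖) ^ 2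
      - 1 / μ * (CF * ‖SQ ηt - τd + lam⁻¹ • ζ‖ + ‖τ - NQ H‖)
        * (CF * ‖ρd + SQ ζt‖ + ‖ρ - NQ Z + (H - g)‖)
    ≤ costL lam g Y p := by
  have hηV : InV hT η H := ⟨hη, hηt.isHalf⟩
  have hζV : InV hT ζ Z := ⟨hζ, hζt.isHalf⟩
  have heV := hy.sub hηV
  have e1 := h.2 _ _ heV
  -- Skewness replaces y by η, whose time derivative is in L²(Q).
  have k1 : half hT S y (y - η) = half hT S η (y - η) := by
    have := half_self (hT := hT) hS (y - η)
    rw [half_sub_left hy.isHalf hηV.isHalf heV.isHalf] at this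
    linarith
  rw [k1, hηt.half_eq hSQ] at e1
  have e2 := h.2 _ _ hζV
  -- Splitting y = η + (y - η) and using skewness moves the derivative of the error onto ζ.
  have k2 : half hT S y ζ = inner ℝ (SQ ηt) ζ - inner ℝ (SQ ζt) (y - η) := by
    have h1 : half hT S (y - η) ζ = half hT S y ζ - half hT S η ζ :=
      half_sub_left hy.isHalf hηV.isHalf hζV.isHalf
    rw [half_skew hS, hζt.half_eq hSQ, hηt.half_eq hSQ] at h1
    linarith
  rw [k2] at e2
  exact minorant_le_of_identities hNQ hlam hCF.1.le hμ hμν hμν2 (heV.inWQ.norm_le hCF) e1 e2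
    (hτ _ _ heV.inWQ) (hρ _ _ heV.inWQ)

end LowerBound

end ParabolicOC

namespace ParabolicOC

/-! ### Truncation to finitely many modes -/

section Truncation

variable {X H : Type*} [NormedAddCommGroup X] [InnerProductSpace ℝ X] [CompleteSpace X]
  [NormedAddCommGroup H] [InnerProductSpace ℝ H] [CompleteSpace H]

/-- The symmetric partial sums of the mode expansion. -/
def modeSum (M : ℤ → X →ₗᵢ[ℝ] H) (n : ℕ) (u : H) : H :=
  ∑ j ∈ Finset.Icc (-(n : ℤ)) n, M j (coeff M j u)

variable {M : ℤ → X →ₗᵢ[ℝ] H}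

lemma CompleteFamily.tendsto_modeSum (hM : CompleteFamily M) (u : H) :
    Tendsto (fun n => modeSum M n u) atTop (𝓝 u) := by
  refine (hM.hasSum_emb u).comp (tendsto_atTop_finset_of_monotone ?_ fun j => ?_)
  · intro a b hab
    exact Finset.Icc_subset_Icc (by simpa using hab) (by simpa using hab)
  · exact ⟨j.natAbs, by rw [Finset.mem_Icc]; omega⟩

/-- The range is symmetric, so j and -j, which the time derivative couples, are kept or dropped
together. -/
lemma CompleteFamily.coeff_modeSum (hM : CompleteFamily M) (n : ℕ) (u : H) (j : ℤ) :
    coeff M j (modeSum M n u) = if j.natAbs ≤ n then coeff M j u else 0 := by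
  rw [modeSum, map_sum]
  by_cases h : j.natAbs ≤ n
  · rw [Finset.sum_eq_single j, coeff_emb_self, if_pos h]
    · intro i _ hi
      exact hM.coeff_emb_of_ne hi.symm _
    · intro h'
      rw [Finset.mem_Icc] at h'
      omega
  · rw [if_neg h]
    refine Finset.sum_eq_zero fun i hi => hM.coeff_emb_of_ne ?_ _
    rw [Finset.mem_Icc] at hi
    omega

end Truncation

/-! ### Cost identity, fluxes and truncations of solutions -/

section Exact

variable {d : ℕ} {Ω : Set (Space d)} {T : ℝ} [IsFiniteMeasure (volume.restrict Ω)]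
  {hT : 0 < T} {S : LX Ω →L[ℝ] LX Ω} {SQ : HX Ω T →L[ℝ] HX Ω T} {N : LG Ω →L[ℝ] LG Ω}
  {NQ : HG Ω T →L[ℝ] HG Ω T} {σlow νlow lam CF : ℝ}
  {g : HG Ω T} {y : HX Ω T} {Y : HG Ω T} {p : HX Ω T} {P : HG Ω T}

/-- The value of the cost functional at an arbitrary admissible pair. -/
lemma OptSys.cost_eq (hS : IsSymmCoercive S σlow) (hNQ : IsSymmCoercive NQ νlow) (hlam : 0 < lam)
    (hy : InV hT y Y) (hp : InV hT p P) (h : OptSys hT S NQ lam g y Y p P) {y' u' : HX Ω T}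
    {Y' : HG Ω T} (hy' : InV hT y' Y')
    (hst : ∀ v V, InV hT v V → inner ℝ (NQ Y') V + half hT S y' v = inner ℝ u' v) :
    1 / 2 * ‖Y' - g‖ ^ 2 + lam / 2 * ‖u'‖ ^ 2
      = costL lam g Y p + (1 / 2 * ‖Y' - Y‖ ^ 2 + lam / 2 * ‖u' + lam⁻¹ • p‖ ^ 2) := by
  -- The adjoint equation tested with y' - y and both state equations tested with p cancel the
  -- linear terms of the expansion.
  have a1 := h.1 _ _ (hy'.sub hy)
  have a2 := h.2 _ _ hp
  have a3 := hst _ _ hp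
  rw [half_sub_right hy'.isHalf hy.isHalf hp.isHalf, half_skew hS p y', half_skew hS p y,
    hNQ.comm P, map_sub, inner_sub_left (NQ Y'), inner_sub_right g, inner_sub_right Y] at a1
  have x1 : ‖Y' - g‖ ^ 2 = ‖Y - g‖ ^ 2 + 2 * inner ℝ (Y - g) (Y' - Y) + ‖Y' - Y‖ ^ 2 := by
    rw [← norm_add_sq_real]; congr 2; abel
  have x2 : ‖u' + lam⁻¹ • p‖ ^ 2
      = ‖u'‖ ^ 2 + 2 * (lam⁻¹ * inner ℝ u' p) + (lam⁻¹) ^ 2 * ‖p‖ ^ 2 := by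
    rw [norm_add_sq_real, real_inner_smul_right, norm_smul, mul_pow, Real.norm_eq_abs, sq_abs]
  rw [inner_sub_left, inner_sub_right, inner_sub_right] at x1
  rw [real_inner_self_eq_norm_sq] at a2
  unfold costL
  rw [x1, x2]
  have l1 : lam / 2 * (‖u'‖ ^ 2 + 2 * (lam⁻¹ * inner ℝ u' p) + (lam⁻¹) ^ 2 * ‖p‖ ^ 2)
      = lam / 2 * ‖u'‖ ^ 2 + inner ℝ u' p + lam⁻¹ / 2 * ‖p‖ ^ 2 := by
    field_simp
  have l2 : 1 / (2 * lam) = lam⁻¹ / 2 := by field_simp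
  rw [l1, l2]
  linarith

/-- Divergences can be identified mode by mode. -/
lemma isDiv_of_coeff (hT : 0 < T) {τ : HG Ω T} {τd : HX Ω T}
    (h : ∀ j v V, InW0 v V → inner ℝ (cG hT j τ) V = -inner ℝ (cX hT j τd) v) : IsDiv τ τd := by
  intro v V hv
  have h1 := (completeG Ω hT).hasSum_inner τ V
  have h2 := (completeX Ω hT).hasSum_inner τd v
  exact h1.unique (h2.neg.of_forall_eq fun j => h j _ _ (hv.coeff hT j))

/-- In the mode equation -jω S y_{-j} is the coefficient of σ∂_t y, so the equation itself says
∇·(ν∇y) = σ∂_t y + p/λ. -/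
lemma OptSys.isDiv_flux (hSQ : ∀ j u, cX hT j (SQ u) = S (cX hT j u))
    (hNQ : ∀ j G, cG hT j (NQ G) = N (cG hT j G)) (hy : InWQ y Y) (hp : InWQ p P)
    (h : OptSys hT S NQ lam g y Y p P) {yt : HX Ω T} (hyt : IsDt hT y yt) :
    IsDiv (NQ Y) (SQ yt + lam⁻¹ • p) := by
  have hm := h.modeSystem hNQ hy hp
  refine isDiv_of_coeff hT fun j v V hv => ?_
  have h3 := hm.eq₂ j v V hv
  have e1 : cX hT j (SQ yt) = -(j * freq T) • S (cX hT (-j) y) := by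
    rw [hSQ, hyt j, S.map_smul]
  have e2 : cX hT j (lam⁻¹ • p) = lam⁻¹ • cX hT j p := (cX hT j).map_smul _ _
  rw [hNQ, map_add, inner_add_left, e1, e2, real_inner_smul_left, real_inner_smul_left]
  linarith

/-- The analogue for the adjoint equation. It needs ∂_t p in L²(Q), which the system does not
supply. -/
lemma OptSys.isDiv_adjoint_flux (hSQ : ∀ j u, cX hT j (SQ u) = S (cX hT j u))
    (hNQ : ∀ j G, cG hT j (NQ G) = N (cG hT j G)) (hy : InWQ y Y) (hp : InWQ p P)
    (h : OptSys hT S NQ lam g y Y p P) {pt : HX Ω T} (hpt : IsDt hT p pt) :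
    IsDiv (NQ P - (Y - g)) (-SQ pt) := by
  have hm := h.modeSystem hNQ hy hp
  refine isDiv_of_coeff hT fun j v V hv => ?_
  have h3 := hm.eq₁ j v V hv
  have e1 : cX hT j (SQ pt) = -(j * freq T) • S (cX hT (-j) p) := by
    rw [hSQ, hpt j, S.map_smul]
  rw [map_sub, map_sub, hNQ, map_neg, e1, inner_neg_left, real_inner_smul_left,
    inner_sub_left, inner_sub_left]
  linarith

/-- The pairing in the minorant vanishes for solutions of the optimality system. -/
lemma OptSys.pairing_eq_zero (hSQ : ∀ j u, cX hT j (SQ u) = S (cX hT j u)) (hp : InV hT p P)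
    (h : OptSys hT S NQ lam g y Y p P) {yt : HX Ω T} (hyt : IsDt hT y yt) :
    inner ℝ (NQ Y) P + inner ℝ (SQ yt) p + lam⁻¹ * ‖p‖ ^ 2 = 0 := by
  have := h.2 _ _ hp
  rw [hyt.half_eq hSQ, real_inner_self_eq_norm_sq] at this
  linarith

abbrev sumX (hT : 0 < T) (n : ℕ) (u : HX Ω T) : HX Ω T := modeSum (mX hT) n u
abbrev sumG (hT : 0 < T) (n : ℕ) (G : HG Ω T) : HG Ω T := modeSum (mG hT) n G

lemma InWQ.modeSum {u : HX Ω T} {G : HG Ω T} (h : InWQ u G) (n : ℕ) :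
    InWQ (sumX hT n u) (sumG hT n G) := by
  refine inWQ_of_coeff hT fun j => ?_
  rw [(completeX Ω hT).coeff_modeSum, (completeG Ω hT).coeff_modeSum]
  split_ifs
  · exact h.coeff hT j
  · exact InW0.zero

lemma exists_isDt_modeSum (n : ℕ) (u : HX Ω T) : ∃ ut, IsDt hT (sumX hT n u) ut := by
  refine exists_isDt (summable_of_ne_finset_zero (s := Finset.Icc (-(n : ℤ)) n) fun j hj => ?_)
  rw [(completeX Ω hT).coeff_modeSum, if_neg]
  · simp
  · rw [Finset.mem_Icc] at hj
    omega

/-- Each mode equation involves only j and -j, so it is either retained whole or becomes 0 = 0. -/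
lemma OptSys.modeSum (hNQ : ∀ j G, cG hT j (NQ G) = N (cG hT j G)) (hy : InWQ y Y)
    (hp : InWQ p P) (h : OptSys hT S NQ lam g y Y p P) (n : ℕ) :
    OptSys hT S NQ lam (sumG hT n g) (sumX hT n y) (sumG hT n Y) (sumX hT n p) (sumG hT n P) := by
  obtain ⟨yt, hyt⟩ := exists_isDt_modeSum (hT := hT) n y
  obtain ⟨pt, hpt⟩ := exists_isDt_modeSum (hT := hT) n p
  have hm := h.modeSystem hNQ hy hp
  refine ModeSystem.optSys hNQ hyt.isHalf hpt.isHalf ⟨fun j => (hy.modeSum n).coeff hT j,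
    fun j => (hp.modeSum n).coeff hT j, fun j z Z hz => ?_, fun j z Z hz => ?_⟩
  · simp only [(completeX Ω hT).coeff_modeSum, (completeG Ω hT).coeff_modeSum, Int.natAbs_neg]
    split_ifs
    · exact hm.eq₁ j z Z hz
    · simp
  · simp only [(completeX Ω hT).coeff_modeSum, (completeG Ω hT).coeff_modeSum, Int.natAbs_neg]
    split_ifs
    · exact hm.eq₂ j z Z hz
    · simp

/-- The values of the minorant at the truncated solutions converge to the optimal value. -/
lemma tendsto_minorant_modeSum (c : ℝ) :
    Tendsto (fun n => costL lam g (sumG hT n Y) (sumX hT n p) - c * ‖sumG hT n g - g‖ ^ 2) atTop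
      (𝓝 (costL lam g Y p)) := by
  have h1 := (completeG Ω hT).tendsto_modeSum Y
  have h2 := (completeX Ω hT).tendsto_modeSum p
  have h3 := (completeG Ω hT).tendsto_modeSum g
  have h4 := (((h1.sub_const g).norm.pow 2).const_mul (1 / 2)).add
    ((h2.norm.pow 2).const_mul (1 / (2 * lam)))
  have h5 := h4.sub (((h3.sub_const g).norm.pow 2).const_mul c)
  simpa [costL] using h5

end Exact

end ParabolicOC

namespace ParabolicOC

/-! ### Periodic time traces and mode-wise derivatives -/

section TimePeriodic

variable {d : ℕ} {Ω : Set (Space d)} {T : ℝ} [IsFiniteMeasure (volume.restrict Ω)]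

lemma inner_coeff_toLp {F : Type*} [NormedAddCommGroup F] [InnerProductSpace ℝ F] [CompleteSpace F]
    (hT : 0 < T) (j : ℤ) {u : Space d × ℝ → F} (hu : MemLp u 2 (muP Ω T)) {ψ : Space d → F}
    (hψ : MemLp ψ 2 (volume.restrict Ω)) :
    inner ℝ (coeff (mode F (volume.restrict Ω) hT) j (hu.toLp u)) (hψ.toLp ψ)
      = ∫ z, hartley T j z.2 * inner ℝ (u z) (ψ z.1) ∂(muP Ω T) := by
  rw [inner_coeff, inner_toLp_mode]
  refine integral_congr_ae ?_
  filter_upwards [ae_comp_fst hψ.coeFn_toLp (tauT T)] with z hz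
  rw [hz]

/-- A cut-off function in time which is `1` in a neighbourhood of `[0,T]`. -/
lemma exists_cutoff (hT : 0 < T) : ∃ χ : ℝ → ℝ, ContDiff ℝ ∞ χ ∧ HasCompactSupport χ ∧
    ∀ t ∈ Icc 0 T, χ =ᶠ[𝓝 t] 1 := by
  -- [0,T] lies within distance T/2 of the centre, strictly inside the inner radius T.
  let b : ContDiffBump (T / 2) := ⟨T, 2 * T, hT, by linarith⟩
  refine ⟨b, b.contDiff, b.hasCompactSupport, fun t ht => ?_⟩
  refine b.eventuallyEq_one_of_mem_ball ?_
  rw [Metric.mem_ball, Real.dist_eq, abs_lt]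
  constructor <;> linarith [ht.1, ht.2, show b.rIn = T from rfl]

lemma ae_muP_time (Ω : Set (Space d)) (T : ℝ) : ∀ᵐ z ∂(muP Ω T), z.2 ∈ Ioo 0 T :=
  Measure.quasiMeasurePreserving_snd.ae (ae_restrict_mem measurableSet_Ioo)

/-- The time derivative of a time-periodic function is the derivative mode by mode. -/
lemma IsH01Per.isDt (hΩ : IsOpen Ω) (hT : 0 < T) {u ut : Space d × ℝ → ℝ}
    (h : IsH01Per Ω T u ut) (hu : MemLp u 2 (muP Ω T)) (hut : MemLp ut 2 (muP Ω T)) :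
    IsDt hT (hu.toLp u) (hut.toLp ut) := by
  obtain ⟨-, -, w, hw, htr⟩ := h
  obtain ⟨χ, hχ, hχc, hχ1⟩ := exists_cutoff hT
  intro j
  -- The trace identity requires compact support in time, so e_j is cut off away from [0,T] and left
  -- unchanged near it.
  set θ : ℝ → ℝ := fun t => χ t * hartley T j t with hθ
  have hθt : IsTest (univ : Set ℝ) θ :=
    ⟨hχ.mul (contDiff_hartley T j), hχc.mul_right, subset_univ _⟩
  have hθe : ∀ t ∈ Icc 0 T, θ =ᶠ[𝓝 t] hartley T j := fun t ht => by
    filter_upwards [hχ1 t ht] with s hs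
    rw [hθ]; simp [hs]
  have hθv : ∀ t ∈ Icc 0 T, θ t = hartley T j t := fun t ht => (hθe t ht).eq_of_nhds
  have hθd : ∀ t ∈ Icc 0 T, deriv θ t = j * freq T * hartley T (-j) t := fun t ht => by
    rw [(hθe t ht).deriv_eq, (hasDerivAt_hartley T j t).deriv]
  rw [← sub_eq_zero, Lp.eq_zero_iff_ae_eq_zero]
  set D : LX Ω := cX hT j (hut.toLp ut) - -(j * freq T) • cX hT (-j) (hu.toLp u) with hD
  refine ae_eq_zero_of_forall_test hΩ ((Lp.memLp D).integrable (by norm_num)) fun ψ hψ => ?_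
  have e0 : ∫ x in Ω, ψ x • D x = inner ℝ D (hψ.memLp.toLp ψ) := by
    rw [real_inner_comm, inner_toLp_left]
    refine integral_congr_ae (ae_of_all _ fun x => ?_)
    simp [mul_comm]
  rw [e0, hD, inner_sub_left, real_inner_smul_left, inner_coeff_toLp hT j hut,
    inner_coeff_toLp hT (-j) hu]
  -- Both traces equal w and e_j(0) = e_j(T), so the boundary terms cancel.
  have key := htr _ (hψ.mul_time hθt)
  dsimp only at key
  rw [muQ_eq, hθv T ⟨hT.le, le_rfl⟩, hθv 0 ⟨le_rfl, hT.le⟩, hartley_zero, hartley_right hT,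
    add_sub_cancel_right] at key
  have k1 : ∫ z, u z * derivT (fun z => ψ z.1 * θ z.2) z ∂(muP Ω T)
      = j * freq T * ∫ z, hartley T (-j) z.2 * inner ℝ (u z) (ψ z.1) ∂(muP Ω T) := by
    rw [← integral_const_mul]
    refine integral_congr_ae ?_
    filter_upwards [ae_muP_time Ω T] with z hz
    rw [derivT_mul_time, hθd _ (Ioo_subset_Icc_self hz)]
    simp only [RCLike.inner_apply, conj_trivial]; ring
  have k2 : ∫ z, ut z * (ψ z.1 * θ z.2) ∂(muP Ω T)
      = ∫ z, hartley T j z.2 * inner ℝ (ut z) (ψ z.1) ∂(muP Ω T) := by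
    refine integral_congr_ae ?_
    filter_upwards [ae_muP_time Ω T] with z hz
    rw [hθv _ (Ioo_subset_Icc_self hz)]
    simp only [RCLike.inner_apply, conj_trivial]; ring
  rw [k1, k2] at key
  linarith

/-- For j ≠ 0, ‖u_j‖ = |j|⁻¹ · |j|‖u_j‖ is a product of square summable sequences. Absolute
convergence is what gives the series a value at t = 0. -/
lemma summable_coeff_of_isDt {hT : 0 < T} {u ut : HX Ω T} (h : IsDt hT u ut) :
    Summable fun j => cX hT j u := by
  have hω := freq_pos hT
  have h1 := summable_neg_int ((completeX Ω hT).summable_coeff ut)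
  have h2 : Summable fun j : ℤ => 1 / (j : ℝ) ^ 2 := Real.summable_one_div_int_pow.2 (by norm_num)
  refine Summable.of_norm_bounded_eventually (g := fun j : ℤ => 1 / (j : ℝ) ^ 2
    + (freq T ^ 2)⁻¹ * ‖cX hT (-j) ut‖ ^ 2) (h2.add (h1.mul_left _)) ?_
  have : ({0} : Set ℤ)ᶜ ∈ (cofinite : Filter ℤ) := (finite_singleton 0).compl_mem_cofinite
  filter_upwards [this] with j hj
  have hj' : (j : ℝ) ≠ 0 := by exact_mod_cast hj
  have hja : 0 < |(j : ℝ)| := abs_pos.2 hj'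
  rw [h.norm_eq, mul_pow, mul_pow, sq_abs]
  have e : (freq T ^ 2)⁻¹ * ((j : ℝ) ^ 2 * freq T ^ 2 * ‖cX hT j u‖ ^ 2)
      = (|(j : ℝ)| * ‖cX hT j u‖) ^ 2 := by
    rw [mul_pow, sq_abs]; field_simp
  have e' : 1 / (j : ℝ) ^ 2 = (|(j : ℝ)|⁻¹) ^ 2 := by rw [inv_pow, sq_abs, one_div]
  have e'' : ‖cX hT j u‖ = |(j : ℝ)|⁻¹ * (|(j : ℝ)| * ‖cX hT j u‖) := by field_simp
  rw [e, e']
  nth_rewrite 1 [e'']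
  nlinarith [sq_nonneg (|(j : ℝ)|⁻¹ - |(j : ℝ)| * ‖cX hT j u‖), sq_nonneg (|(j : ℝ)|⁻¹),
    sq_nonneg (|(j : ℝ)| * ‖cX hT j u‖)]

/-- The modes of the time derivative of a smooth, not necessarily periodic, function. -/
lemma coeff_derivT (hT : 0 < T) (j : ℤ) {φ : Space d × ℝ → ℝ}
    (hφ : IsTest (Ω ×ˢ (univ : Set ℝ)) φ) :
    cX hT j ((hφ.memLp_derivT (Ω := Ω) (T := T)).toLp (derivT φ))
        + (j * freq T) • cX hT (-j) ((hφ.memLp_Q (Ω := Ω) (T := T)).toLp φ)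
      = (1 / √T) • ((hφ.slice T).memLp.toLp (fun x => φ (x, T))
        - (hφ.slice 0).memLp.toLp (fun x => φ (x, 0))) := by
  ext1
  have m1 := hφ.memLp_derivT (Ω := Ω) (T := T)
  have m2 := hφ.memLp_Q (Ω := Ω) (T := T)
  filter_upwards [integral_hartley_ae hT j m1, integral_hartley_ae hT (-j) m2,
    (hφ.slice T).memLp.coeFn_toLp, (hφ.slice 0).memLp.coeFn_toLp,
    Lp.coeFn_add (cX hT j (m1.toLp (derivT φ))) ((j * freq T) • cX hT (-j) (m2.toLp φ)),
    Lp.coeFn_smul (j * freq T : ℝ) (cX hT (-j) (m2.toLp φ)),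
    Lp.coeFn_smul (1 / √T) ((hφ.slice T).memLp.toLp (fun x => φ (x, T))
        - (hφ.slice 0).memLp.toLp (fun x => φ (x, 0))),
    Lp.coeFn_sub ((hφ.slice T).memLp.toLp (fun x => φ (x, T)))
        ((hφ.slice 0).memLp.toLp (fun x => φ (x, 0)))] with x h1 h2 h3 h4 h5 h6 h7 h8
  rw [h5, h7, Pi.add_apply, Pi.smul_apply, h6, Pi.smul_apply, h8, Pi.sub_apply, h3, h4, ← h1, ← h2]
  have c1 : Continuous fun t => hartley T j t • derivT φ (x, t) :=
    (continuous_hartley T j).smul ((continuous_derivT hφ.1).comp (by fun_prop))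
  have c2 : Continuous fun t => hartley T (-j) t • φ (x, t) :=
    (continuous_hartley T (-j)).smul (hφ.1.continuous.comp (by fun_prop))
  have c3 : Continuous fun t => (j * freq T) • hartley T (-j) t • φ (x, t) := by fun_prop
  rw [← integral_Ioc_eq_integral_Ioo, ← integral_Ioc_eq_integral_Ioo,
    ← intervalIntegral.integral_of_le hT.le, ← intervalIntegral.integral_of_le hT.le,
    ← intervalIntegral.integral_smul, ← intervalIntegral.integral_add (c1.intervalIntegrable _ _)
      (c3.intervalIntegrable _ _)]
  -- The fundamental theorem of calculus for e_j φ(x,·); both endpoints carry the factor 1/√T.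
  have hd : ∀ t, HasDerivAt (fun t => hartley T j t * φ (x, t))
      (hartley T j t • derivT φ (x, t) + (j * freq T) • hartley T (-j) t • φ (x, t)) t := by
    intro t
    refine ((hasDerivAt_hartley T j t).mul (derivT_eq hφ.1 (x, t)).1).congr_deriv ?_
    simp only [smul_eq_mul]; ring
  rw [intervalIntegral.integral_eq_sub_of_hasDerivAt (fun t _ => hd t)
    ((c1.add c3).intervalIntegrable _ _), hartley_zero, hartley_right hT]
  simp only [smul_eq_mul]; ring

/-- Functions with a mode-wise time derivative are time-periodic. -/
lemma IsDt.isH01Per (hT : 0 < T) {u ut : Space d × ℝ → ℝ} (hu : MemLp u 2 (muP Ω T))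
    (hut : MemLp ut 2 (muP Ω T)) (h : IsDt hT (hu.toLp u) (hut.toLp ut)) : IsH01Per Ω T u ut := by
  have hs := summable_coeff_of_isDt h
  -- The expansion ∑ e_j(t) u_j evaluated at t = 0, and equally at t = T, where every e_j equals
  -- 1/√T.
  set w : LX Ω := (1 / √T) • ∑' j, cX hT j (hu.toLp u) with hw
  refine ⟨by rwa [muQ_eq], by rwa [muQ_eq], w, Lp.memLp w, fun φ hφ => ?_⟩
  rw [muQ_eq]
  have m1 := hφ.memLp_derivT (Ω := Ω) (T := T)
  have m2 := hφ.memLp_Q (Ω := Ω) (T := T)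
  have s1 := (completeX Ω hT).hasSum_inner (hu.toLp u) (m1.toLp (derivT φ))
  have s2 := (Equiv.neg ℤ).hasSum_iff.2
    ((completeX Ω hT).hasSum_inner (hut.toLp ut) (m2.toLp φ))
  set δ : LX Ω := (hφ.slice T).memLp.toLp (fun x => φ (x, T))
        - (hφ.slice 0).memLp.toLp (fun x => φ (x, 0)) with hδ
  have s3 : HasSum (fun j => inner ℝ (cX hT j (hu.toLp u)) ((1 / √T) • δ)) (inner ℝ w δ) := by
    have h1 := (innerSL ℝ ((1 / √T) • δ)).hasSum hs.hasSum
    have h2 : inner ℝ w δ = innerSL ℝ ((1 / √T) • δ) (∑' j, cX hT j (hu.toLp u)) := by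
      rw [innerSL_apply_apply, hw, real_inner_smul_left, real_inner_smul_left, real_inner_comm]
    rw [h2]
    exact h1.of_forall_eq fun j => (real_inner_comm _ _)
  have s4 : inner ℝ (hu.toLp u) (m1.toLp (derivT φ)) + inner ℝ (hut.toLp ut) (m2.toLp φ)
      = inner ℝ w δ := by
    refine (s1.add s2).unique (s3.of_forall_eq fun j => ?_)
    rw [← coeff_derivT hT j hφ, inner_add_right, real_inner_smul_right]
    simp only [Function.comp_apply, Equiv.neg_apply]
    rw [h, neg_neg, real_inner_smul_left]
    push_cast; ring
  rw [hδ, inner_sub_right, inner_toLp, inner_toLp, real_inner_comm, inner_toLp_left,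
    real_inner_comm, inner_toLp_left] at s4
  simp only [RCLike.inner_apply, conj_trivial] at s4
  have c1 : ∀ (f g : Space d × ℝ → ℝ), ∫ z, f z * g z ∂(muP Ω T) = ∫ z, g z * f z ∂(muP Ω T) :=
    fun f g => by simp only [mul_comm]
  rw [c1 u, c1 ut]
  linarith

end TimePeriodic

end ParabolicOC

namespace ParabolicOC

/-! ### Trigonometric and Hartley coefficients -/

section FourierCoefficients

variable {d : ℕ} {Ω : Set (Space d)} {T : ℝ} [IsFiniteMeasure (volume.restrict Ω)]

lemma ae_integrable_hartley_slice {u : Space d × ℝ → ℝ} (hu : MemLp u 2 (muP Ω T)) (j : ℤ) :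
    ∀ᵐ x ∂(volume.restrict Ω), Integrable (fun t => hartley T j t • u (x, t)) (tauT T) :=
  (integrable_hartley_smul j (hu.integrable (by norm_num))).prod_right_ae

lemma two_div_mul_sqrt (hT : 0 < T) (a : ℝ) : 2 / T * (√T / 2 * a) = 1 / √T * a := by
  have h1 := Real.sqrt_pos.2 hT
  have h2 := Real.sq_sqrt hT.le
  nth_rewrite 1 [← h2]
  field_simp

lemma cosCoeff_ae (hT : 0 < T) {u : Space d × ℝ → ℝ} (hu : MemLp u 2 (muP Ω T)) (k : ℕ) :
    cosCoeff T u k =ᵐ[volume.restrict Ω]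
      ((1 / √T) • (cX hT k (hu.toLp u) + cX hT (-k) (hu.toLp u)) : LX Ω) := by
  filter_upwards [integral_hartley_ae hT k hu, integral_hartley_ae hT (-k) hu,
    ae_integrable_hartley_slice hu k, ae_integrable_hartley_slice hu (-k),
    Lp.coeFn_smul (1 / √T) (cX hT k (hu.toLp u) + cX hT (-k) (hu.toLp u)),
    Lp.coeFn_add (cX hT k (hu.toLp u)) (cX hT (-k) (hu.toLp u))] with x h1 h2 h3 h4 h5 h6
  rw [h5, Pi.smul_apply, h6, Pi.add_apply, ← h1, ← h2, cosCoeff, smul_eq_mul,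
    ← two_div_mul_sqrt hT, ← integral_add h3 h4, ← integral_const_mul (√T / 2)]
  congr 1
  refine integral_congr_ae (ae_of_all _ fun t => ?_)
  simp only [cos_eq_hartley hT, smul_eq_mul]; ring

lemma sinCoeff_ae (hT : 0 < T) {u : Space d × ℝ → ℝ} (hu : MemLp u 2 (muP Ω T)) (k : ℕ) :
    sinCoeff T u k =ᵐ[volume.restrict Ω]
      ((1 / √T) • (cX hT k (hu.toLp u) - cX hT (-k) (hu.toLp u)) : LX Ω) := by
  filter_upwards [integral_hartley_ae hT k hu, integral_hartley_ae hT (-k) hu,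
    ae_integrable_hartley_slice hu k, ae_integrable_hartley_slice hu (-k),
    Lp.coeFn_smul (1 / √T) (cX hT k (hu.toLp u) - cX hT (-k) (hu.toLp u)),
    Lp.coeFn_sub (cX hT k (hu.toLp u)) (cX hT (-k) (hu.toLp u))] with x h1 h2 h3 h4 h5 h6
  rw [h5, Pi.smul_apply, h6, Pi.sub_apply, ← h1, ← h2, sinCoeff, smul_eq_mul,
    ← two_div_mul_sqrt hT, ← integral_sub h3 h4, ← integral_const_mul (√T / 2)]
  congr 1
  refine integral_congr_ae (ae_of_all _ fun t => ?_)
  simp only [sin_eq_hartley hT, smul_eq_mul]; ring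

lemma l2norm_congr_Lp {α F : Type*} [MeasurableSpace α] [NormedAddCommGroup F] {μ : Measure α}
    {f : α → F} {g : Lp F 2 μ} (h : f =ᵐ[μ] g) : l2norm μ f = ‖g‖ := by
  rw [l2norm, eLpNorm_congr_ae h, Lp.norm_def]

/-- The trigonometric coefficients are (u_k ± u_{-k})/√T, and the parallelogram law removes the
mixed terms. -/
lemma half_deriv_term (hT : 0 < T) {u : Space d × ℝ → ℝ} (hu : MemLp u 2 (muP Ω T)) (k : ℕ) :
    (k : ℝ) * freq T * (l2norm (volume.restrict Ω) (cosCoeff T u k) ^ 2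
        + l2norm (volume.restrict Ω) (sinCoeff T u k) ^ 2)
      = 2 * freq T / T * (|((k : ℤ) : ℝ)| * ‖cX hT k (hu.toLp u)‖ ^ 2
        + |((-k : ℤ) : ℝ)| * ‖cX hT (-k) (hu.toLp u)‖ ^ 2) := by
  rw [l2norm_congr_Lp (cosCoeff_ae hT hu k), l2norm_congr_Lp (sinCoeff_ae hT hu k), norm_smul,
    norm_smul, mul_pow, mul_pow, ← mul_add]
  have h1 := parallelogram_law_with_norm ℝ (cX hT k (hu.toLp u)) (cX hT (-k) (hu.toLp u))
  have h2 : ‖1 / √T‖ ^ 2 = 1 / T := by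
    rw [Real.norm_eq_abs, sq_abs, div_pow, Real.sq_sqrt hT.le, one_pow]
  rw [h2]
  simp only [Int.cast_neg, Int.cast_natCast, abs_neg, Nat.abs_cast]
  have h3 : ‖cX hT k (hu.toLp u) + cX hT (-k) (hu.toLp u)‖ ^ 2
      + ‖cX hT k (hu.toLp u) - cX hT (-k) (hu.toLp u)‖ ^ 2
      = 2 * (‖cX hT k (hu.toLp u)‖ ^ 2 + ‖cX hT (-k) (hu.toLp u)‖ ^ 2) := by
    simpa only [sq] using h1
  rw [h3]; ring

lemma summable_half_deriv_iff (hT : 0 < T) {u : Space d × ℝ → ℝ} (hu : MemLp u 2 (muP Ω T)) :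
    (Summable fun k : ℕ => (k : ℝ) * freq T * (l2norm (volume.restrict Ω) (cosCoeff T u k) ^ 2
        + l2norm (volume.restrict Ω) (sinCoeff T u k) ^ 2)) ↔ IsHalf hT (hu.toLp u) := by
  have hc : 2 * freq T / T ≠ 0 := by
    have := freq_pos hT
    positivity
  simp only [half_deriv_term hT hu]
  rw [summable_mul_left_iff hc, IsHalf]
  refine ⟨fun h => ?_, fun h => ?_⟩
  · exact .of_nat_of_neg
      (.of_nonneg_of_le (fun k => by positivity)
        (fun k => le_add_of_nonneg_right (by positivity)) h)
      (.of_nonneg_of_le (fun k => by positivity)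
        (fun k => le_add_of_nonneg_left (by positivity)) h)
  · have h' := (summable_int_iff_summable_nat_and_neg).1 h
    exact h'.1.add h'.2

/-- Writing a, b for the coefficients at ±k, this rests on (a-b)(a'+b') - (a+b)(a'-b') = 2(ab' -
ba'). -/
lemma halfForm_term (hT : 0 < T) {σ : Space d → ℝ} (hσ : IsBddMul (volume.restrict Ω) σ)
    {u v : Space d × ℝ → ℝ} (hu : MemLp u 2 (muP Ω T)) (hv : MemLp v 2 (muP Ω T)) (k : ℕ) :
    T / 2 * ((k : ℝ) * freq T * ∫ x in Ω, σ x *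
        (cosCoeff T u k x * (-sinCoeff T v k x) + sinCoeff T u k x * cosCoeff T v k x))
      = ((k : ℤ) : ℝ) * freq T * inner ℝ (mulL ℝ hσ (cX hT k (hu.toLp u))) (cX hT (-k) (hv.toLp v))
        + ((-k : ℤ) : ℝ) * freq T * inner ℝ (mulL ℝ hσ (cX hT (-k) (hu.toLp u)))
          (cX hT (-(-k)) (hv.toLp v)) := by
  rw [neg_neg]
  set a := cX hT k (hu.toLp u)
  set b := cX hT (-k) (hu.toLp u)
  set a' := cX hT k (hv.toLp v)
  set b' := cX hT (-k) (hv.toLp v)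
  have e : ∫ x in Ω, σ x *
        (cosCoeff T u k x * (-sinCoeff T v k x) + sinCoeff T u k x * cosCoeff T v k x)
      = 2 / T * (inner ℝ (mulL ℝ hσ a) b' - inner ℝ (mulL ℝ hσ b) a') := by
    rw [L2.inner_def, L2.inner_def, ← integral_sub (L2.integrable_inner _ _)
      (L2.integrable_inner _ _), ← integral_const_mul]
    refine integral_congr_ae ?_
    filter_upwards [cosCoeff_ae hT hu k, sinCoeff_ae hT hu k, cosCoeff_ae hT hv k,
      sinCoeff_ae hT hv k, Lp.coeFn_smul (1 / √T) (a + b), Lp.coeFn_add a b,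
      Lp.coeFn_smul (1 / √T) (a - b), Lp.coeFn_sub a b, Lp.coeFn_smul (1 / √T) (a' + b'),
      Lp.coeFn_add a' b', Lp.coeFn_smul (1 / √T) (a' - b'), Lp.coeFn_sub a' b',
      coeFn_mulL hσ a, coeFn_mulL hσ b] with x h1 h2 h3 h4 h5 h6 h7 h8 h9 h10 h11 h12 h13 h14
    rw [h1, h2, h3, h4, h5, h7, h9, h11, h13, h14, Pi.smul_apply, Pi.smul_apply, Pi.smul_apply,
      Pi.smul_apply, h6, h8, h10, h12]
    simp only [Pi.add_apply, Pi.sub_apply, smul_eq_mul, RCLike.inner_apply, conj_trivial]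
    have h2 : 2 / T = 2 * (1 / √T * (1 / √T)) := by
      rw [div_mul_div_comm, one_mul, Real.mul_self_sqrt hT.le, mul_one_div]
    rw [h2]; ring
  rw [e]
  push_cast
  field_simp
  ring

/-- The half-order form in terms of the Hartley coefficients. -/
lemma halfForm_eq (hT : 0 < T) {σ : Space d → ℝ} (hσ : IsBddMul (volume.restrict Ω) σ)
    {u v : Space d × ℝ → ℝ} (hu : MemLp u 2 (muP Ω T)) (hv : MemLp v 2 (muP Ω T))
    (hu' : IsHalf hT (hu.toLp u)) (hv' : IsHalf hT (hv.toLp v)) :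
    halfForm Ω T σ u v = half hT (mulL ℝ hσ) (hu.toLp u) (hv.toLp v) := by
  -- Folding ℤ onto ℕ counts j = 0 twice, harmlessly, because its weight is zero.
  have h := ((summable_half (S := mulL ℝ hσ) hu' hv').hasSum.nat_add_neg).tsum_eq
  rw [halfForm, ← tsum_mul_left, half]
  rw [tsum_congr (halfForm_term hT hσ hu hv)]
  simpa using h

end FourierCoefficients

end ParabolicOC

namespace ParabolicOC

/-! ### Integrals with bounded multipliers -/

section Multiplication

variable {α F : Type*} [MeasurableSpace α] [NormedAddCommGroup F] [InnerProductSpace ℝ F]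
  {μ : Measure α} {m : α → ℝ}

lemma isSymmCoercive_mulL (hm : IsBddMul μ m) {c : ℝ} (hc : 0 < c) (h : ∀ᵐ x ∂μ, c ≤ m x) :
    IsSymmCoercive (mulL F hm) c :=
  ⟨hc, inner_mulL_left hm, le_inner_mulL_self hm h⟩

lemma integrable_inner_memLp {f g : α → F} (hf : MemLp f 2 μ) (hg : MemLp g 2 μ) :
    Integrable (fun x => (inner ℝ (f x) (g x) : ℝ)) μ :=
  (integrable_inner_toLp_left hf (hg.toLp g)).congr <| by
    filter_upwards [hg.coeFn_toLp] with x h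
    rw [h]

lemma integrable_mul_inner (hm : IsBddMul μ m) {f g : α → F} (hf : MemLp f 2 μ)
    (hg : MemLp g 2 μ) : Integrable (fun x => m x * inner ℝ (f x) (g x)) μ := by
  simpa only [real_inner_smul_left] using integrable_inner_memLp (hm.memLp_smul hf) hg

lemma integral_mul_inner (hm : IsBddMul μ m) {f g : α → F} (hf : MemLp f 2 μ)
    (hg : MemLp g 2 μ) :
    ∫ x, m x * inner ℝ (f x) (g x) ∂μ = inner ℝ (mulL F hm (hf.toLp f)) (hg.toLp g) := by
  rw [mulL_toLp, inner_toLp]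
  simp only [real_inner_smul_left]

end Multiplication

/-! ### From functions on Q to classes in L² -/

section Translation

variable {d : ℕ} {Ω : Set (Space d)} {T : ℝ}

namespace H1HalfZeroPer

lemma memLp_val (y : H1HalfZeroPer Ω T) : MemLp y.val 2 (muP Ω T) := muQ_eq Ω T ▸ y.isH10Zero.1
lemma memLp_grad (y : H1HalfZeroPer Ω T) : MemLp y.grad 2 (muP Ω T) :=
  muQ_eq Ω T ▸ y.isH10Zero.2.1

/-- The class of a function in `L²(Q)`. -/
def toX (y : H1HalfZeroPer Ω T) : HX Ω T := y.memLp_val.toLp y.val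
/-- The class of the weak gradient in `L²(Q)^d`. -/
def toG (y : H1HalfZeroPer Ω T) : HG Ω T := y.memLp_grad.toLp y.grad

lemma inV [IsFiniteMeasure (volume.restrict Ω)] (hT : 0 < T) (y : H1HalfZeroPer Ω T) :
    InV hT y.toX y.toG :=
  ⟨(isH10Zero_iff y.memLp_val y.memLp_grad).1 y.isH10Zero,
    (summable_half_deriv_iff hT y.memLp_val).1 y.half_deriv⟩

end H1HalfZeroPer

lemma isH10Zero_coeFn {u : HX Ω T} {G : HG Ω T} (h : InWQ u G) : IsH10Zero Ω T u G := by
  rw [isH10Zero_iff (Lp.memLp u) (Lp.memLp G), Lp.toLp_coeFn, Lp.toLp_coeFn]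
  exact h

/-- Representatives of the classes form an element of the space, so test functions and test classes
are interchangeable. -/
lemma InV.exists_h1Half [IsFiniteMeasure (volume.restrict Ω)] {hT : 0 < T} {u : HX Ω T}
    {G : HG Ω T} (h : InV hT u G) : ∃ y : H1HalfZeroPer Ω T, y.toX = u ∧ y.toG = G := by
  refine ⟨⟨u, G, isH10Zero_coeFn h.inWQ, (summable_half_deriv_iff hT (Lp.memLp u)).2 ?_⟩, ?_, ?_⟩
  · rw [Lp.toLp_coeFn]; exact h.isHalf
  · exact Lp.toLp_coeFn _ _
  · exact Lp.toLp_coeFn _ _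

namespace H11ZeroPer

lemma memLp_val (y : H11ZeroPer Ω T) : MemLp y.val 2 (muP Ω T) := muQ_eq Ω T ▸ y.isH10Zero.1
lemma memLp_grad (y : H11ZeroPer Ω T) : MemLp y.grad 2 (muP Ω T) :=
  muQ_eq Ω T ▸ y.isH10Zero.2.1
lemma memLp_dt (y : H11ZeroPer Ω T) : MemLp y.dt 2 (muP Ω T) :=
  muQ_eq Ω T ▸ y.isH01Per.2.1

/-- The class of a function in `L²(Q)`. -/
def toX (y : H11ZeroPer Ω T) : HX Ω T := y.memLp_val.toLp y.val
/-- The class of the weak gradient in `L²(Q)^d`. -/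
def toG (y : H11ZeroPer Ω T) : HG Ω T := y.memLp_grad.toLp y.grad
/-- The class of the weak time derivative in `L²(Q)`. -/
def toDt (y : H11ZeroPer Ω T) : HX Ω T := y.memLp_dt.toLp y.dt

lemma inWQ (y : H11ZeroPer Ω T) : InWQ y.toX y.toG :=
  (isH10Zero_iff y.memLp_val y.memLp_grad).1 y.isH10Zero

lemma isDt [IsFiniteMeasure (volume.restrict Ω)] (hΩ : IsOpen Ω) (hT : 0 < T)
    (y : H11ZeroPer Ω T) : IsDt hT y.toX y.toDt :=
  y.isH01Per.isDt hΩ hT y.memLp_val y.memLp_dt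

end H11ZeroPer

lemma InWQ.exists_h11 [IsFiniteMeasure (volume.restrict Ω)] {hT : 0 < T} {u ut : HX Ω T}
    {G : HG Ω T} (h : InWQ u G) (ht : IsDt hT u ut) :
    ∃ y : H11ZeroPer Ω T, y.toX = u ∧ y.toG = G ∧ y.toDt = ut :=
  ⟨⟨u, G, ut, isH10Zero_coeFn h, IsDt.isH01Per hT (Lp.memLp u) (Lp.memLp ut)
    (by rwa [Lp.toLp_coeFn, Lp.toLp_coeFn])⟩,
    Lp.toLp_coeFn _ _, Lp.toLp_coeFn _ _, Lp.toLp_coeFn _ _⟩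

namespace HDiv

lemma memLp_val' (τ : HDiv Ω T) : MemLp τ.val 2 (muP Ω T) := muQ_eq Ω T ▸ τ.memLp_val
lemma memLp_div' (τ : HDiv Ω T) : MemLp τ.div 2 (muP Ω T) := muQ_eq Ω T ▸ τ.memLp_div

/-- The class of a vector field in `L²(Q)^d`. -/
def toG (τ : HDiv Ω T) : HG Ω T := τ.memLp_val'.toLp τ.val
/-- The class of the weak divergence in `L²(Q)`. -/
def toX (τ : HDiv Ω T) : HX Ω T := τ.memLp_div'.toLp τ.div

/-- The pair (∇·τ, τ) annihilates the test pairs, hence by duality all of H^{1,0}_0(Q). -/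
lemma isDiv (τ : HDiv Ω T) : IsDiv τ.toG τ.toX := by
  intro v V hv
  have := (inWQ_iff v V).1 hv τ.toX τ.toG fun φ hφ => by
    rw [toX, toG, inner_toLp, inner_toLp]
    have h := τ.weak_div φ hφ
    rw [muQ_eq] at h
    have e : ∫ z, inner ℝ (gradX φ z) (τ.val z) ∂(muP Ω T)
        = ∫ z, inner ℝ (τ.val z) (gradX φ z) ∂(muP Ω T) :=
      integral_congr_ae (ae_of_all _ fun z => real_inner_comm _ _)
    rw [e, h]
    simp only [RCLike.inner_apply, conj_trivial]
    ring
  linarith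

end HDiv

lemma IsDiv.exists_hDiv {τ : HG Ω T} {τd : HX Ω T} (h : IsDiv τ τd) :
    ∃ σ : HDiv Ω T, σ.toG = τ ∧ σ.toX = τd := by
  refine ⟨⟨τ, τd, by rw [muQ_eq]; exact Lp.memLp τ, by rw [muQ_eq]; exact Lp.memLp τd,
    fun φ hφ => ?_⟩,
    Lp.toLp_coeFn _ _, Lp.toLp_coeFn _ _⟩
  have h' := h _ _ (InWQ.test hφ)
  rw [real_inner_comm, inner_toLp_left, real_inner_comm, inner_toLp_left] at h'
  rw [muQ_eq]
  simp only [RCLike.inner_apply, conj_trivial] at h'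
  rw [← h']
  exact integral_congr_ae (ae_of_all _ fun z => real_inner_comm _ _)

variable [IsFiniteMeasure (volume.restrict Ω)] {σ ν : Space d → ℝ}
  (hσ : IsBddMul (volume.restrict Ω) σ) (hν : IsBddMul (volume.restrict Ω) ν)

variable (T) in
/-- Multiplication with a function of the space variable on `L²(Q)`. -/
abbrev mulX : HX Ω T →L[ℝ] HX Ω T := mulL ℝ (isBddMul_fst (T := T) hσ)
variable (T) in
/-- Multiplication with a function of the space variable on `L²(Q)^d`. -/
abbrev mulG : HG Ω T →L[ℝ] HG Ω T := mulL (Space d) (isBddMul_fst (T := T) hν)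

lemma isState_iff (hT : 0 < T) (y : H1HalfZeroPer Ω T) {u : Space d × ℝ → ℝ}
    (hu : MemLp u 2 (muP Ω T)) : IsState Ω T σ ν y u ↔ ∀ v V, InV hT v V →
      inner ℝ (mulG T hν y.toG) V + half hT (mulL ℝ hσ) y.toX v = inner ℝ (hu.toLp u) v := by
  have key : ∀ q : H1HalfZeroPer Ω T,
      ((∫ z, ν z.1 * inner ℝ (y.grad z) (q.grad z) ∂(muQ Ω T)) + halfForm Ω T σ y.val q.val
        = ∫ z, u z * q.val z ∂(muQ Ω T)) ↔
      inner ℝ (mulG T hν y.toG) q.toG + half hT (mulL ℝ hσ) y.toX q.toX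
        = inner ℝ (hu.toLp u) q.toX := fun q => by
    rw [muQ_eq, halfForm_eq hT hσ y.memLp_val q.memLp_val (y.inV hT).isHalf (q.inV hT).isHalf,
      integral_mul_inner (isBddMul_fst hν) y.memLp_grad q.memLp_grad,
      H1HalfZeroPer.toX, H1HalfZeroPer.toX, inner_toLp hu q.memLp_val]
    simp only [RCLike.inner_apply, conj_trivial, mul_comm (u _)]
    rfl
  refine ⟨fun h v V hv => ?_, fun h q => (key q).2 (h _ _ (q.inV hT))⟩
  obtain ⟨q, rfl, rfl⟩ := hv.exists_h1Half
  exact (key q).1 (h q)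

lemma optimalitySystem_iff (hT : 0 < T) {gd : Space d × ℝ → Space d} (hgd : MemLp gd 2 (muP Ω T))
    (lam : ℝ) (y p : H1HalfZeroPer Ω T) : OptimalitySystem Ω T σ ν lam gd y p ↔
      OptSys hT (mulL ℝ hσ) (mulG T hν) lam (hgd.toLp gd) y.toX y.toG p.toX p.toG := by
  have key1 : ∀ v : H1HalfZeroPer Ω T,
      ((∫ z, (inner ℝ (y.grad z) (v.grad z) - ν z.1 * inner ℝ (p.grad z) (v.grad z)) ∂(muQ Ω T))
        + halfForm Ω T σ p.val v.val = ∫ z, inner ℝ (gd z) (v.grad z) ∂(muQ Ω T)) ↔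
      inner ℝ y.toG v.toG - inner ℝ (mulG T hν p.toG) v.toG + half hT (mulL ℝ hσ) p.toX v.toX
        = inner ℝ (hgd.toLp gd) v.toG := fun v => by
    rw [muQ_eq, halfForm_eq hT hσ p.memLp_val v.memLp_val (p.inV hT).isHalf (v.inV hT).isHalf,
      integral_sub (integrable_inner_memLp y.memLp_grad v.memLp_grad)
        (integrable_mul_inner (isBddMul_fst hν) p.memLp_grad v.memLp_grad),
      integral_mul_inner (isBddMul_fst hν) p.memLp_grad v.memLp_grad,
      ← inner_toLp y.memLp_grad v.memLp_grad, ← inner_toLp hgd v.memLp_grad]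
    rfl
  have key2 : ∀ q : H1HalfZeroPer Ω T,
      ((∫ z, (ν z.1 * inner ℝ (y.grad z) (q.grad z) + lam⁻¹ * p.val z * q.val z) ∂(muQ Ω T))
        + halfForm Ω T σ y.val q.val = 0) ↔
      inner ℝ (mulG T hν y.toG) q.toG + lam⁻¹ * inner ℝ p.toX q.toX
        + half hT (mulL ℝ hσ) y.toX q.toX = 0 := fun q => by
    have e : (fun z => lam⁻¹ * p.val z * q.val z)
        = fun z => lam⁻¹ * inner ℝ (p.val z) (q.val z) := by
      funext z
      simp only [RCLike.inner_apply, conj_trivial]; ring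
    have i2 := (integrable_inner_memLp p.memLp_val q.memLp_val).const_mul lam⁻¹
    rw [muQ_eq, halfForm_eq hT hσ y.memLp_val q.memLp_val (y.inV hT).isHalf (q.inV hT).isHalf,
      integral_add (integrable_mul_inner (isBddMul_fst hν) y.memLp_grad q.memLp_grad)
        (by rw [e]; exact i2), e, integral_const_mul,
      integral_mul_inner (isBddMul_fst hν) y.memLp_grad q.memLp_grad,
      ← inner_toLp p.memLp_val q.memLp_val]
    rfl
  constructor
  · refine fun h => ⟨fun v V hv => ?_, fun v V hv => ?_⟩
    · obtain ⟨q, rfl, rfl⟩ := hv.exists_h1Half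
      exact (key1 q).1 (h.1 q)
    · obtain ⟨q, rfl, rfl⟩ := hv.exists_h1Half
      exact (key2 q).1 (h.2 q)
  · exact fun h => ⟨fun q => (key1 q).2 (h.1 _ _ (q.inV hT)),
      fun q => (key2 q).2 (h.2 _ _ (q.inV hT))⟩

lemma cost_toLp {gd : Space d × ℝ → Space d} (hgd : MemLp gd 2 (muP Ω T)) (lam : ℝ)
    (y : H1HalfZeroPer Ω T) {u : Space d × ℝ → ℝ} (hu : MemLp u 2 (muP Ω T)) :
    cost Ω T lam gd y u
      = 1 / 2 * ‖y.toG - hgd.toLp gd‖ ^ 2 + lam / 2 * ‖hu.toLp u‖ ^ 2 := by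
  have e : l2norm (muP Ω T) (fun z => y.grad z - gd z) = ‖y.toG - hgd.toLp gd‖ := by
    rw [H1HalfZeroPer.toG, ← MemLp.toLp_sub, ← l2norm_eq]
    rfl
  rw [cost, muQ_eq, l2norm_eq hu, e]

/-- The minorant as a function of classes in `L²(Q)`. -/
def minorantL (SQ : HX Ω T →L[ℝ] HX Ω T) (NQ : HG Ω T →L[ℝ] HG Ω T) (lam CF μ : ℝ) (g H Z : HG Ω T)
    (ζ ηt ζt : HX Ω T) (τ : HG Ω T) (τd : HX Ω T) (ρ : HG Ω T) (ρd : HX Ω T) : ℝ :=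
  costL lam g H ζ - (inner ℝ (NQ H) Z + inner ℝ (SQ ηt) ζ + lam⁻¹ * ‖ζ‖ ^ 2)
      - CF ^ 2 / (μ ^ 2 * lam) * (CF * ‖ρd + SQ ζt‖ + ‖ρ - NQ Z + (H - g)‖) ^ 2
      - 1 / μ * (CF * ‖SQ ηt - τd + lam⁻¹ • ζ‖ + ‖τ - NQ H‖)
        * (CF * ‖ρd + SQ ζt‖ + ‖ρ - NQ Z + (H - g)‖)

lemma minorant_toLp {gd : Space d × ℝ → Space d} (hgd : MemLp gd 2 (muP Ω T)) (lam CF μ : ℝ)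
    (η ζ : H11ZeroPer Ω T) (τ ρ : HDiv Ω T) :
    minorant σ ν lam CF μ gd η ζ τ ρ = minorantL (mulX T hσ) (mulG T hν) lam CF μ (hgd.toLp gd)
      η.toG ζ.toG ζ.toX η.toDt ζ.toDt τ.toG τ.toX ρ.toG ρ.toX := by
  have hs := isBddMul_fst (T := T) hσ
  have hn := isBddMul_fst (T := T) hν
  have hd := hs.memLp_smul η.memLp_dt
  have r1 : l2norm (muP Ω T) (res1 σ η τ (fun z => -lam⁻¹ * ζ.val z))
      = ‖mulX T hσ η.toDt - τ.toX + lam⁻¹ • ζ.toX‖ := by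
    rw [mulX, H11ZeroPer.toDt, H11ZeroPer.toX, HDiv.toX, mulL_toLp, ← MemLp.toLp_sub,
      ← MemLp.toLp_const_smul, ← MemLp.toLp_add, ← l2norm_eq]
    congr 1
    funext z
    simp only [res1, Pi.add_apply, Pi.sub_apply, Pi.smul_apply, smul_eq_mul]; ring
  have r2 : l2norm (muP Ω T) (res2 ν η τ) = ‖τ.toG - mulG T hν η.toG‖ := by
    rw [mulG, H11ZeroPer.toG, HDiv.toG, mulL_toLp, ← MemLp.toLp_sub, ← l2norm_eq]
    rfl
  have r3 : l2norm (muP Ω T) (res3 σ ζ ρ) = ‖ρ.toX + mulX T hσ ζ.toDt‖ := by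
    rw [mulX, H11ZeroPer.toDt, HDiv.toX, mulL_toLp, ← MemLp.toLp_add, ← l2norm_eq]
    rfl
  have r4 : l2norm (muP Ω T) (res4 ν gd ζ ρ η)
      = ‖ρ.toG - mulG T hν ζ.toG + (η.toG - hgd.toLp gd)‖ := by
    rw [mulG, H11ZeroPer.toG, H11ZeroPer.toG, HDiv.toG, mulL_toLp, ← MemLp.toLp_sub,
      ← MemLp.toLp_sub, ← MemLp.toLp_add, ← l2norm_eq]
    rfl
  have c1 : l2norm (muP Ω T) (fun z => η.grad z - gd z) = ‖η.toG - hgd.toLp gd‖ := by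
    rw [H11ZeroPer.toG, ← MemLp.toLp_sub, ← l2norm_eq]
    rfl
  have i1 := integrable_mul_inner hn η.memLp_grad ζ.memLp_grad
  have i2 := integrable_mul_inner hs η.memLp_dt ζ.memLp_val
  have i3 := (integrable_inner_memLp ζ.memLp_val ζ.memLp_val).const_mul lam⁻¹
  have e : ∫ z, (ν z.1 * inner ℝ (η.grad z) (ζ.grad z) + σ z.1 * η.dt z * ζ.val z
        + lam⁻¹ * ζ.val z ^ 2) ∂(muP Ω T)
      = inner ℝ (mulG T hν η.toG) ζ.toG + inner ℝ (mulX T hσ η.toDt) ζ.toX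
        + lam⁻¹ * ‖ζ.toX‖ ^ 2 := by
    rw [← real_inner_self_eq_norm_sq]
    have h1 := integral_mul_inner hn η.memLp_grad ζ.memLp_grad
    have h2 := integral_mul_inner hs η.memLp_dt ζ.memLp_val
    have h3 := inner_toLp ζ.memLp_val ζ.memLp_val
    have e' : (fun z => ν z.1 * inner ℝ (η.grad z) (ζ.grad z) + σ z.1 * η.dt z * ζ.val z
          + lam⁻¹ * ζ.val z ^ 2)
        = fun z => ν z.1 * inner ℝ (η.grad z) (ζ.grad z) + σ z.1 * inner ℝ (η.dt z) (ζ.val z)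
          + lam⁻¹ * inner ℝ (ζ.val z) (ζ.val z) := by
      funext z
      simp only [RCLike.inner_apply, conj_trivial]; ring
    rw [e']
    refine (integral_add (i1.add i2) i3).trans ?_
    refine congrArg₂ (· + ·) ((integral_add i1 i2).trans (congrArg₂ (· + ·) h1 h2)) ?_
    rw [integral_const_mul]
    exact congrArg _ h3.symm
  rw [minorant, muQ_eq, r1, r2, r3, r4, c1, e, l2norm_eq ζ.memLp_val]
  rfl

end Translation

end ParabolicOC

namespace ParabolicOC

/-! ### The minorant at solutions of the system -/

section Attainment

variable {d : ℕ} {Ω : Set (Space d)} {T : ℝ} [IsFiniteMeasure (volume.restrict Ω)]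
  {hT : 0 < T} {S : LX Ω →L[ℝ] LX Ω} {SQ : HX Ω T →L[ℝ] HX Ω T}
  {NQ : HG Ω T →L[ℝ] HG Ω T} {lam : ℝ}
  {g : HG Ω T} {y : HX Ω T} {Y : HG Ω T} {p : HX Ω T} {P : HG Ω T}

/-- The minorant at a regular solution of the optimality system, whose desired gradient `g` may
differ from the one in the minorant. -/
lemma OptSys.minorantL_eq (hSQ : ∀ j u, cX hT j (SQ u) = S (cX hT j u)) (hp : InV hT p P)
    (h : OptSys hT S NQ lam g y Y p P) {yt : HX Ω T} (hyt : IsDt hT y yt) (pt : HX Ω T)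
    (g' : HG Ω T) (CF μ : ℝ) :
    minorantL SQ NQ lam CF μ g' Y P p yt pt (NQ Y) (SQ yt + lam⁻¹ • p) (NQ P - (Y - g)) (-SQ pt)
      = costL lam g' Y p - CF ^ 2 / (μ ^ 2 * lam) * ‖g - g'‖ ^ 2 := by
  have r1 : SQ yt - (SQ yt + lam⁻¹ • p) + lam⁻¹ • p = 0 := by abel
  -- Only R₄ sees the mismatch of targets; R₁, R₂, R₃ vanish.
  have r4 : NQ P - (Y - g) - NQ P + (Y - g') = g - g' := by abel
  rw [minorantL, h.pairing_eq_zero hSQ hp hyt, r1, r4, sub_self (NQ Y), neg_add_cancel]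
  simp

end Attainment

/-! ### The constant μ₁ -/

section Mu1

variable {νlow σlow : ℝ}

lemma two_mul_mu1_sq (νlow σlow : ℝ) : 2 * mu1 νlow σlow ^ 2 = min νlow σlow ^ 2 := by
  rw [mu1, mul_pow, div_pow, Real.sq_sqrt (by norm_num)]; ring

lemma mu1_pos (hν : 0 < νlow) (hσ : 0 < σlow) : 0 < mu1 νlow σlow :=
  mul_pos (by positivity) (lt_min hν hσ)

lemma two_mul_mu1_sq_le (hν : 0 < νlow) (hσ : 0 < σlow) : 2 * mu1 νlow σlow ^ 2 ≤ νlow ^ 2 := by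
  rw [two_mul_mu1_sq]
  exact pow_le_pow_left₀ (lt_min hν hσ).le (min_le_left _ _) 2

lemma mu1_le (hν : 0 < νlow) (hσ : 0 < σlow) : mu1 νlow σlow ≤ νlow :=
  abs_le_of_sq_le_sq' (by nlinarith [two_mul_mu1_sq_le hν hσ, sq_nonneg (mu1 νlow σlow)])
    hν.le |>.2

end Mu1

/-! ### Optimal pairs, supremum and attainment -/

section Control

variable {d : ℕ} {Ω : Set (Space d)} {T : ℝ} [IsFiniteMeasure (volume.restrict Ω)]
  {σ ν : Space d → ℝ} {σlow νlow lam CF : ℝ} {gd : Space d × ℝ → Space d}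
  {hT : 0 < T} {hσ : IsBddMul (volume.restrict Ω) σ} {hν : IsBddMul (volume.restrict Ω) ν}

lemma toLp_eq_neg_smul {p : H1HalfZeroPer Ω T} {u : Space d × ℝ → ℝ} (hu : MemLp u 2 (muP Ω T)) :
    hu.toLp u = -(lam⁻¹ • p.toX) ↔ u =ᵐ[muP Ω T] fun z => -lam⁻¹ * p.val z := by
  rw [H1HalfZeroPer.toX, ← MemLp.toLp_const_smul, ← MemLp.toLp_neg, MemLp.toLp_eq_toLp_iff]
  have e : ∀ z, (-(lam⁻¹ • p.val)) z = -lam⁻¹ * p.val z := fun z => by simp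
  exact ⟨fun h => h.trans (ae_of_all _ e), fun h => h.trans (ae_of_all _ fun z => (e z).symm)⟩

lemma costL_neg_smul {V W : Type*} [NormedAddCommGroup V] [InnerProductSpace ℝ V]
    [NormedAddCommGroup W] [InnerProductSpace ℝ W] (hlam : 0 < lam) (g Y : W) (p : V) :
    1 / 2 * ‖Y - g‖ ^ 2 + lam / 2 * ‖-(lam⁻¹ • p)‖ ^ 2 = costL lam g Y p := by
  rw [costL, norm_neg, norm_smul, Real.norm_of_nonneg (inv_nonneg.2 hlam.le)]
  field_simp

lemma memLp_of_ae_eq_adjoint {p : H1HalfZeroPer Ω T} {u : Space d × ℝ → ℝ}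
    (hu : u =ᵐ[muP Ω T] fun z => -lam⁻¹ * p.val z) : MemLp u 2 (muP Ω T) :=
  (p.memLp_val.const_mul (-lam⁻¹)).ae_eq hu.symm

/-- The value of the cost functional at the solution of the optimality system. -/
lemma cost_eq_costL (hlam : 0 < lam) (hgd : MemLp gd 2 (muP Ω T)) (y p : H1HalfZeroPer Ω T)
    {u : Space d × ℝ → ℝ} (hu : u =ᵐ[muP Ω T] fun z => -lam⁻¹ * p.val z) :
    cost Ω T lam gd y u = costL lam (hgd.toLp gd) y.toG p.toX := by
  have hu' := memLp_of_ae_eq_adjoint hu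
  rw [cost_toLp hgd lam y hu', (toLp_eq_neg_smul hu').2 hu, costL_neg_smul hlam]

lemma cost_eq_add (hS : IsSymmCoercive (mulL ℝ hσ) σlow) (hN : IsSymmCoercive (mulG T hν) νlow)
    (hlam : 0 < lam) (hgd : MemLp gd 2 (muP Ω T)) {y p : H1HalfZeroPer Ω T}
    (h : OptSys hT (mulL ℝ hσ) (mulG T hν) lam (hgd.toLp gd) y.toX y.toG p.toX p.toG)
    {y' : H1HalfZeroPer Ω T} {u' : Space d × ℝ → ℝ} (hu' : MemLp u' 2 (muP Ω T))
    (hst : IsState Ω T σ ν y' u') :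
    cost Ω T lam gd y' u' = costL lam (hgd.toLp gd) y.toG p.toX
      + (1 / 2 * ‖y'.toG - y.toG‖ ^ 2 + lam / 2 * ‖hu'.toLp u' + lam⁻¹ • p.toX‖ ^ 2) := by
  rw [cost_toLp hgd lam y' hu', h.cost_eq hS hN hlam (y.inV hT) (p.inV hT) (y'.inV hT)
    ((isState_iff hσ hν hT y' hu').1 hst)]

/-- Solutions of the optimality system are optimal. -/
lemma isOptimal_of_optSys (hS : IsSymmCoercive (mulL ℝ hσ) σlow)
    (hN : IsSymmCoercive (mulG T hν) νlow)
    (hlam : 0 < lam) (hgd : MemLp gd 2 (muP Ω T)) {y p : H1HalfZeroPer Ω T}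
    (h : OptSys hT (mulL ℝ hσ) (mulG T hν) lam (hgd.toLp gd) y.toX y.toG p.toX p.toG)
    {u : Space d × ℝ → ℝ} (hu : u =ᵐ[muP Ω T] fun z => -lam⁻¹ * p.val z) :
    IsOptimal Ω T σ ν lam gd y u := by
  have hu' := memLp_of_ae_eq_adjoint hu
  refine ⟨muQ_eq Ω T ▸ hu', (isState_iff hσ hν hT y hu').2 fun v V hv => ?_,
    fun y' u' hm hst => ?_⟩
  · rw [(toLp_eq_neg_smul hu').2 hu, inner_neg_left, real_inner_smul_left]
    linarith [h.2 v V hv]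
  · rw [muQ_eq] at hm
    rw [cost_eq_costL hlam hgd y p hu, cost_eq_add hS hN hlam hgd h hm hst]
    exact le_add_of_nonneg_right (by positivity)

/-- Optimal pairs solve the optimality system. -/
lemma optSys_of_isOptimal (hS : IsSymmCoercive (mulL ℝ hσ) σlow)
    (hN : IsSymmCoercive (mulG T hν) νlow) (hCF : IsFriedrichsConst Ω CF)
    (hlam : 0 < lam) (hgd : MemLp gd 2 (muP Ω T)) {y₀ p₀ : H1HalfZeroPer Ω T}
    (h : OptSys hT (mulL ℝ hσ) (mulG T hν) lam (hgd.toLp gd) y₀.toX y₀.toG p₀.toX p₀.toG)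
    {y : H1HalfZeroPer Ω T} {u : Space d × ℝ → ℝ} (hyu : IsOptimal Ω T σ ν lam gd y u) :
    OptSys hT (mulL ℝ hσ) (mulG T hν) lam (hgd.toLp gd) y.toX y.toG p₀.toX p₀.toG ∧
      u =ᵐ[muP Ω T] fun z => -lam⁻¹ * p₀.val z := by
  obtain ⟨hu, hst, hmin⟩ := hyu
  rw [muQ_eq] at hu
  have h₀ := isOptimal_of_optSys hS hN hlam hgd h (ae_eq_refl fun z => -lam⁻¹ * p₀.val z)
  have hle := hmin _ _ h₀.1 h₀.2.1
  -- The two excess squares in the cost identity must both vanish by minimality.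
  rw [cost_eq_costL hlam hgd y₀ p₀ (ae_eq_refl _), cost_eq_add hS hN hlam hgd h hu hst] at hle
  have n1 : 0 ≤ 1 / 2 * ‖y.toG - y₀.toG‖ ^ 2 := by positivity
  have n2 : 0 ≤ lam / 2 * ‖hu.toLp u + lam⁻¹ • p₀.toX‖ ^ 2 := by positivity
  have z1 : y.toG = y₀.toG := by
    have : ‖y.toG - y₀.toG‖ ^ 2 = 0 := by linarith
    rwa [sq_eq_zero_iff, norm_eq_zero, sub_eq_zero] at this
  have z2 : hu.toLp u = -(lam⁻¹ • p₀.toX) := by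
    have : lam / 2 * ‖hu.toLp u + lam⁻¹ • p₀.toX‖ ^ 2 = 0 := by linarith
    rw [mul_eq_zero, or_iff_right (by positivity), sq_eq_zero_iff, norm_eq_zero] at this
    exact eq_neg_of_add_eq_zero_left this
  -- Equal gradients give equal states by Friedrichs.
  have z3 : y.toX = y₀.toX := by
    have := ((y.inV hT).inWQ.sub (y₀.inV hT).inWQ).norm_le hCF
    rwa [z1, sub_self, norm_zero, mul_zero, norm_le_zero_iff, sub_eq_zero] at this
  rw [z1, z3]
  exact ⟨h, (toLp_eq_neg_smul hu).1 z2⟩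

/-- The optimal value is the least upper bound of the minorant. -/
lemma isLUB_minorant (hΩ : IsOpen Ω) (hS : IsSymmCoercive (mulL ℝ hσ) σlow)
    (hN : IsSymmCoercive (mulL (Space d) hν) νlow) (hNQ : IsSymmCoercive (mulG T hν) νlow)
    (hCF : IsFriedrichsConst Ω CF) (hlam : 0 < lam) (hgd : MemLp gd 2 (muP Ω T))
    {y p : H1HalfZeroPer Ω T}
    (h : OptSys hT (mulL ℝ hσ) (mulG T hν) lam (hgd.toLp gd) y.toX y.toG p.toX p.toG) :
    IsLUB {m : ℝ | ∃ (η ζ : H11ZeroPer Ω T) (τ ρ : HDiv Ω T),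
        m = minorant σ ν lam CF (mu1 νlow σlow) gd η ζ τ ρ}
      (costL lam (hgd.toLp gd) y.toG p.toX) := by
  constructor
  · rintro m ⟨η, ζ, τ, ρ, rfl⟩
    rw [minorant_toLp hσ hν hgd]
    exact h.minorant_le (coeff_mulL hT hσ) hS hNQ hlam hCF (mu1_pos hN.pos hS.pos)
      (mu1_le hN.pos hS.pos) (two_mul_mu1_sq_le hN.pos hS.pos) (y.inV hT) η.inWQ (η.isDt hΩ hT)
      ζ.inWQ (ζ.isDt hΩ hT) τ.isDiv ρ.isDiv
  · intro b hb
    refine le_of_tendsto (tendsto_minorant_modeSum (hT := hT) (g := hgd.toLp gd) (Y := y.toG)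
      (p := p.toX) (lam := lam) (CF ^ 2 / (mu1 νlow σlow ^ 2 * lam)))
      (Eventually.of_forall fun n => hb ?_)
    have hy := (y.inV hT).inWQ.modeSum (hT := hT) n
    have hp := (p.inV hT).inWQ.modeSum (hT := hT) n
    -- The truncation solves the system for the truncated target, while the minorant keeps the full
    -- one; the gap enters through R₄ only.
    have hn := h.modeSum (coeff_mulL hT hν) (y.inV hT).inWQ (p.inV hT).inWQ n
    obtain ⟨yt, hyt⟩ := exists_isDt_modeSum (hT := hT) n y.toX
    obtain ⟨pt, hpt⟩ := exists_isDt_modeSum (hT := hT) n p.toX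
    obtain ⟨η, h1, h2, h3⟩ := hy.exists_h11 hyt
    obtain ⟨ζ, h4, h5, h6⟩ := hp.exists_h11 hpt
    obtain ⟨τ, h7, h8⟩ :=
      (hn.isDiv_flux (coeff_mulL hT hσ) (coeff_mulL hT hν) hy hp hyt).exists_hDiv
    obtain ⟨ρ, h9, h10⟩ :=
      (hn.isDiv_adjoint_flux (coeff_mulL hT hσ) (coeff_mulL hT hν) hy hp hpt).exists_hDiv
    refine ⟨η, ζ, τ, ρ, ?_⟩
    rw [minorant_toLp hσ hν hgd, h2, h3, h4, h5, h6, h7, h8, h9, h10,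
      hn.minorantL_eq (coeff_mulL hT hσ) ⟨hp, hpt.isHalf⟩ hyt]

/-- The minorant attains the optimal value at a regular solution. -/
lemma exists_minorant_eq (hΩ : IsOpen Ω) (hS : IsSymmCoercive (mulL ℝ hσ) σlow)
    (hN : IsSymmCoercive (mulL (Space d) hν) νlow)
    (hlam : 0 < lam) (hgd : MemLp gd 2 (muP Ω T)) {y p : H1HalfZeroPer Ω T}
    (h : OptSys hT (mulL ℝ hσ) (mulG T hν) lam (hgd.toLp gd) y.toX y.toG p.toX p.toG)
    (ζ : H11ZeroPer Ω T) (hζ : ζ.val =ᵐ[muP Ω T] p.val) (CF μ : ℝ) :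
    ∃ (η : H11ZeroPer Ω T) (τ ρ : HDiv Ω T), η.val =ᵐ[muP Ω T] y.val ∧
      (τ.val =ᵐ[muP Ω T] fun z => ν z.1 • y.grad z) ∧
      (ρ.val =ᵐ[muP Ω T] fun z => ν z.1 • p.grad z - (y.grad z - gd z)) ∧
      minorant σ ν lam CF μ gd η ζ τ ρ = cost Ω T lam gd y (fun z => -lam⁻¹ * p.val z) := by
  have hy := (y.inV hT).inWQ
  have hp := (p.inV hT).inWQ
  have e1 : ζ.toX = p.toX := (MemLp.toLp_eq_toLp_iff _ _).2 hζ
  -- ζ carries its own gradient, which agrees with that of p by uniqueness of weak gradients.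
  have e2 : ζ.toG = p.toG := by
    have := ζ.inWQ.sub hp
    rw [e1, sub_self] at this
    exact sub_eq_zero.1 (this.eq_zero hΩ)
  have hpt : IsDt hT p.toX ζ.toDt := e1 ▸ ζ.isDt hΩ hT
  obtain ⟨yt, hyt⟩ := h.exists_isDt (coeff_mulL hT hν) hS hN hlam hy hp
  obtain ⟨η, h1, h2, h3⟩ := hy.exists_h11 hyt
  obtain ⟨τ, h7, h8⟩ :=
    (h.isDiv_flux (coeff_mulL hT hσ) (coeff_mulL hT hν) hy hp hyt).exists_hDiv
  obtain ⟨ρ, h9, h10⟩ :=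
    (h.isDiv_adjoint_flux (coeff_mulL hT hσ) (coeff_mulL hT hν) hy hp hpt).exists_hDiv
  refine ⟨η, τ, ρ, (MemLp.toLp_eq_toLp_iff _ _).1 h1, ?_, ?_, ?_⟩
  · rw [HDiv.toG, H1HalfZeroPer.toG, mulL_toLp] at h7
    exact (MemLp.toLp_eq_toLp_iff _ _).1 h7
  · rw [HDiv.toG, H1HalfZeroPer.toG, H1HalfZeroPer.toG, mulL_toLp, ← MemLp.toLp_sub,
      ← MemLp.toLp_sub] at h9
    exact (MemLp.toLp_eq_toLp_iff _ _).1 h9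
  · rw [minorant_toLp hσ hν hgd, e1, e2, h2, h3, h7, h8, h9, h10,
      h.minorantL_eq (coeff_mulL hT hσ) (p.inV hT) hyt, sub_self, norm_zero,
      cost_eq_costL hlam hgd y p (ae_eq_refl _)]
    ring

end Control

end ParabolicOC

end

/-! ### The main theorem -/

theorem mainTheorem9 (d : ℕ) (hd1 : 1 ≤ d) (hd3 : d ≤ 3)
    (Ω : Set (ParabolicOC.Space d)) (hΩo : IsOpen Ω) (hΩb : Bornology.IsBounded Ω)
    (T : ℝ) (hT : 0 < T)
    (σ ν : ParabolicOC.Space d → ℝ)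
    (hσm : AEMeasurable σ (volume.restrict Ω)) (hνm : AEMeasurable ν (volume.restrict Ω))
    (σlow σup νlow νup : ℝ) (hσlow : 0 < σlow) (hνlow : 0 < νlow)
    (hσ : ∀ x ∈ Ω, σlow ≤ σ x ∧ σ x ≤ σup) (hν : ∀ x ∈ Ω, νlow ≤ ν x ∧ ν x ≤ νup)
    (lam : ℝ) (hlam : 0 < lam)
    (CF : ℝ) (hCF : ParabolicOC.IsFriedrichsConst Ω CF)
    (gd : ParabolicOC.Space d × ℝ → ParabolicOC.Space d)
    (hgd : MemLp gd 2 (ParabolicOC.muQ Ω T)) :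
    -- the optimal control problem is solvable
    (∃ (y : ParabolicOC.H1HalfZeroPer Ω T) (u : ParabolicOC.Space d × ℝ → ℝ),
      ParabolicOC.IsOptimal Ω T σ ν lam gd y u) ∧
    -- minimizing is equivalent to solving the optimality system
    (∀ (y : ParabolicOC.H1HalfZeroPer Ω T) (u : ParabolicOC.Space d × ℝ → ℝ),
      ParabolicOC.IsOptimal Ω T σ ν lam gd y u ↔
        ∃ p : ParabolicOC.H1HalfZeroPer Ω T,
          ParabolicOC.OptimalitySystem Ω T σ ν lam gd y p ∧
            u =ᵐ[ParabolicOC.muQ Ω T] fun z => -lam⁻¹ * p.val z) ∧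
    -- the minorant is a lower bound of the optimal value, and its supremum is the optimal value
    (∀ (y : ParabolicOC.H1HalfZeroPer Ω T) (u : ParabolicOC.Space d × ℝ → ℝ),
      ParabolicOC.IsOptimal Ω T σ ν lam gd y u →
        (∀ (η ζ : ParabolicOC.H11ZeroPer Ω T) (τ ρ : ParabolicOC.HDiv Ω T),
          ParabolicOC.minorant σ ν lam CF (ParabolicOC.mu1 νlow σlow) gd η ζ τ ρ
            ≤ ParabolicOC.cost Ω T lam gd y u) ∧
        IsLUB {m : ℝ | ∃ (η ζ : ParabolicOC.H11ZeroPer Ω T) (τ ρ : ParabolicOC.HDiv Ω T),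
            m = ParabolicOC.minorant σ ν lam CF (ParabolicOC.mu1 νlow σlow) gd η ζ τ ρ}
          (ParabolicOC.cost Ω T lam gd y u)) ∧
    -- the supremum is attained at the exact solution when the adjoint state is in `H^{1,1}_{0,per}(Q)`
    (∀ y p : ParabolicOC.H1HalfZeroPer Ω T,
      ParabolicOC.OptimalitySystem Ω T σ ν lam gd y p →
        ∀ ζ : ParabolicOC.H11ZeroPer Ω T, ζ.val =ᵐ[ParabolicOC.muQ Ω T] p.val →
          ∃ (η : ParabolicOC.H11ZeroPer Ω T) (τ ρ : ParabolicOC.HDiv Ω T),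
            η.val =ᵐ[ParabolicOC.muQ Ω T] y.val ∧
            (τ.val =ᵐ[ParabolicOC.muQ Ω T] fun z => ν z.1 • y.grad z) ∧
            (ρ.val =ᵐ[ParabolicOC.muQ Ω T] fun z => ν z.1 • p.grad z - (y.grad z - gd z)) ∧
            ParabolicOC.minorant σ ν lam CF (ParabolicOC.mu1 νlow σlow) gd η ζ τ ρ
              = ParabolicOC.cost Ω T lam gd y (fun z => -lam⁻¹ * p.val z)) := by
  have : IsFiniteMeasure (volume.restrict Ω) := isFiniteMeasure_restrict.2 hΩb.measure_lt_top.ne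
  have hae : ∀ᵐ x ∂(volume.restrict Ω), x ∈ Ω := ae_restrict_mem hΩo.measurableSet
  have hσb : ParabolicOC.IsBddMul (volume.restrict Ω) σ := ⟨hσm, σup, hae.mono fun x hx => by
    rw [abs_of_pos (hσlow.trans_le (hσ x hx).1)]; exact (hσ x hx).2⟩
  have hνb : ParabolicOC.IsBddMul (volume.restrict Ω) ν := ⟨hνm, νup, hae.mono fun x hx => by
    rw [abs_of_pos (hνlow.trans_le (hν x hx).1)]; exact (hν x hx).2⟩
  have hσae : ∀ᵐ x ∂(volume.restrict Ω), σlow ≤ σ x := hae.mono fun x hx => (hσ x hx).1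
  have hνae : ∀ᵐ x ∂(volume.restrict Ω), νlow ≤ ν x := hae.mono fun x hx => (hν x hx).1
  have hS : ParabolicOC.IsSymmCoercive (ParabolicOC.mulL ℝ hσb) σlow :=
    ParabolicOC.isSymmCoercive_mulL hσb hσlow hσae
  have hN : ParabolicOC.IsSymmCoercive (ParabolicOC.mulL (ParabolicOC.Space d) hνb) νlow :=
    ParabolicOC.isSymmCoercive_mulL hνb hνlow hνae
  have hNQ : ParabolicOC.IsSymmCoercive (ParabolicOC.mulG T hνb) νlow :=
    ParabolicOC.isSymmCoercive_mulL (ParabolicOC.isBddMul_fst hνb) hνlow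
      (ParabolicOC.ae_comp_fst hνae _)
  rw [ParabolicOC.muQ_eq] at hgd
  have hsys := ParabolicOC.optimalitySystem_iff hσb hνb hT hgd lam
  obtain ⟨y₀, p₀, h₀⟩ : ∃ y p, ParabolicOC.OptimalitySystem Ω T σ ν lam gd y p := by
    obtain ⟨y, Y, p, P, hy, hp, h⟩ := ParabolicOC.exists_optSys (hT := hT)
      (ParabolicOC.coeff_mulL hT hνb) hS hN hlam hCF (hgd.toLp gd)
    obtain ⟨y', rfl, rfl⟩ := hy.exists_h1Half
    obtain ⟨p', rfl, rfl⟩ := hp.exists_h1Half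
    exact ⟨y', p', (hsys y' p').2 h⟩
  have hopt : ∀ y p u, ParabolicOC.OptimalitySystem Ω T σ ν lam gd y p →
      u =ᵐ[ParabolicOC.muP Ω T] (fun z => -lam⁻¹ * p.val z) →
      ParabolicOC.IsOptimal Ω T σ ν lam gd y u := fun y p u h hu =>
    ParabolicOC.isOptimal_of_optSys hS hNQ hlam hgd ((hsys y p).1 h) hu
  rw [ParabolicOC.muQ_eq]
  refine ⟨⟨y₀, _, hopt y₀ p₀ _ h₀ (ae_eq_refl _)⟩, fun y u => ⟨fun h => ?_, ?_⟩, fun y u h => ?_,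
    fun y p h ζ hζ => ParabolicOC.exists_minorant_eq hΩo hS hN hlam hgd ((hsys y p).1 h) ζ hζ CF _⟩
  -- The adjoint state p₀ of one fixed solution serves every optimal pair.
  · obtain ⟨h1, h2⟩ :=
      ParabolicOC.optSys_of_isOptimal hS hNQ hCF hlam hgd ((hsys y₀ p₀).1 h₀) h
    exact ⟨p₀, (hsys y p₀).2 h1, h2⟩
  · rintro ⟨p, h, hu⟩
    exact hopt y p u h hu
  · obtain ⟨h1, h2⟩ :=
      ParabolicOC.optSys_of_isOptimal hS hNQ hCF hlam hgd ((hsys y₀ p₀).1 h₀) h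
    rw [ParabolicOC.cost_eq_costL hlam hgd y p₀ h2]
    have hlub := ParabolicOC.isLUB_minorant hΩo hS hN hNQ hCF hlam hgd h1
    exact ⟨fun η ζ τ ρ => hlub.1 ⟨η, ζ, τ, ρ, rfl⟩, hlub⟩
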